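/- **Setting.** Let $x\in\mathbb R^M$ be an observable and $y=(y_1,\dots,y_K)\in\{1,\dots,L\}^K$ a latent variable. Let $\mu$ be a $\sigma$-finite Borel measure on $\mathbb R^M$ (Lebesgue measure for continuous data, a counting measure for discrete data; $dx$ below means $\mu(dx)$). Let $p(x,y|w)$, $w\in W\subseteq\mathbb R^d$ ($W$ measurable), be a family of probability densities, jointly measurable in $(x,w)$, with $p(x|w)=\sum_y p(x,y|w)$, and let $\varphi$ be a (measurable) prior probability density on $W$. The data $(x_i,y_i)$, $i=1,\dots,n$, are i.i.d. with density $q(x,y)=p(x,y|w^*)$ for some $w^*\in W$; in particular the latent variables of the model and of the true distribution have the same dimension and range (non-redundant case). Put $q(x)=\sum_y q(x,y)$, $q(Y^n|X^n)=\prod_i q(x_i,y_i)/q(x_i)$ and $$p(Y^n|X^n)=\frac{\int_W\prod_i p(x_i,y_i|w)\varphi(w)\,dw}{\int_W\prod_i p(x_i|w)\varphi(w)\,dw}.$$ For $K_t<K$ let $y^{(11)}=(y_1,\dots,y_{K_t})$ be the target part of $y$, let $Y_{11}^n=(y^{(11)}_1,\dots,y^{(11)}_n)$, and let $p(x,y^{(11)}|w)$,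 $q(x,y^{(11)})$, $p(Y_{11}^n|X^n)$, $q(Y_{11}^n|X^n)$ be obtained by summing out the other label coordinates. The error functions are $$D_{n1}(n)=\frac1nE_{X^n}\Big[\sum_{Y^n}q(Y^n|X^n)\ln\frac{q(Y^n|X^n)}{p(Y^n|X^n)}\Big],\qquad D_{n2}(n)=\frac1nE_{X^n}\Big[\sum_{Y_{11}^n}q(Y_{11}^n|X^n)\ln\frac{q(Y_{11}^n|X^n)}{p(Y_{11}^n|X^n)}\Big],$$ where $X^n$ has density $\prod_i q(x_i)$. The Fisher information matrices $I_X(w),I_{XY}(w),I_{XY_{11}}(w)$ have entries $$E\big[\partial_{w_i}\ln f(z|w)\,\partial_{w_j}\ln f(z|w)\big]$$ with $f(z|w)=p(x|w)$, $p(x,y|w)$, $p(x,y^{(11)}|w)$ respectively, the expectation being with respect to $q$. **Regularity.** Let $\nu$ be the reference measure of $z$: $\mu$ for $z=x$, and the product of $\mu$ with the counting measure of the labels for $z=(x,y)$ and $z=(x,y^{(11)})$. Call a family $f(z|w)$ *regular at $w^*$* if there is an open set $N$ with $w^*\in N\subseteq W$ such that: (i) for $\nu$-almost every $z$, $w\mapsto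 f(z|w)$ is $C^2$ on $N$ and is either everywhere positive or identically zero on $N$; (ii) the second partial derivatives in $w$ of $f(z|w)$ are bounded in absolute value, for $\nu$-almost every $z$ and all $w\in N$, by a $\nu$-integrable function of $z$; (iii) the score $\nabla_w\ln f(z|w^*)$ is square integrable under $f(z|w^*)\,\nu(dz)$; (iv) the second partial derivatives in $w$ of $\ln f(z|w)$ are bounded in absolute value, for $\nu$-almost every $z$ and all $w\in N$, by a function of $z$ that is square integrable under $f(z|w^*)\,\nu(dz)$. **Theorem.** Assume that $p(x|w)$ and $p(x,y|w)$ are regular at $w^*$, that $I_X(w^*)$ is positive definite, that $\varphi$ is continuous at $w^*$ with $\varphi(w^*)>0$, and that $w^*$ is identified by the observable: if $w_k\in W$ and the distributions with densities $p(x|w_k)$ converge weakly to the distribution with density $q(x)$, then $w_k\to w^*$. Then the expectation in $D_{n1}(n)$ exists and is finite for every $n\ge 1$, and as $n\to\infty$ $$D_{n1}(n)=\frac1{2n}\ln\det\big(I_{XY}(w^*)I_X(w^*)^{-1}\big)+o\Big(\frac1n\Big).$$ Likewise, for every $K_t<K$ such that $p(x,y^{(11)}|w)$ is regular at $w^*$,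 the expectation in $D_{n2}(n)$ exists and is finite for every $n\ge1$, and $$D_{n2}(n)=\frac1{2n}\ln\det\big(I_{XY_{11}}(w^*)I_X(w^*)^{-1}\big)+o\Big(\frac1n\Big).$$ -/

import Mathlib

open MeasureTheory Filter Topology Asymptotics

noncomputable section

namespace LatentBayes

/-- Observations `x ∈ ℝ^M`. -/
abbrev Obs (M : ℕ) : Type := Fin M → ℝ

/-- Labels `y ∈ {1, …, L}^K`. -/
abbrev Label (K L : ℕ) : Type := Fin K → Fin L

/-- Parameters `w ∈ ℝ^d`, where `d = dim w`. -/
abbrev Par (d : ℕ) : Type := Fin d → ℝ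

/-- The target part `(y_1, …, y_{Kt})` of a label `(y_1, …, y_K)`. -/
def target {K L Kt : ℕ} (h : Kt ≤ K) (y : Label K L) : Label Kt L :=
  fun k => y (Fin.castLE h k)

/-- A parametric model `p(x, y | w)` of probability densities of the pair of an observable and a
latent variable, together with a prior density on the parameter set `W`. The densities refer to a
`σ`-finite measure `μ` on `ℝ^M` for the observable (Lebesgue measure for continuous observations,
a counting measure for discrete ones) and to the counting measure for the label. -/
structure Model (M K L d : ℕ) where
  μ : Measure (Obs M)
  sigmaFinite : SigmaFinite μ
  W : Set (Par d)
  measurableSet_W : MeasurableSet W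
  p : Obs M → Label K L → Par d → ℝ
  measurable_p : ∀ y, Measurable (fun z : Obs M × Par d => p z.1 y z.2)
  p_nonneg : ∀ x y, ∀ w ∈ W, 0 ≤ p x y w
  integral_p : ∀ w ∈ W, ∫ x, ∑ y, p x y w ∂μ = 1
  prior : Par d → ℝ
  measurable_prior : Measurable prior
  prior_nonneg : ∀ w ∈ W, 0 ≤ prior w
  integral_prior : ∫ w in W, prior w = 1

/-! ### Marginal densities -/

/-- `g(x) = ∑_y g(x, y)`. -/
def margX {M K L : ℕ} (g : Obs M → Label K L → ℝ) (x : Obs M) : ℝ :=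
  ∑ y, g x y

/-- `g(x, y^{(11)}) = ∑_{y^{(12)}} g(x, y^{(11)}, y^{(12)})`. -/
def margTarget {M K L Kt : ℕ} (h : Kt ≤ K) (g : Obs M → Label K L → ℝ)
    (x : Obs M) (t : Label Kt L) : ℝ :=
  ∑ y with target h y = t, g x y

namespace Model

variable {M K L d : ℕ} (m : Model M K L d)

/-- The family `p(x | w)`. -/
def densX : Obs M → Par d → ℝ :=
  fun x w => margX (fun x y => m.p x y w) x

/-- The family `p(x, y | w)`. -/
def densXY : Obs M × Label K L → Par d → ℝ :=
  fun z w => m.p z.1 z.2 w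

/-- The family `p(x, y^{(11)} | w)`. -/
def densTarget {Kt : ℕ} (h : Kt ≤ K) : Obs M × Label Kt L → Par d → ℝ :=
  fun z w => margTarget h (fun x y => m.p x y w) z.1 z.2

/-! ### Bayesian estimation of the labels -/

/-- `Z(X^n)`. -/
def evidenceX {n : ℕ} (X : Fin n → Obs M) : ℝ :=
  ∫ w in m.W, (∏ i, m.densX (X i) w) * m.prior w

/-- `Z(X^n, Y^n)`. -/
def evidenceXY {n : ℕ} (X : Fin n → Obs M) (Y : Fin n → Label K L) : ℝ :=
  ∫ w in m.W, (∏ i, m.p (X i) (Y i) w) * m.prior w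

/-- The estimated distribution `p(Y^n | X^n) = Z(X^n, Y^n) / Z(X^n)`. -/
def estimated {n : ℕ} (X : Fin n → Obs M) (Y : Fin n → Label K L) : ℝ :=
  m.evidenceXY X Y / m.evidenceX X

end Model

/-- The true distribution `q(Y^n | X^n) = ∏ q(x_i, y_i) / q(x_i)`. -/
def trueCond {M K L n : ℕ} (q : Obs M → Label K L → ℝ)
    (X : Fin n → Obs M) (Y : Fin n → Label K L) : ℝ :=
  ∏ i, q (X i) (Y i) / margX q (X i)

/-- The marginal `r(Y_{11}^n)` of a distribution `r(Y^n)`: the coordinates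
`k = Kt + 1, …, K` of all labels are summed out. -/
def sumNuisance {K L Kt n : ℕ} (h : Kt ≤ K) (r : (Fin n → Label K L) → ℝ)
    (T : Fin n → Label Kt L) : ℝ :=
  ∑ Y : Fin n → Label K L with (∀ i, target h (Y i) = T i), r Y

/-! ### Error functions -/

/-- The Kullback-Leibler divergence `∑ a ln (a / b)` on a finite set. -/
def klSum {ι : Type*} [Fintype ι] (a b : ι → ℝ) : ℝ :=
  ∑ k, a k * Real.log (a k / b k)

/-- The distribution of `X^n`: independent observations with density `q(x)`. -/
def lawX {M K L : ℕ} (μ : Measure (Obs M)) (q : Obs M → Label K L → ℝ) (n : ℕ) :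
    Measure (Fin n → Obs M) :=
  Measure.pi (fun _ => μ.withDensity (fun x => ENNReal.ofReal (margX q x)))

namespace Model

variable {M K L d : ℕ} (m : Model M K L d)

/-- The divergence from `q(Y^n | X^n)` to `p(Y^n | X^n)`. -/
def jointLoss (q : Obs M → Label K L → ℝ) {n : ℕ} (X : Fin n → Obs M) : ℝ :=
  klSum (trueCond q X) (m.estimated X)

/-- The divergence from `q(Y_{11}^n | X^n)` to `p(Y_{11}^n | X^n)`. -/
def targetLoss (q : Obs M → Label K L → ℝ) {Kt : ℕ} (h : Kt ≤ K) {n : ℕ}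
    (X : Fin n → Obs M) : ℝ :=
  klSum (sumNuisance h (trueCond q X)) (sumNuisance h (m.estimated X))

/-- The joint error function `D_{n1}(n)`. -/
def errorJoint (q : Obs M → Label K L → ℝ) (n : ℕ) : ℝ :=
  1 / (n : ℝ) * ∫ X, m.jointLoss q X ∂(lawX m.μ q n)

/-- The marginal error function `D_{n2}(n)`. -/
def errorTarget (q : Obs M → Label K L → ℝ) {Kt : ℕ} (h : Kt ≤ K) (n : ℕ) : ℝ :=
  1 / (n : ℝ) * ∫ X, m.targetLoss q h X ∂(lawX m.μ q n)

end Model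

/-! ### Fisher information and regularity -/

/-- The partial derivative `∂g/∂w_i` at `w`. -/
def pderiv {d : ℕ} (i : Fin d) (g : Par d → ℝ) (w : Par d) : ℝ :=
  fderiv ℝ g w (Pi.single i 1)

/-- The Fisher information matrix at `w` of a family `f(z | w)`; the expectation is taken with
respect to the density `g` of the true distribution of `z`. -/
def fisherInfo {d : ℕ} {Z : Type*} [MeasurableSpace Z] (ν : Measure Z) (g : Z → ℝ)
    (f : Z → Par d → ℝ) (w : Par d) : Matrix (Fin d) (Fin d) ℝ :=
  Matrix.of fun i j =>
    ∫ z, pderiv i (fun v => Real.log (f z v)) w * pderiv j (fun v => Real.log (f z v)) w * g z ∂ν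

/-- The usual regularity conditions on a family of densities `f(z | w)`, `w ∈ W`, near an interior
point `w₀` of `W`: smoothness and a locally constant support, domination of the second derivatives
of the density, square integrability of the score at `w₀`, and a square integrable bound on the
second derivatives of the log-likelihood. -/
def RegularAt {d : ℕ} {Z : Type*} [MeasurableSpace Z] (ν : Measure Z) (W : Set (Par d))
    (f : Z → Par d → ℝ) (w₀ : Par d) : Prop :=
  ∃ N : Set (Par d), IsOpen N ∧ w₀ ∈ N ∧ N ⊆ W ∧
    (∀ᵐ z ∂ν, ContDiffOn ℝ 2 (f z) N ∧ ((∀ w ∈ N, 0 < f z w) ∨ (∀ w ∈ N, f z w = 0))) ∧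
    (∃ B : Z → ℝ, Integrable B ν ∧
      ∀ᵐ z ∂ν, ∀ w ∈ N, ∀ i j, |pderiv i (pderiv j (f z)) w| ≤ B z) ∧
    (∀ i, Integrable (fun z => pderiv i (fun v => Real.log (f z v)) w₀ ^ 2 * f z w₀) ν) ∧
    (∃ G : Z → ℝ, Integrable (fun z => G z ^ 2 * f z w₀) ν ∧
      ∀ᵐ z ∂ν, ∀ w ∈ N, ∀ i j,
        |pderiv i (pderiv j (fun v => Real.log (f z v))) w| ≤ G z)

namespace Model

variable {M K L d : ℕ} (m : Model M K L d)

/-- The parameter `w₀` is determined by the distribution of the observable, in the stable sense: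
if `w_k ∈ W` and the distributions with densities `p(x | w_k)` converge weakly to the one with
density `p(x | w₀)`, then `w_k → w₀`. (Constant sequences give: `p(· | w) = p(· | w₀)` only for
`w = w₀`.) -/
def IdentifiableAt (w₀ : Par d) : Prop :=
  ∀ u : ℕ → Par d, (∀ k, u k ∈ m.W) →
    (∀ f : BoundedContinuousFunction (Obs M) ℝ,
      Tendsto (fun k => ∫ x, f x * m.densX x (u k) ∂m.μ) atTop
        (𝓝 (∫ x, f x * m.densX x w₀ ∂m.μ))) →
    Tendsto u atTop (𝓝 w₀)

/-- `I_X(w)`. -/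
def infoX (q : Obs M → Label K L → ℝ) (w : Par d) : Matrix (Fin d) (Fin d) ℝ :=
  fisherInfo m.μ (margX q) m.densX w

/-- `I_{XY}(w)`. -/
def infoXY (q : Obs M → Label K L → ℝ) (w : Par d) : Matrix (Fin d) (Fin d) ℝ :=
  fisherInfo (m.μ.prod Measure.count) (fun z => q z.1 z.2) m.densXY w

/-- `I_{XY_{11}}(w)`. -/
def infoTarget (q : Obs M → Label K L → ℝ) {Kt : ℕ} (h : Kt ≤ K) (w : Par d) :
    Matrix (Fin d) (Fin d) ℝ :=
  fisherInfo (m.μ.prod Measure.count) (fun z => margTarget h q z.1 z.2) (m.densTarget h) w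

end Model

end LatentBayes

end

noncomputable section

namespace LatentBayes

open scoped Matrix

/-! ### Partial derivatives and second order expansions -/

section Calculus

variable {d : ℕ}

/-! For a family `f` of densities let `Y` be the evidence of a sample divided by its true density
(`evidenceRatio`). Both conditional laws of the labels are quotients of densities or evidences, so
the divergence given `X^n` equals `log Y` of the observations minus the conditional mean of `log Y`
of the labelled sample (`targetLoss_ae_eq`). In expectation this is a difference of two expected
log-evidences, and the theorem follows from one expansion, valid for any regular family with
separating statistics and Fisher information `J`: E log Y = -(d/2) log n + log φ(w₀) + log
(gaussConst J) + d/2 + o(1) (`tendsto_integral_log_evidenceRatio`). In the difference only the terms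
-(1/2) log det J survive (`log_gaussConst`). The joint error is the case `Kt = K` of the marginal
one.

The expansion is Laplace's method carried out in expectation. With u = √n (w - w₀) and normalised
score S, the log-likelihood ratio is u·S - u·Ju/2 up to an error small in mean, uniformly on balls
(`exists_lan_remainder`). The Gaussian integral contributes gaussConst J · exp(S·J⁻¹S/2), and E
S·J⁻¹S = d. Convergence in probability would not suffice, so the two bounds are proved separately in
mean. Lower bound (`eventually_le_integral_log_evidenceRatio`): only a ball of local parameters is
kept, and uniform integrability of ‖S‖² handles the samples whose Gaussian centre leaves that ball.
Upper bound (`eventually_integral_log_evidenceRatio_le`): the tangent line of the logarithm gives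
log Y' ≤ T + log c₀ - 1 + Y' e^{-T}/c₀ for Y' = n^{d/2} Y, c₀ = φ(w₀) gaussConst J and any T. Here T
is S·J⁻¹S/2 plus two terms of small mean, one of which is a penalty. By Tonelli and change of
measure, the far part of E[Y' e^{-T}] is bounded one parameter at a time. The penalty, built from
bounded statistics whose means move by at least a multiple of min(‖w - w₀‖, 1), makes that part
small.

Such statistics exist (`exists_isSeparating`): near w₀ they are bounded approximations of the
scores, which work because I_X is positive definite; away from w₀ they are finitely many bounded
continuous functions, supplied by identifiability. Read as functions that ignore the labels, they
also separate the labelled family (`IsSeparating.comp_fst`), whose Fisher information is then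
automatically positive definite (`posDef_scoreCov`). -/

lemma fderiv_apply_eq_sum_pderiv (g : Par d → ℝ) (w v : Par d) :
    fderiv ℝ g w v = ∑ j, v j * pderiv j g w := by
  conv_lhs => rw [pi_eq_sum_univ' v, map_sum]
  refine Finset.sum_congr rfl fun j _ => ?_
  rw [map_smul, smul_eq_mul, pderiv]

lemma contDiffOn_pderiv {g : Par d → ℝ} {s : Set (Par d)} (hs : IsOpen s)
    (hg : ContDiffOn ℝ 2 g s) (i : Fin d) : ContDiffOn ℝ 1 (pderiv i g) s :=
  (hg.fderiv_of_isOpen hs (by norm_num)).clm_apply contDiffOn_const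

lemma continuousOn_pderiv_pderiv {g : Par d → ℝ} {s : Set (Par d)} (hs : IsOpen s)
    (hg : ContDiffOn ℝ 2 g s) (i j : Fin d) : ContinuousOn (pderiv i (pderiv j g)) s :=
  (((contDiffOn_pderiv hs hg j).fderiv_of_isOpen (m := 0) hs (by norm_num)).clm_apply
    contDiffOn_const).continuousOn

lemma hasDerivAt_comp_line {g : Par d → ℝ} {w v : Par d} {t : ℝ}
    (hg : DifferentiableAt ℝ g (w + t • v)) :
    HasDerivAt (fun t : ℝ => g (w + t • v)) (∑ j, v j * pderiv j g (w + t • v)) t := by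
  rw [← fderiv_apply_eq_sum_pderiv]
  have h : HasDerivAt (fun t : ℝ => w + t • v) v t := by
    simpa using ((hasDerivAt_id t).smul_const v).const_add w
  exact hg.hasFDerivAt.comp_hasDerivAt t h

/-- The error of a second order expansion, when the second derivatives stay within `C` of given
numbers along the way. -/
lemma abs_taylor_remainder_le {g : Par d → ℝ} {w v : Par d} {r C : ℝ}
    (hg : ContDiffOn ℝ 2 g (Metric.ball w r)) (hv : ‖v‖ < r) (c : Fin d → Fin d → ℝ)
    (hC : ∀ u, ‖u‖ ≤ ‖v‖ → ∀ i j, |pderiv i (pderiv j g) (w + u) - c i j| ≤ C) :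
    |g (w + v) - g w - ∑ i, v i * pderiv i g w - 1 / 2 * ∑ i, ∑ j, v i * v j * c i j|
      ≤ (d : ℝ) ^ 2 * C * ‖v‖ ^ 2 := by
  -- The remainder along the segment and its derivative both vanish at 0, so two applications of the
  -- mean value inequality reduce everything to the bound on the second derivative. The factor `d ^
  -- 2` comes from a double sum estimated in the sup norm.
  set k : ℝ → ℝ := fun t => g (w + t • v) - g w - t * ∑ i, v i * pderiv i g w
    - t ^ 2 * (1 / 2 * ∑ i, ∑ j, v i * v j * c i j) with hk
  set k' : ℝ → ℝ := fun t => (∑ j, v j * pderiv j g (w + t • v)) - ∑ i, v i * pderiv i g w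
    - t * ∑ i, ∑ j, v i * v j * c i j with hk'
  have hnorm : ∀ t ∈ Set.Icc (0 : ℝ) 1, ‖t • v‖ ≤ ‖v‖ := fun t ht => by
    rw [norm_smul, Real.norm_eq_abs, abs_of_nonneg ht.1]
    exact mul_le_of_le_one_left (norm_nonneg _) ht.2
  have hmem : ∀ t ∈ Set.Icc (0 : ℝ) 1, w + t • v ∈ Metric.ball w r := fun t ht => by
    simpa [mem_ball_iff_norm] using (hnorm t ht).trans_lt hv
  have hd : ∀ t ∈ Set.Icc (0 : ℝ) 1, DifferentiableAt ℝ g (w + t • v) := fun t ht =>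
    (hg.differentiableOn (by norm_num)).differentiableAt (Metric.isOpen_ball.mem_nhds (hmem t ht))
  have hd' : ∀ t ∈ Set.Icc (0 : ℝ) 1, ∀ j, DifferentiableAt ℝ (pderiv j g) (w + t • v) :=
    fun t ht j => ((contDiffOn_pderiv Metric.isOpen_ball hg j).differentiableOn
      (by norm_num)).differentiableAt (Metric.isOpen_ball.mem_nhds (hmem t ht))
  have hK : ∀ t ∈ Set.Icc (0 : ℝ) 1, HasDerivAt k (k' t) t := fun t ht => by
    have h1 := (hasDerivAt_comp_line (hd t ht)).sub_const (g w)
    have h2 := (hasDerivAt_id t).mul_const (∑ i, v i * pderiv i g w)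
    have h3 := ((hasDerivAt_id t).pow 2).mul_const (1 / 2 * ∑ i, ∑ j, v i * v j * c i j)
    refine ((h1.sub h2).sub h3).congr_deriv ?_
    simp only [hk', id]
    push_cast
    ring
  have hK' : ∀ t ∈ Set.Icc (0 : ℝ) 1, HasDerivAt k'
      (∑ i, ∑ j, v i * v j * (pderiv i (pderiv j g) (w + t • v) - c i j)) t := fun t ht => by
    have h1 : HasDerivAt (fun t => ∑ j, v j * pderiv j g (w + t • v))
        (∑ j, v j * ∑ i, v i * pderiv i (pderiv j g) (w + t • v)) t :=
      HasDerivAt.fun_sum fun j _ => (hasDerivAt_comp_line (hd' t ht j)).const_mul (v j)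
    have h2 := (hasDerivAt_id t).mul_const (∑ i, ∑ j, v i * v j * c i j)
    refine ((h1.sub_const (∑ i, v i * pderiv i g w)).sub h2).congr_deriv ?_
    simp only [Finset.mul_sum, mul_sub, one_mul, Finset.sum_sub_distrib]
    rw [Finset.sum_comm]
    congr 1
    exact Finset.sum_congr rfl fun i _ => Finset.sum_congr rfl fun j _ => by ring
  have hbound : ∀ t ∈ Set.Icc (0 : ℝ) 1,
      ‖∑ i, ∑ j, v i * v j * (pderiv i (pderiv j g) (w + t • v) - c i j)‖
        ≤ (d : ℝ) ^ 2 * C * ‖v‖ ^ 2 := fun t ht => by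
    calc _ ≤ ∑ i : Fin d, ∑ j : Fin d, ‖v‖ * ‖v‖ * C := by
          refine (norm_sum_le _ _).trans (Finset.sum_le_sum fun i _ =>
            (norm_sum_le _ _).trans (Finset.sum_le_sum fun j _ => ?_))
          rw [norm_mul, norm_mul]
          gcongr
          · exact norm_le_pi_norm v i
          · exact norm_le_pi_norm v j
          · exact hC _ (hnorm t ht) i j
      _ = _ := by simp; ring
  have hconv : Convex ℝ (Set.Icc (0 : ℝ) 1) := convex_Icc 0 1
  have hk'0 : k' 0 = 0 := by simp [hk']
  have hk0 : k 0 = 0 := by simp [hk]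
  have hb' : ∀ t ∈ Set.Icc (0 : ℝ) 1, ‖k' t‖ ≤ (d : ℝ) ^ 2 * C * ‖v‖ ^ 2 := fun t ht => by
    have h := hconv.norm_image_sub_le_of_norm_hasDerivWithin_le
      (fun x hx => (hK' x hx).hasDerivWithinAt) hbound (Set.left_mem_Icc.2 zero_le_one) ht
    rw [hk'0, sub_zero, sub_zero, Real.norm_eq_abs t, abs_of_nonneg ht.1] at h
    refine h.trans (mul_le_of_le_one_right ?_ ht.2)
    exact (norm_nonneg _).trans (hbound t ht)
  have h := hconv.norm_image_sub_le_of_norm_hasDerivWithin_le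
      (fun x hx => (hK x hx).hasDerivWithinAt) hb' (Set.left_mem_Icc.2 zero_le_one)
      (Set.right_mem_Icc.2 zero_le_one)
  rw [hk0, sub_zero, sub_zero, norm_one, mul_one, Real.norm_eq_abs] at h
  have e : k 1 = g (w + v) - g w - ∑ i, v i * pderiv i g w
      - 1 / 2 * ∑ i, ∑ j, v i * v j * c i j := by simp only [hk, one_smul, one_pow, one_mul]
  rwa [e] at h

/-- A family of functions that are almost all differentiable at `w` has measurable partial
derivatives there, as soon as it is measurable in the neighbourhood of `w`. -/
lemma aemeasurable_pderiv {Z : Type*} [MeasurableSpace Z] {ν : Measure Z} {g : Z → Par d → ℝ}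
    {s : Set (Par d)} (hs : IsOpen s) {w : Par d} (hw : w ∈ s)
    (hm : ∀ u ∈ s, AEMeasurable (fun z => g z u) ν)
    (hd : ∀ᵐ z ∂ν, DifferentiableAt ℝ (g z) w) (i : Fin d) :
    AEMeasurable (fun z => pderiv i (g z) w) ν := by
  have ht : Tendsto (fun k : ℕ => (1 / ((k : ℝ) + 1))) atTop (𝓝[≠] 0) :=
    tendsto_nhdsWithin_iff.2 ⟨tendsto_one_div_add_atTop_nhds_zero_nat,
      Eventually.of_forall fun k => by simp; positivity⟩
  have hmem : ∀ᶠ k : ℕ in atTop, w + (1 / ((k : ℝ) + 1)) • (Pi.single i 1 : Par d) ∈ s := by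
    have : Tendsto (fun t : ℝ => w + t • (Pi.single i 1 : Par d)) (𝓝 0) (𝓝 w) := by
      have h : Continuous fun t : ℝ => w + t • (Pi.single i 1 : Par d) := by fun_prop
      simpa using h.tendsto 0
    exact (this.comp tendsto_one_div_add_atTop_nhds_zero_nat) (hs.mem_nhds hw)
  obtain ⟨k₀, hk₀⟩ := eventually_atTop.1 hmem
  -- The partial derivative is a limit of difference quotients; the shift by `k₀` keeps every
  -- evaluation point inside `s`.
  refine aemeasurable_of_tendsto_metrizable_ae atTop
    (f := fun k z => (1 / (((k + k₀ : ℕ) : ℝ) + 1))⁻¹ *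
      (g z (w + (1 / (((k + k₀ : ℕ) : ℝ) + 1)) • Pi.single i 1) - g z w)) (fun k => ?_) ?_
  · exact ((hm _ (hk₀ _ (Nat.le_add_left _ _))).sub (hm w hw)).const_mul _
  · filter_upwards [hd] with z hz
    have h := (hasDerivAt_iff_tendsto_slope_zero.1
      (hz.hasFDerivAt.hasLineDerivAt (Pi.single i 1 : Par d)))
    have h' := (h.comp ht).comp (tendsto_add_atTop_nat k₀)
    simpa [Function.comp_def, pderiv] using h'

end Calculus

/-! ### Sums over independent samples -/

section Sampling

variable {Z : Type*} [MeasurableSpace Z] {P : Measure Z}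

/-- The law of `n` independent draws from `P`. -/
abbrev sampleLaw (P : Measure Z) (n : ℕ) : Measure (Fin n → Z) := Measure.pi fun _ => P

lemma lintegral_prod_apply_sampleLaw [IsProbabilityMeasure P] {n : ℕ}
    {F : Fin n → Z → ENNReal} (hF : ∀ i, Measurable (F i)) :
    ∫⁻ z, ∏ i, F i (z i) ∂sampleLaw P n = ∏ i, ∫⁻ x, F i x ∂P := by
  have hind : ProbabilityTheory.iIndepFun (fun (i : Fin n) (z : Fin n → Z) => F i (z i))
      (sampleLaw P n) := ProbabilityTheory.iIndepFun_pi fun i => (hF i).aemeasurable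
  rw [ProbabilityTheory.lintegral_prod_eq_prod_lintegral_of_indepFun Finset.univ _ hind
    (fun i => (hF i).comp (measurable_pi_apply i))]
  exact Finset.prod_congr rfl fun i _ =>
    (measurePreserving_eval (fun _ : Fin n => P) i).lintegral_comp (hF i)

lemma lintegral_prod_sampleLaw [IsProbabilityMeasure P] (n : ℕ) {F : Z → ENNReal}
    (hF : Measurable F) : ∫⁻ z, ∏ i, F (z i) ∂sampleLaw P n = (∫⁻ x, F x ∂P) ^ n := by
  rw [lintegral_prod_apply_sampleLaw fun _ => hF]
  simp

lemma integral_exp_sum_sampleLaw [SigmaFinite P] (n : ℕ) (h : Z → ℝ) :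
    ∫ z, Real.exp (∑ i, h (z i)) ∂sampleLaw P n = (∫ x, Real.exp (h x) ∂P) ^ n := by
  simp_rw [Real.exp_sum]
  simpa using integral_fintype_prod_eq_pow (ι := Fin n) (μ := P) (fun x => Real.exp (h x))

/-- Square integrable functions are close in `L²` to bounded ones. -/
lemma exists_simpleFunc_integral_sq_sub_le {g : Z → ℝ} (hg : MemLp g 2 P) {ε : ℝ} (hε : 0 < ε) :
    ∃ φ : SimpleFunc Z ℝ, ∫ x, (g x - φ x) ^ 2 ∂P ≤ ε := by
  obtain ⟨φ, h1, h2⟩ := hg.exists_simpleFunc_eLpNorm_sub_lt (by norm_num)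
    (ε := ENNReal.ofReal (Real.sqrt ε)) (by simpa using Real.sqrt_pos.2 hε)
  refine ⟨φ, ?_⟩
  rw [(hg.sub h2).eLpNorm_eq_integral_rpow_norm (by norm_num) (by norm_num)] at h1
  have h3 := (ENNReal.ofReal_lt_ofReal_iff (Real.sqrt_pos.2 hε)).1 h1
  simp only [ENNReal.toReal_ofNat, Pi.sub_apply, Real.norm_eq_abs, Real.rpow_two, sq_abs] at h3
  rw [← one_div, ← Real.sqrt_eq_rpow] at h3
  exact (Real.sqrt_lt_sqrt_iff (integral_nonneg fun x => sq_nonneg _)).1 h3 |>.le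

variable [IsProbabilityMeasure P]

lemma integrable_sum_sampleLaw (n : ℕ) {g : Z → ℝ} (hg : Integrable g P) :
    Integrable (fun z => ∑ i, g (z i)) (sampleLaw P n) :=
  integrable_finsetSum _ fun _ _ => integrable_comp_eval hg

lemma integral_sum_sampleLaw (n : ℕ) {g : Z → ℝ} (hg : Integrable g P) :
    ∫ z, ∑ i, g (z i) ∂sampleLaw P n = n * ∫ x, g x ∂P := by
  rw [integral_finsetSum _ fun _ _ => integrable_comp_eval hg]
  simp [integral_comp_eval (μ := fun _ : Fin n => P) hg.aestronglyMeasurable]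

lemma memLp_sum_sampleLaw (n : ℕ) {g : Z → ℝ} (hg : MemLp g 2 P) :
    MemLp (fun z => ∑ i, g (z i)) 2 (sampleLaw P n) :=
  memLp_finsetSum _ fun i _ => hg.comp_measurePreserving (measurePreserving_eval _ i)

lemma integral_sq_sum_sampleLaw (n : ℕ) {g : Z → ℝ} (hg : MemLp g 2 P) (h0 : ∫ x, g x ∂P = 0) :
    ∫ z, (∑ i, g (z i)) ^ 2 ∂sampleLaw P n = n * ∫ x, g x ^ 2 ∂P := by
  have h := ProbabilityTheory.variance_sum_pi (ι := Fin n) (μ := fun _ => P) (X := fun _ => g)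
    fun _ => hg
  have e : (∑ i : Fin n, fun z : Fin n → Z => g (z i)) = fun z => ∑ i, g (z i) := by
    ext z; simp
  rw [e, ProbabilityTheory.variance_eq_sub (memLp_sum_sampleLaw n hg),
    integral_sum_sampleLaw n (hg.integrable (by norm_num)), h0] at h
  rw [ProbabilityTheory.variance_eq_sub hg, h0] at h
  simpa using h

/-- Polarisation of `integral_sq_sum_sampleLaw`, applied to `g + h`. -/
lemma integral_mul_sum_sampleLaw (n : ℕ) {g h : Z → ℝ} (hg : MemLp g 2 P) (hh : MemLp h 2 P)
    (hg0 : ∫ x, g x ∂P = 0) (hh0 : ∫ x, h x ∂P = 0) :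
    ∫ z, (∑ i, g (z i)) * (∑ i, h (z i)) ∂sampleLaw P n = n * ∫ x, g x * h x ∂P := by
  have key : ∀ {Ω : Type _} [MeasurableSpace Ω] (Q : Measure Ω) {a b : Ω → ℝ}, MemLp a 2 Q →
      MemLp b 2 Q →
      ∫ x, (a x + b x) ^ 2 ∂Q = ∫ x, a x ^ 2 ∂Q + ∫ x, b x ^ 2 ∂Q + 2 * ∫ x, a x * b x ∂Q := by
    intro Ω _ Q a b ha hb
    have hab : Integrable (fun x => a x * b x) Q := ha.integrable_mul hb
    rw [← integral_const_mul, ← integral_add ha.integrable_sq hb.integrable_sq,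
      ← integral_add (ha.integrable_sq.fun_add hb.integrable_sq) (hab.const_mul 2)]
    exact integral_congr_ae (Eventually.of_forall fun x => by ring)
  have h1 := integral_sq_sum_sampleLaw n (hg.add hh) (by
    simp only [Pi.add_apply]
    rw [integral_add (hg.integrable (by norm_num)) (hh.integrable (by norm_num)), hg0, hh0,
      add_zero])
  simp only [Pi.add_apply, Finset.sum_add_distrib] at h1
  rw [key _ (memLp_sum_sampleLaw n hg) (memLp_sum_sampleLaw n hh), key _ hg hh,
    integral_sq_sum_sampleLaw n hg hg0, integral_sq_sum_sampleLaw n hh hh0] at h1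
  linarith

/-- The weak law of large numbers in `L¹`, for square integrable summands. -/
lemma tendsto_integral_abs_average_sub {g : Z → ℝ} (hg : MemLp g 2 P) :
    Tendsto (fun n : ℕ => ∫ z, |(n : ℝ)⁻¹ * ∑ i, g (z i) - ∫ x, g x ∂P| ∂sampleLaw P n)
      atTop (𝓝 0) := by
  set m := ∫ x, g x ∂P with hm
  set V := ∫ x, (g x - m) ^ 2 ∂P with hV
  have hgm : MemLp (fun x => g x - m) 2 P := hg.sub (memLp_const m)
  have h0 : ∫ x, (g x - m) ∂P = 0 := by
    rw [integral_sub (hg.integrable (by norm_num)) (integrable_const _)]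
    simp [hm]
  have hV0 : 0 ≤ V := integral_nonneg fun x => sq_nonneg _
  have hlim : Tendsto (fun n : ℕ => Real.sqrt (V / n)) atTop (𝓝 0) := by
    have := (tendsto_const_div_atTop_nhds_zero_nat V).sqrt
    simpa using this
  refine squeeze_zero' (Eventually.of_forall fun n => integral_nonneg fun _ => abs_nonneg _) ?_ hlim
  filter_upwards [eventually_gt_atTop 0] with n hn
  have hn' : (n : ℝ) ≠ 0 := by positivity
  have hX : MemLp (fun z : Fin n → Z => (n : ℝ)⁻¹ * ∑ i, (g (z i) - m)) 2 (sampleLaw P n) :=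
    (memLp_sum_sampleLaw n hgm).const_mul _
  have e : ∀ z : Fin n → Z, (n : ℝ)⁻¹ * ∑ i, g (z i) - m = (n : ℝ)⁻¹ * ∑ i, (g (z i) - m) := by
    intro z
    rw [Finset.sum_sub_distrib]
    simp
    field_simp
  simp_rw [e]
  refine Real.le_sqrt_of_sq_le ?_
  -- E|X| ≤ (E X²)^{1/2} is read off from the nonnegativity of the variance of |X|; the second
  -- moment is V / n.
  have hvar := ProbabilityTheory.variance_nonneg
    |fun z : Fin n → Z => (n : ℝ)⁻¹ * ∑ i, (g (z i) - m)| (sampleLaw P n)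
  rw [ProbabilityTheory.variance_eq_sub hX.abs] at hvar
  simp only [Pi.pow_apply, Pi.abs_apply, sq_abs, mul_pow] at hvar
  rw [integral_const_mul, integral_sq_sum_sampleLaw n hgm h0] at hvar
  have : ((n : ℝ)⁻¹) ^ 2 * (n * V) = V / n := by field_simp
  linarith

/-- Exponential moments of normalised sums of bounded centred variables. -/
lemma integral_exp_normalized_sum_le {g : Z → ℝ} {A : ℝ} (hg : AEStronglyMeasurable g P)
    (hA : ∀ x, |g x| ≤ A) (h0 : ∫ x, g x ∂P = 0) {n : ℕ} (hn : A ^ 2 < n) :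
    ∫ z, Real.exp ((Real.sqrt n)⁻¹ * ∑ i, g (z i)) ∂sampleLaw P n ≤ Real.exp (A ^ 2) := by
  have hn0 : (0 : ℝ) < n := (sq_nonneg A).trans_lt hn
  have hs : 0 < Real.sqrt n := Real.sqrt_pos.2 hn0
  have hgi : Integrable g P := Integrable.of_bound hg A (Eventually.of_forall hA)
  have hb : ∀ x, |(Real.sqrt n)⁻¹ * g x| ≤ A * (Real.sqrt n)⁻¹ := fun x => by
    rw [abs_mul, abs_of_pos (inv_pos.2 hs), mul_comm]
    exact mul_le_mul_of_nonneg_right (hA x) (inv_pos.2 hs).le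
  have hA1 : A * (Real.sqrt n)⁻¹ ≤ 1 := by
    rw [← div_eq_mul_inv, div_le_one hs]
    exact Real.le_sqrt_of_sq_le hn.le
  have hsq : ((Real.sqrt n)⁻¹) ^ 2 = (n : ℝ)⁻¹ := by rw [inv_pow, Real.sq_sqrt hn0.le]
  -- e^t ≤ 1 + t + t² for |t| ≤ 1; the condition `A ^ 2 < n` brings the exponents into that range.
  have hpt : ∀ x, Real.exp ((Real.sqrt n)⁻¹ * g x)
      ≤ 1 + (Real.sqrt n)⁻¹ * g x + A ^ 2 * (n : ℝ)⁻¹ := fun x => by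
    have h1 := (abs_le.1 (Real.abs_exp_sub_one_sub_id_le ((hb x).trans hA1))).2
    have h2 : ((Real.sqrt n)⁻¹ * g x) ^ 2 ≤ A ^ 2 * (n : ℝ)⁻¹ := by
      rw [← sq_abs, ← hsq, ← mul_pow]
      exact pow_le_pow_left₀ (abs_nonneg _) (hb x) 2
    linarith
  have hint : Integrable (fun x => 1 + (Real.sqrt n)⁻¹ * g x + A ^ 2 * (n : ℝ)⁻¹) P :=
    ((integrable_const _).add (hgi.const_mul _)).add (integrable_const _)
  have hone : ∫ x, Real.exp ((Real.sqrt n)⁻¹ * g x) ∂P ≤ Real.exp (A ^ 2 * (n : ℝ)⁻¹) := by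
    calc _ ≤ ∫ x, (1 + (Real.sqrt n)⁻¹ * g x + A ^ 2 * (n : ℝ)⁻¹) ∂P :=
          integral_mono_of_nonneg (Eventually.of_forall fun x => (Real.exp_pos _).le) hint
            (Eventually.of_forall hpt)
      _ = A ^ 2 * (n : ℝ)⁻¹ + 1 := by
          rw [integral_add ((integrable_const _).fun_add (hgi.const_mul _)) (integrable_const _),
            integral_add (integrable_const _) (hgi.const_mul _), integral_const_mul, h0]
          simp; ring
      _ ≤ _ := Real.add_one_le_exp _
  have e : ∀ z : Fin n → Z, (Real.sqrt n)⁻¹ * ∑ i, g (z i) = ∑ i, (Real.sqrt n)⁻¹ * g (z i) :=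
    fun z => Finset.mul_sum _ _ _
  simp_rw [e]
  rw [integral_exp_sum_sampleLaw n (fun x => (Real.sqrt n)⁻¹ * g x)]
  calc _ ≤ (Real.exp (A ^ 2 * (n : ℝ)⁻¹)) ^ n :=
        pow_le_pow_left₀ (integral_nonneg fun x => (Real.exp_pos _).le) hone n
    _ = Real.exp (A ^ 2) := by
        rw [← Real.exp_nat_mul]
        congr 1
        field_simp

/-- The squares of the normalised sums `n^{-1/2} ∑ g(z_i)` are uniformly integrable. -/
lemma uniformIntegrable_normalized_sum_sq {g : Z → ℝ} (hg : MemLp g 2 P) (h0 : ∫ x, g x ∂P = 0)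
    {ε : ℝ} (hε : 0 < ε) :
    ∃ R : ℝ, 0 < R ∧ ∀ᶠ n : ℕ in atTop, ∃ U : (Fin n → Z) → ℝ, Integrable U (sampleLaw P n) ∧
      ∫ z, U z ∂sampleLaw P n ≤ ε ∧ (∀ z, 0 ≤ U z) ∧
      ∀ z : Fin n → Z, R < |(Real.sqrt n)⁻¹ * ∑ i, g (z i)| →
        ((Real.sqrt n)⁻¹ * ∑ i, g (z i)) ^ 2 ≤ U z := by
  -- Truncation: `g = g₁ + g₂` with `g₁` bounded and centred, so that its normalised sums have
  -- exponential moments bounded in `n`, and `g₂` centred of small variance.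
  obtain ⟨φ, hφ⟩ := exists_simpleFunc_integral_sq_sub_le hg (ε := ε / 8) (by positivity)
  obtain ⟨A₀, hA₀⟩ := φ.exists_forall_norm_le
  have hφL : MemLp φ 2 P := MemLp.of_bound φ.aestronglyMeasurable A₀ (Eventually.of_forall hA₀)
  set b := ∫ x, φ x ∂P with hb
  set g₁ : Z → ℝ := fun x => φ x - b with hg₁
  set g₂ : Z → ℝ := fun x => g x - g₁ x with hg₂
  have hφi : Integrable φ P := hφL.integrable (by norm_num)
  have hg₁L : MemLp g₁ 2 P := hφL.sub (memLp_const b)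
  have hg₂L : MemLp g₂ 2 P := hg.sub hg₁L
  have hg₁0 : ∫ x, g₁ x ∂P = 0 := by
    rw [hg₁, integral_sub hφi (integrable_const _)]; simp [hb]
  have hg₂0 : ∫ x, g₂ x ∂P = 0 := by
    rw [hg₂, integral_sub (hg.integrable (by norm_num)) (hg₁L.integrable (by norm_num)), h0, hg₁0,
      sub_zero]
  -- Since `-b` is the mean of `g - φ`, the function `g₂` is `g - φ` centred, and centring does not
  -- increase the second moment.
  have hg₂ε : ∫ x, g₂ x ^ 2 ∂P ≤ ε / 8 := by
    refine le_trans ?_ hφ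
    have hd : MemLp (fun x => g x - φ x) 2 P := hg.sub hφL
    have hdi := hd.integrable (by norm_num : (1 : ENNReal) ≤ 2)
    have hdb : ∫ x, (g x - φ x) ∂P = - b := by
      rw [integral_sub (hg.integrable (by norm_num)) hφi, h0, zero_sub]
    have e : ∀ x, g₂ x ^ 2 = (g x - φ x) ^ 2 + (2 * b * (g x - φ x) + b ^ 2) := fun x => by
      simp only [hg₂, hg₁]; ring
    simp_rw [e]
    rw [integral_add hd.integrable_sq ((hdi.const_mul _).fun_add (integrable_const _)),
      integral_add (hdi.const_mul _) (integrable_const _), integral_const_mul, hdb]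
    simp
    nlinarith [sq_nonneg b]
  obtain ⟨A, hA⟩ : ∃ A, ∀ x, |g₁ x| ≤ A := ⟨A₀ + |b|, fun x =>
    (abs_sub _ _).trans (add_le_add_left (hA₀ x) _)⟩
  set E := Real.exp (A ^ 2) with hE
  have hEpos : 0 < E := Real.exp_pos _
  -- `B` makes the exponential part of the majorant cost ε/8, and `R ^ 2` below makes its last term
  -- cost at most ε/8.
  set B := 48 * E * 8 / ε with hB
  have hBpos : 0 < B := by positivity
  set V := ∫ x, g x ^ 2 ∂P with hV
  have hV0 : 0 ≤ V := integral_nonneg fun x => sq_nonneg _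
  set R := Real.sqrt (B * (V + 1) * 8 / ε) with hR
  have hR2 : R ^ 2 = B * (V + 1) * 8 / ε := Real.sq_sqrt (by positivity)
  have hRpos : 0 < R := Real.sqrt_pos.2 (by positivity)
  refine ⟨R, hRpos, ?_⟩
  obtain ⟨n₀, hn₀⟩ := exists_nat_gt (A ^ 2)
  filter_upwards [eventually_ge_atTop n₀] with n hn
  have hnA : A ^ 2 < n := hn₀.trans_le (by exact_mod_cast hn)
  have hn0 : (0 : ℝ) < n := (sq_nonneg A).trans_lt hnA
  have hsq : ((Real.sqrt n)⁻¹) ^ 2 = (n : ℝ)⁻¹ := by rw [inv_pow, Real.sq_sqrt hn0.le]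
  set S : (Z → ℝ) → (Fin n → Z) → ℝ := fun g z => (Real.sqrt n)⁻¹ * ∑ i, g (z i) with hS
  have hSL : ∀ {g : Z → ℝ}, MemLp g 2 P → MemLp (S g) 2 (sampleLaw P n) := fun hg =>
    (memLp_sum_sampleLaw n hg).const_mul _
  have hSsq : ∀ {g : Z → ℝ}, MemLp g 2 P → ∫ x, g x ∂P = 0 →
      ∫ z, S g z ^ 2 ∂sampleLaw P n = ∫ x, g x ^ 2 ∂P := fun {g} hg h0 => by
    simp only [hS, mul_pow, hsq]
    rw [integral_const_mul, integral_sq_sum_sampleLaw n hg h0]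
    field_simp
  have hSneg : ∀ z, -(S g₁ z) = S (fun x => -g₁ x) z := fun z => by
    simp [hS]
  have hexp1 : ∫ z, Real.exp (S g₁ z) ∂sampleLaw P n ≤ E :=
    integral_exp_normalized_sum_le hg₁L.1 hA hg₁0 hnA
  have hexp2 : ∫ z, Real.exp (-(S g₁ z)) ∂sampleLaw P n ≤ E := by
    simp_rw [hSneg]
    exact integral_exp_normalized_sum_le hg₁L.1.neg (by simpa using hA)
      (by rw [integral_neg', hg₁0, neg_zero]) hnA
  have hbdd : ∀ z, |S g₁ z| ≤ (Real.sqrt n)⁻¹ * (n * A) := fun z => by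
    simp only [hS]
    rw [abs_mul, abs_of_nonneg (inv_nonneg.2 (Real.sqrt_nonneg _))]
    gcongr
    refine (Finset.abs_sum_le_sum_abs _ _).trans ((Finset.sum_le_sum fun i _ => hA (z i)).trans ?_)
    simp
  have hexpi : ∀ c : ℝ, |c| ≤ 1 → Integrable (fun z => Real.exp (c * S g₁ z)) (sampleLaw P n) := by
    intro c hc
    refine Integrable.of_bound (Real.continuous_exp.comp_aestronglyMeasurable
      ((hSL hg₁L).1.const_mul c)) (Real.exp ((Real.sqrt n)⁻¹ * (n * A)))
      (Eventually.of_forall fun z => ?_)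
    rw [Real.norm_eq_abs, Real.abs_exp, Real.exp_le_exp]
    refine (le_abs_self _).trans ?_
    rw [abs_mul]
    exact (mul_le_of_le_one_left (abs_nonneg _) hc).trans (hbdd z)
  have hexpi1 := hexpi 1 (by norm_num)
  have hexpi2 := hexpi (-1) (by norm_num)
  simp only [one_mul, neg_mul] at hexpi1 hexpi2
  have hfour : ∀ x : ℝ, x ^ 4 ≤ 24 * (Real.exp x + Real.exp (-x)) := fun x => by
    have h := Real.pow_div_factorial_le_exp |x| (abs_nonneg x) 4
    have h4 : ((Nat.factorial 4 : ℕ) : ℝ) = 24 := by norm_num [Nat.factorial]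
    rw [h4, show |x| ^ 4 = x ^ 4 from by
      rw [← sq_abs, show (4 : ℕ) = 2 * 2 from rfl, pow_mul, pow_mul] at *; simp] at h
    have hx : Real.exp |x| ≤ Real.exp x + Real.exp (-x) := by
      rcases abs_cases x with h | h <;> rw [h.1] <;> linarith [Real.exp_pos x, Real.exp_pos (-x)]
    linarith
  -- The majorant comes from S² ≤ 2S₁² + 2S₂² and 2S₁² ≤ S₁⁴/B + B. The fourth power is bounded by
  -- exponentials, and the constant B by B S²/R², because |S| > R.
  refine ⟨fun z => 2 * S g₂ z ^ 2 + (24 / B * (Real.exp (S g₁ z) + Real.exp (-(S g₁ z)))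
    + B / R ^ 2 * S g z ^ 2), ?_, ?_, fun z => by positivity, fun z hz => ?_⟩
  · exact ((hSL hg₂L).integrable_sq.const_mul _).add (((hexpi1.add hexpi2).const_mul _).add
      ((hSL hg).integrable_sq.const_mul _))
  · rw [integral_add ((hSL hg₂L).integrable_sq.const_mul _) (((hexpi1.fun_add hexpi2).const_mul _).fun_add
      ((hSL hg).integrable_sq.const_mul _)), integral_add ((hexpi1.fun_add hexpi2).const_mul _)
      ((hSL hg).integrable_sq.const_mul _), integral_const_mul, integral_const_mul,
      integral_const_mul, integral_add hexpi1 hexpi2, hSsq hg₂L hg₂0, hSsq hg h0]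
    have h1 : 24 / B * (∫ z, Real.exp (S g₁ z) ∂sampleLaw P n
        + ∫ z, Real.exp (-(S g₁ z)) ∂sampleLaw P n) ≤ 24 / B * (E + E) := by gcongr
    have h2 : 24 / B * (E + E) = ε / 8 := by rw [hB]; field_simp; ring
    have h3 : B / R ^ 2 * V ≤ ε / 8 := by
      rw [hR2]
      have : B / (B * (V + 1) * 8 / ε) * V = ε / 8 * (V / (V + 1)) := by field_simp
      rw [this]
      exact mul_le_of_le_one_right (by positivity) ((div_le_one (by positivity)).2 (by linarith))
    linarith
  · have hsum : S g z = S g₁ z + S g₂ z := by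
      simp only [hS, hg₂, ← mul_add, ← Finset.sum_add_distrib]
      simp
    change R < |S g z| at hz
    change S g z ^ 2 ≤ _
    have hR1 : 1 ≤ S g z ^ 2 / R ^ 2 := by
      rw [one_le_div (by positivity), ← sq_abs (S g z)]
      exact pow_le_pow_left₀ hRpos.le hz.le 2
    have h5 : 2 * S g₁ z ^ 2 ≤ S g₁ z ^ 4 / B + B := by
      have : S g₁ z ^ 4 / B + B - 2 * S g₁ z ^ 2 = (S g₁ z ^ 2 - B) ^ 2 / B := by field_simp; ring
      have h' : 0 ≤ (S g₁ z ^ 2 - B) ^ 2 / B := by positivity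
      linarith
    have h6 : S g₁ z ^ 4 / B ≤ 24 / B * (Real.exp (S g₁ z) + Real.exp (-(S g₁ z))) := by
      rw [div_mul_eq_mul_div]
      gcongr
      exact hfour _
    have h7 : B ≤ B / R ^ 2 * S g z ^ 2 := by
      rw [div_mul_eq_mul_div, mul_div_assoc]
      exact le_mul_of_one_le_right hBpos.le hR1
    have h8 : S g z ^ 2 ≤ 2 * S g₁ z ^ 2 + 2 * S g₂ z ^ 2 := by
      rw [hsum]; nlinarith [sq_nonneg (S g₁ z - S g₂ z)]
    linarith

end Sampling

/-! ### Remainder of the second order expansion -/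

section Remainder

variable {d : ℕ}

/-- The remainder of the second order expansion of `g` at `w`. -/
def taylorRem (g : Par d → ℝ) (w v : Par d) : ℝ :=
  g (w + v) - g w - ∑ i, v i * pderiv i g w
    - 1 / 2 * ∑ i, ∑ j, v i * v j * pderiv i (pderiv j g) w

/-- Peano's form of the remainder, from continuity of the second derivatives at `w`; `η` absorbs the
factor `d ^ 2`. -/
lemma exists_abs_taylorRem_le {g : Par d → ℝ} {w : Par d} {r : ℝ} (hr : 0 < r)
    (hg : ContDiffOn ℝ 2 g (Metric.ball w r)) {ε : ℝ} (hε : 0 < ε) :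
    ∃ δ > 0, ∀ v, ‖v‖ < δ → |taylorRem g w v| ≤ ε * ‖v‖ ^ 2 := by
  set η := ε / ((d : ℝ) ^ 2 + 1) with hη
  have hηpos : 0 < η := by positivity
  have hcont : ∀ i j, ∀ᶠ u in 𝓝 w, |pderiv i (pderiv j g) u - pderiv i (pderiv j g) w| < η :=
    fun i j => (((continuousOn_pderiv_pderiv Metric.isOpen_ball hg i j).continuousAt
      (Metric.ball_mem_nhds w hr)).eventually (Metric.ball_mem_nhds _ hηpos))
  obtain ⟨δ, hδ, hδ'⟩ := Metric.eventually_nhds_iff.1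
    (eventually_all.2 fun i => eventually_all.2 fun j => hcont i j)
  refine ⟨min δ r, lt_min hδ hr, fun v hv => ?_⟩
  have h := abs_taylor_remainder_le hg (hv.trans_le (min_le_right _ _))
    (fun i j => pderiv i (pderiv j g) w) (C := η) fun u hu i j =>
      (hδ' (by simpa using hu.trans_lt (hv.trans_le (min_le_left _ _))) i j).le
  refine h.trans ?_
  gcongr
  rw [hη, mul_div_assoc', div_le_iff₀ (by positivity)]
  nlinarith

/-- Supplies the pointwise limit when the density is differentiated twice under the integral in
`sum_integral_logHess`. -/
lemma tendsto_taylorRem_smul {g : Par d → ℝ} {w : Par d} {r : ℝ} (hr : 0 < r)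
    (hg : ContDiffOn ℝ 2 g (Metric.ball w r)) (v : Par d) :
    Tendsto (fun t : ℝ => (t ^ 2)⁻¹ * taylorRem g w (t • v)) (𝓝[≠] 0) (𝓝 0) := by
  rw [Metric.tendsto_nhds]
  intro ε hε
  obtain ⟨δ, hδ, h⟩ := exists_abs_taylorRem_le hr hg (ε := ε / (2 * (‖v‖ ^ 2 + 1))) (by positivity)
  have h1 : ∀ᶠ t : ℝ in 𝓝[≠] 0, ‖t • v‖ < δ := by
    have : Tendsto (fun t : ℝ => ‖t • v‖) (𝓝 0) (𝓝 0) := by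
      have h : Continuous fun t : ℝ => ‖t • v‖ := by fun_prop
      simpa using h.tendsto 0
    exact (this.mono_left nhdsWithin_le_nhds).eventually (gt_mem_nhds hδ)
  filter_upwards [h1, self_mem_nhdsWithin] with t ht ht0
  have ht0' : t ≠ 0 := ht0
  have ht2 : 0 < t ^ 2 := by positivity
  rw [Real.dist_eq, sub_zero, abs_mul, abs_of_pos (inv_pos.2 ht2)]
  have h2 := h _ ht
  rw [norm_smul, mul_pow, Real.norm_eq_abs, sq_abs] at h2
  calc (t ^ 2)⁻¹ * |taylorRem g w (t • v)|
      ≤ (t ^ 2)⁻¹ * (ε / (2 * (‖v‖ ^ 2 + 1)) * (t ^ 2 * ‖v‖ ^ 2)) := by gcongr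
    _ = ε / 2 * (‖v‖ ^ 2 / (‖v‖ ^ 2 + 1)) := by field_simp
    _ ≤ ε / 2 * 1 := by
        gcongr
        exact (div_le_one (by positivity)).2 (by linarith)
    _ < ε := by linarith

end Remainder

/-! ### Regular families of densities -/

/-- A jointly measurable family of probability densities, regular at `w₀`. -/
structure IsRegularFamily {d : ℕ} {Z : Type*} [MeasurableSpace Z] (ν : Measure Z)
    (W : Set (Par d)) (f : Z → Par d → ℝ) (w₀ : Par d) : Prop where
  measurableSet : MeasurableSet W
  mem : w₀ ∈ W
  measurable_uncurry : Measurable fun z : Z × Par d => f z.1 z.2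
  nonneg : ∀ z, ∀ w ∈ W, 0 ≤ f z w
  integral_eq_one : ∀ w ∈ W, ∫ z, f z w ∂ν = 1
  regular : RegularAt ν W f w₀

/-- The distribution with density `f(z | w₀)`. -/
def trueLaw {d : ℕ} {Z : Type*} [MeasurableSpace Z] (ν : Measure Z) (f : Z → Par d → ℝ)
    (w₀ : Par d) : Measure Z := ν.withDensity fun z => ENNReal.ofReal (f z w₀)

/-- The score at `w₀`. -/
def score {d : ℕ} {Z : Type*} (f : Z → Par d → ℝ) (w₀ : Par d) (z : Z) : Par d :=
  fun i => pderiv i (fun v => Real.log (f z v)) w₀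

/-- The second derivatives of the log-likelihood at `w₀`. -/
def logHess {d : ℕ} {Z : Type*} (f : Z → Par d → ℝ) (w₀ : Par d) (z : Z) (i j : Fin d) : ℝ :=
  pderiv i (pderiv j fun v => Real.log (f z v)) w₀

/-- The regularity conditions on a ball, with nonnegative bounds. -/
structure LocalBounds {d : ℕ} {Z : Type*} [MeasurableSpace Z] (ν : Measure Z)
    (W : Set (Par d)) (f : Z → Par d → ℝ) (w₀ : Par d) (r : ℝ) (B G : Z → ℝ) : Prop where
  pos : 0 < r
  subset : Metric.ball w₀ r ⊆ W
  B_nonneg : ∀ z, 0 ≤ B z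
  integrable_B : Integrable B ν
  G_nonneg : ∀ z, 0 ≤ G z
  memLp_G : MemLp G 2 (trueLaw ν f w₀)
  smooth : ∀ᵐ z ∂ν, ContDiffOn ℝ 2 (f z) (Metric.ball w₀ r)
  pos_or_zero : ∀ᵐ z ∂ν, (∀ w ∈ Metric.ball w₀ r, 0 < f z w) ∨ ∀ w ∈ Metric.ball w₀ r, f z w = 0
  le_B : ∀ᵐ z ∂ν, ∀ w ∈ Metric.ball w₀ r, ∀ i j, |pderiv i (pderiv j (f z)) w| ≤ B z
  pos_ae : ∀ᵐ z ∂trueLaw ν f w₀, ∀ w ∈ Metric.ball w₀ r, 0 < f z w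
  smooth_log : ∀ᵐ z ∂trueLaw ν f w₀,
    ContDiffOn ℝ 2 (fun v => Real.log (f z v)) (Metric.ball w₀ r)
  le_G : ∀ᵐ z ∂trueLaw ν f w₀, ∀ w ∈ Metric.ball w₀ r, ∀ i j,
    |pderiv i (pderiv j fun v => Real.log (f z v)) w| ≤ G z

namespace IsRegularFamily

variable {d : ℕ} {Z : Type*} [MeasurableSpace Z] {ν : Measure Z} {W : Set (Par d)}
  {f : Z → Par d → ℝ} {w₀ : Par d}

lemma measurable (hf : IsRegularFamily ν W f w₀) (w : Par d) : Measurable fun z => f z w :=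
  hf.measurable_uncurry.comp (measurable_id.prodMk measurable_const)

/-- A non-integrable function has Bochner integral 0, so total mass 1 forces integrability. -/
lemma integrable (hf : IsRegularFamily ν W f w₀) {w : Par d} (hw : w ∈ W) :
    Integrable (fun z => f z w) ν :=
  Integrable.of_integral_ne_zero (by rw [hf.integral_eq_one w hw]; exact one_ne_zero)

lemma isProbabilityMeasure_trueLaw (hf : IsRegularFamily ν W f w₀) {w : Par d} (hw : w ∈ W) :
    IsProbabilityMeasure (trueLaw ν f w) := by
  refine ⟨?_⟩
  rw [trueLaw, withDensity_apply _ MeasurableSet.univ, Measure.restrict_univ,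
    ← ofReal_integral_eq_lintegral_ofReal (hf.integrable hw)
      (Eventually.of_forall fun z => hf.nonneg z _ hw), hf.integral_eq_one _ hw,
    ENNReal.ofReal_one]

lemma isProbabilityMeasure (hf : IsRegularFamily ν W f w₀) :
    IsProbabilityMeasure (trueLaw ν f w₀) := hf.isProbabilityMeasure_trueLaw hf.mem

lemma integrable_trueLaw_iff (hf : IsRegularFamily ν W f w₀) {g : Z → ℝ} :
    Integrable g (trueLaw ν f w₀) ↔ Integrable (fun z => g z * f z w₀) ν := by
  rw [trueLaw, integrable_withDensity_iff (hf.measurable w₀).ennreal_ofReal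
    (Eventually.of_forall fun z => ENNReal.ofReal_lt_top)]
  simp_rw [ENNReal.toReal_ofReal (hf.nonneg _ _ hf.mem)]

lemma integral_trueLaw_of_mem (hf : IsRegularFamily ν W f w₀) {w : Par d} (hw : w ∈ W)
    (g : Z → ℝ) : ∫ z, g z ∂trueLaw ν f w = ∫ z, g z * f z w ∂ν := by
  rw [trueLaw, integral_withDensity_eq_integral_toReal_smul (hf.measurable w).ennreal_ofReal
    (Eventually.of_forall fun z => ENNReal.ofReal_lt_top)]
  simp_rw [ENNReal.toReal_ofReal (hf.nonneg _ _ hw), smul_eq_mul, mul_comm]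

lemma integral_trueLaw (hf : IsRegularFamily ν W f w₀) (g : Z → ℝ) :
    ∫ z, g z ∂trueLaw ν f w₀ = ∫ z, g z * f z w₀ ∂ν := hf.integral_trueLaw_of_mem hf.mem g

lemma trueLaw_absolutelyContinuous : trueLaw ν f w₀ ≪ ν := withDensity_absolutelyContinuous _ _

lemma ae_trueLaw_pos (hf : IsRegularFamily ν W f w₀) : ∀ᵐ z ∂trueLaw ν f w₀, 0 < f z w₀ := by
  rw [trueLaw, ae_withDensity_iff (hf.measurable w₀).ennreal_ofReal]
  exact Eventually.of_forall fun z hz => by simpa using hz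

/-- Under the true law the density at `w₀` is almost surely positive, and the alternative in the
regularity condition spreads positivity to all of `N`. The logarithm is therefore as smooth as the
density there. -/
lemma exists_localBounds (hf : IsRegularFamily ν W f w₀) :
    ∃ (r : ℝ) (B G : Z → ℝ), LocalBounds ν W f w₀ r B G := by
  obtain ⟨N, hN, hwN, hNW, hsm, ⟨B, hBi, hB⟩, -, G, hGi, hG⟩ := hf.regular
  obtain ⟨r, hr, hrN⟩ := Metric.isOpen_iff.1 hN w₀ hwN
  have hac : trueLaw ν f w₀ ≪ ν := trueLaw_absolutelyContinuous
  have hpos : ∀ᵐ z ∂trueLaw ν f w₀, ∀ w ∈ N, 0 < f z w := by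
    filter_upwards [hac.ae_le hsm, hf.ae_trueLaw_pos] with z hz hz0
    exact hz.2.resolve_right fun h => hz0.ne' (h _ hwN)
  have hG2 : Integrable (fun z => G z ^ 2) (trueLaw ν f w₀) := hf.integrable_trueLaw_iff.2 hGi
  -- No measurability of `G` is given; that of |G| is recovered from the integrable function G² f by
  -- a square root.
  have habs : (fun z => |G z|) = fun z => Real.sqrt (G z ^ 2) := by
    ext z; exact (Real.sqrt_sq_eq_abs _).symm
  have hGm : AEStronglyMeasurable (fun z => |G z|) (trueLaw ν f w₀) := by
    rw [habs]; exact Real.continuous_sqrt.comp_aestronglyMeasurable hG2.1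
  refine ⟨r, fun z => |B z|, fun z => |G z|, hr, hrN.trans hNW, fun z => abs_nonneg _, hBi.abs,
    fun z => abs_nonneg _, (memLp_two_iff_integrable_sq hGm).2 (by simpa using hG2), ?_, ?_, ?_,
    ?_, ?_, ?_⟩
  · exact hsm.mono fun z hz => hz.1.mono hrN
  · exact hsm.mono fun z hz => hz.2.imp (fun h w hw => h w (hrN hw)) fun h w hw => h w (hrN hw)
  · exact hB.mono fun z hz w hw i j => (hz w (hrN hw) i j).trans (le_abs_self _)
  · exact hpos.mono fun z hz w hw => hz w (hrN hw)
  · filter_upwards [hpos, hac.ae_le hsm] with z hz hz'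
    exact (hz'.1.mono hrN).log fun w hw => (hz w (hrN hw)).ne'
  · filter_upwards [hac.ae_le hG] with z hz w hw i j using
      (hz w (hrN hw) i j).trans (le_abs_self _)

end IsRegularFamily

namespace LocalBounds

variable {d : ℕ} {Z : Type*} [MeasurableSpace Z] {ν : Measure Z} {W : Set (Par d)}
  {f : Z → Par d → ℝ} {w₀ : Par d} {r : ℝ} {B G : Z → ℝ}

lemma center_mem (hb : LocalBounds ν W f w₀ r B G) : w₀ ∈ Metric.ball w₀ r :=
  Metric.mem_ball_self hb.pos

lemma aemeasurable_score (hf : IsRegularFamily ν W f w₀) (hb : LocalBounds ν W f w₀ r B G)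
    (i : Fin d) : AEMeasurable (fun z => score f w₀ z i) (trueLaw ν f w₀) :=
  aemeasurable_pderiv Metric.isOpen_ball hb.center_mem
    (fun u _ => (hf.measurable u).log.aemeasurable)
    (hb.smooth_log.mono fun z hz => (hz.differentiableOn (by norm_num)).differentiableAt
      (Metric.ball_mem_nhds w₀ hb.pos)) i

lemma aemeasurable_logHess (hf : IsRegularFamily ν W f w₀) (hb : LocalBounds ν W f w₀ r B G)
    (i j : Fin d) : AEMeasurable (fun z => logHess f w₀ z i j) (trueLaw ν f w₀) := by
  refine aemeasurable_pderiv Metric.isOpen_ball hb.center_mem (fun u hu => ?_) ?_ i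
  · exact aemeasurable_pderiv Metric.isOpen_ball hu
      (fun u _ => (hf.measurable u).log.aemeasurable)
      (hb.smooth_log.mono fun z hz => (hz.differentiableOn (by norm_num)).differentiableAt
        (Metric.isOpen_ball.mem_nhds hu)) j
  · exact hb.smooth_log.mono fun z hz =>
      ((contDiffOn_pderiv Metric.isOpen_ball hz j).differentiableOn (by norm_num)).differentiableAt
        (Metric.ball_mem_nhds w₀ hb.pos)

lemma memLp_score (hf : IsRegularFamily ν W f w₀) (hb : LocalBounds ν W f w₀ r B G)
    (i : Fin d) : MemLp (fun z => score f w₀ z i) 2 (trueLaw ν f w₀) := by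
  refine (memLp_two_iff_integrable_sq (hb.aemeasurable_score hf i).aestronglyMeasurable).2 ?_
  obtain ⟨-, -, -, -, -, -, hs, -⟩ := hf.regular
  exact hf.integrable_trueLaw_iff.2 (hs i)

lemma memLp_logHess (hf : IsRegularFamily ν W f w₀) (hb : LocalBounds ν W f w₀ r B G)
    (i j : Fin d) : MemLp (fun z => logHess f w₀ z i j) 2 (trueLaw ν f w₀) :=
  hb.memLp_G.mono (hb.aemeasurable_logHess hf i j).aestronglyMeasurable
    (hb.le_G.mono fun z hz => by
      rw [Real.norm_eq_abs, Real.norm_eq_abs, abs_of_nonneg (hb.G_nonneg z)]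
      exact hz w₀ hb.center_mem i j)

/-- First and second derivatives of the density at `w₀` in terms of the log-likelihood. -/
lemma ae_pderiv_eq (hb : LocalBounds ν W f w₀ r B G) :
    ∀ᵐ z ∂ν, (∀ i, pderiv i (f z) w₀ = score f w₀ z i * f z w₀) ∧
      ∀ i j, pderiv i (pderiv j (f z)) w₀
        = (logHess f w₀ z i j + score f w₀ z i * score f w₀ z j) * f z w₀ := by
  have hnhds := Metric.ball_mem_nhds w₀ hb.pos
  filter_upwards [hb.smooth, hb.pos_or_zero] with z hsm hpz
  rcases hpz with hpos | hzero
  · have hd : ∀ w ∈ Metric.ball w₀ r, DifferentiableAt ℝ (f z) w := fun w hw =>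
      (hsm.differentiableOn (by norm_num)).differentiableAt (Metric.isOpen_ball.mem_nhds hw)
    have h1 : ∀ w ∈ Metric.ball w₀ r, ∀ i,
        pderiv i (fun v => Real.log (f z v)) w = (f z w)⁻¹ * pderiv i (f z) w := fun w hw i => by
      have := fderiv.log (hd w hw) (hpos w hw).ne'
      simp [pderiv, this]
    have h0 := (hpos w₀ hb.center_mem).ne'
    have hs : ∀ i, pderiv i (f z) w₀ = score f w₀ z i * f z w₀ := fun i => by
      rw [score, h1 _ hb.center_mem]; field_simp
    refine ⟨hs, fun i j => ?_⟩
    -- The first-order identity ∂f = f ∂ log f holds on a whole neighbourhood, so it can be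
    -- differentiated once more.
    have h2 : pderiv j (f z) =ᶠ[𝓝 w₀] fun w => pderiv j (fun v => Real.log (f z v)) w * f z w := by
      filter_upwards [hnhds] with w hw
      rw [h1 w hw]
      have := (hpos w hw).ne'
      field_simp
    have hlog : ContDiffOn ℝ 2 (fun v => Real.log (f z v)) (Metric.ball w₀ r) :=
      hsm.log fun w hw => (hpos w hw).ne'
    have hdl : DifferentiableAt ℝ (pderiv j fun v => Real.log (f z v)) w₀ :=
      ((contDiffOn_pderiv Metric.isOpen_ball hlog j).differentiableOn
        (by norm_num)).differentiableAt hnhds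
    rw [pderiv, h2.fderiv_eq, fderiv_fun_mul hdl (hd _ hb.center_mem)]
    simp only [add_apply, smul_apply, smul_eq_mul]
    have h3 := hs i
    rw [pderiv] at h3
    rw [h3]
    simp only [score, logHess, pderiv]
    ring
  · have he : f z =ᶠ[𝓝 w₀] fun _ => 0 := by
      filter_upwards [hnhds] with w hw using hzero w hw
    have h0 := hzero w₀ hb.center_mem
    have h1 : ∀ i, ∀ w ∈ Metric.ball w₀ r, pderiv i (f z) w = 0 := fun i w hw => by
      have he : f z =ᶠ[𝓝 w] fun _ => 0 := by
        filter_upwards [Metric.isOpen_ball.mem_nhds hw] with w hw using hzero w hw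
      rw [pderiv, he.fderiv_eq]; simp
    refine ⟨fun i => by rw [h1 i _ hb.center_mem, h0, mul_zero], fun i j => ?_⟩
    have h2 : pderiv j (f z) =ᶠ[𝓝 w₀] fun _ => 0 := by
      filter_upwards [hnhds] with w hw using h1 j w hw
    rw [pderiv, h2.fderiv_eq, h0, mul_zero]; simp

/-- Expectations of bounded functions depend differentiably on the parameter. -/
lemma abs_integral_expansion_le (hf : IsRegularFamily ν W f w₀) (hb : LocalBounds ν W f w₀ r B G)
    {ψ : Z → ℝ} {A : ℝ} (hψ : Measurable ψ) (hA : ∀ z, |ψ z| ≤ A) {v : Par d} (hv : ‖v‖ < r) :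
    |∫ z, ψ z * f z (w₀ + v) ∂ν - ∫ z, ψ z ∂trueLaw ν f w₀
        - ∑ i, v i * ∫ z, ψ z * score f w₀ z i ∂trueLaw ν f w₀|
      ≤ (d : ℝ) ^ 2 * A * (∫ z, B z ∂ν) * ‖v‖ ^ 2 := by
  have := hf.isProbabilityMeasure
  have hbd : ∀ {g : Z → ℝ} {ν : Measure Z}, Integrable g ν → Integrable (fun z => ψ z * g z) ν :=
    fun hg => hg.bdd_mul hψ.aestronglyMeasurable (Eventually.of_forall hA)
  have hmem : w₀ + v ∈ W := hb.subset (by simpa [mem_ball_iff_norm] using hv)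
  have hsi : ∀ i, Integrable (fun z => ψ z * score f w₀ z i) (trueLaw ν f w₀) := fun i =>
    hbd ((hb.memLp_score hf i).integrable (by norm_num))
  have hsi' := fun i => hf.integrable_trueLaw_iff.1 (hsi i)
  have hi1 : Integrable (fun z => ψ z * f z (w₀ + v)) ν := hbd (hf.integrable hmem)
  have hi2 : Integrable (fun z => ψ z * f z w₀) ν := hbd (hf.integrable hf.mem)
  have hi3 : Integrable (fun z => ∑ i, v i * (ψ z * score f w₀ z i * f z w₀)) ν :=
    integrable_finsetSum _ fun i _ => (hsi' i).const_mul _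
  have e : ∫ z, ψ z * f z (w₀ + v) ∂ν - ∫ z, ψ z ∂trueLaw ν f w₀
        - ∑ i, v i * ∫ z, ψ z * score f w₀ z i ∂trueLaw ν f w₀
      = ∫ z, (ψ z * f z (w₀ + v) - ψ z * f z w₀
        - ∑ i, v i * (ψ z * score f w₀ z i * f z w₀)) ∂ν := by
    rw [integral_sub (hi1.sub' hi2) hi3, integral_sub hi1 hi2,
      integral_finsetSum _ fun i _ => (hsi' i).const_mul _]
    simp_rw [integral_const_mul, hf.integral_trueLaw]
  rw [e, ← Real.norm_eq_abs]
  calc _ ≤ ∫ z, (d : ℝ) ^ 2 * A * ‖v‖ ^ 2 * B z ∂ν := by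
        refine norm_integral_le_of_norm_le (hb.integrable_B.const_mul _) ?_
        filter_upwards [hb.smooth, hb.le_B, hb.ae_pderiv_eq] with z hsm hB hp
        -- With 0 in place of the second derivatives, `B z` bounds the whole quadratic term.
        have h := abs_taylor_remainder_le hsm hv (fun _ _ => 0) (C := B z) fun u hu i j => by
          rw [sub_zero]
          exact hB _ (by simpa [mem_ball_iff_norm] using hu.trans_lt hv) i j
        simp only [mul_zero, Finset.sum_const_zero, sub_zero] at h
        have e : ψ z * f z (w₀ + v) - ψ z * f z w₀ - ∑ i, v i * (ψ z * score f w₀ z i * f z w₀)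
            = ψ z * (f z (w₀ + v) - f z w₀ - ∑ i, v i * pderiv i (f z) w₀) := by
          simp only [hp.1, mul_sub, Finset.mul_sum]
          congr 1
          exact Finset.sum_congr rfl fun i _ => by ring
        rw [e, norm_mul, Real.norm_eq_abs, Real.norm_eq_abs]
        calc |ψ z| * |f z (w₀ + v) - f z w₀ - ∑ i, v i * pderiv i (f z) w₀|
            ≤ A * ((d : ℝ) ^ 2 * B z * ‖v‖ ^ 2) :=
              mul_le_mul (hA z) h (abs_nonneg _) ((abs_nonneg _).trans (hA z))
          _ = _ := by ring
    _ = _ := by rw [integral_const_mul]; ring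

/-- The expansion of the integral of the constant 1 has no zeroth-order change, since the total mass
stays 1. What is left is the linear term, which must be O(t²) along each coordinate and hence
vanishes. -/
lemma integral_score (hf : IsRegularFamily ν W f w₀) (hb : LocalBounds ν W f w₀ r B G)
    (i : Fin d) : ∫ z, score f w₀ z i ∂trueLaw ν f w₀ = 0 := by
  have := hf.isProbabilityMeasure
  set c := ∫ z, score f w₀ z i ∂trueLaw ν f w₀ with hc
  set K := (d : ℝ) ^ 2 * 1 * (∫ z, B z ∂ν) with hK
  have h : ∀ t : ℝ, 0 < t → t < r → |c| ≤ K * t := fun t ht htr => by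
    have hn : ‖(Pi.single i t : Par d)‖ = t := by
      rw [Pi.norm_single, Real.norm_eq_abs, abs_of_pos ht]
    have h := hb.abs_integral_expansion_le hf (ψ := fun _ => 1) (A := 1) measurable_const
      (fun _ => by simp) (v := Pi.single i t) (by rwa [hn])
    have hm : w₀ + Pi.single i t ∈ W := hb.subset (by simpa [mem_ball_iff_norm, hn] using htr)
    simp only [one_mul, integral_const, smul_eq_mul, mul_one, probReal_univ,
      hf.integral_eq_one _ hm, sub_self, zero_sub, abs_neg] at h
    rw [Finset.sum_eq_single i (fun j _ hj => by simp [hj]) (by simp), Pi.single_eq_same, abs_mul,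
      abs_of_pos ht, hn] at h
    rw [mul_one] at hK
    have : t * |c| ≤ t * (K * t) := by rw [hK]; linarith
    exact le_of_mul_le_mul_left this ht
  have hlim : Tendsto (fun t : ℝ => K * t) (𝓝[>] 0) (𝓝 0) := by
    have : Continuous fun t : ℝ => K * t := by fun_prop
    simpa using (this.tendsto 0).mono_left nhdsWithin_le_nhds
  have hle : |c| ≤ 0 := ge_of_tendsto hlim (by
    filter_upwards [Ioo_mem_nhdsGT hb.pos] with t ht using h t ht.1 ht.2)
  exact abs_nonpos_iff.1 hle

lemma integrable_logHess_add (hf : IsRegularFamily ν W f w₀) (hb : LocalBounds ν W f w₀ r B G)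
    (i j : Fin d) : Integrable
      (fun z => (logHess f w₀ z i j + score f w₀ z i * score f w₀ z j) * f z w₀) ν := by
  have := hf.isProbabilityMeasure
  exact hf.integrable_trueLaw_iff.1 (((hb.memLp_logHess hf i j).integrable (by norm_num)).add
    ((hb.memLp_score hf i).integrable_mul (hb.memLp_score hf j)))

/-- The two expressions for the Fisher information agree. -/
lemma sum_integral_logHess (hf : IsRegularFamily ν W f w₀) (hb : LocalBounds ν W f w₀ r B G)
    (v : Par d) :
    ∑ i, ∑ j, v i * v j * ∫ z, logHess f w₀ z i j ∂trueLaw ν f w₀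
      = -∑ i, ∑ j, v i * v j * ∫ z, score f w₀ z i * score f w₀ z j ∂trueLaw ν f w₀ := by
  have := hf.isProbabilityMeasure
  -- `F t` is a second-order difference quotient of the density. Its integral is 0, because the mass
  -- is constant and the score centred. It converges to `H` pointwise and is dominated by a multiple
  -- of `B`, so the integral of `H` is 0 as well.
  set F : ℝ → Z → ℝ := fun t z => (t ^ 2)⁻¹ *
    (f z (w₀ + t • v) - f z w₀ - ∑ i, t * v i * (score f w₀ z i * f z w₀)) with hF
  set H : Z → ℝ := fun z => 1 / 2 * ∑ i, ∑ j, v i * v j *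
    ((logHess f w₀ z i j + score f w₀ z i * score f w₀ z j) * f z w₀) with hH
  have hsi : ∀ i, Integrable (fun z => score f w₀ z i) (trueLaw ν f w₀) := fun i =>
    (hb.memLp_score hf i).integrable (by norm_num)
  have hsi' := fun i => hf.integrable_trueLaw_iff.1 (hsi i)
  have hsmall : ∀ᶠ t : ℝ in 𝓝[≠] 0, ‖t • v‖ < r := by
    have : Tendsto (fun t : ℝ => ‖t • v‖) (𝓝 0) (𝓝 0) := by
      have h : Continuous fun t : ℝ => ‖t • v‖ := by fun_prop
      simpa using h.tendsto 0
    exact (this.mono_left nhdsWithin_le_nhds).eventually (gt_mem_nhds hb.pos)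
  have hmem : ∀ t : ℝ, ‖t • v‖ < r → w₀ + t • v ∈ W := fun t ht =>
    hb.subset (by simpa [mem_ball_iff_norm] using ht)
  have hFi : ∀ t : ℝ, ‖t • v‖ < r → Integrable (F t) ν := fun t ht =>
    (((hf.integrable (hmem t ht)).sub (hf.integrable hf.mem)).sub
      (integrable_finsetSum _ fun i _ => (hsi' i).const_mul (t * v i))).const_mul _
  have hF0 : ∀ t : ℝ, ‖t • v‖ < r → ∫ z, F t z ∂ν = 0 := fun t ht => by
    simp only [hF]
    rw [integral_const_mul, integral_sub ((hf.integrable (hmem t ht)).sub' (hf.integrable hf.mem))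
      (integrable_finsetSum _ fun i _ => (hsi' i).const_mul (t * v i)),
      integral_sub (hf.integrable (hmem t ht)) (hf.integrable hf.mem),
      integral_finsetSum _ fun i _ => (hsi' i).const_mul (t * v i),
      hf.integral_eq_one _ (hmem t ht), hf.integral_eq_one _ hf.mem]
    simp_rw [integral_const_mul, ← hf.integral_trueLaw, hb.integral_score hf]
    simp
  have hlim : Tendsto (fun t => ∫ z, F t z ∂ν) (𝓝[≠] 0) (𝓝 (∫ z, H z ∂ν)) := by
    refine tendsto_integral_filter_of_dominated_convergence
      (fun z => (d : ℝ) ^ 2 * B z * ‖v‖ ^ 2) ?_ ?_ ?_ ?_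
    · filter_upwards [hsmall] with t ht using (hFi t ht).1
    · filter_upwards [hsmall, self_mem_nhdsWithin] with t ht ht0
      filter_upwards [hb.smooth, hb.le_B, hb.ae_pderiv_eq] with z hsm hB hp
      have h := abs_taylor_remainder_le hsm ht (fun _ _ => 0) (C := B z) fun u hu i j => by
        rw [sub_zero]
        exact hB _ (by simpa [mem_ball_iff_norm] using hu.trans_lt ht) i j
      simp only [mul_zero, Finset.sum_const_zero, sub_zero, hp.1, Pi.smul_apply,
        smul_eq_mul] at h
      have ht2 : 0 < t ^ 2 := by
        have : t ≠ 0 := ht0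
        positivity
      rw [norm_smul, mul_pow, Real.norm_eq_abs t, sq_abs] at h
      simp only [hF]
      rw [Real.norm_eq_abs, abs_mul, abs_of_pos (inv_pos.2 ht2), inv_mul_le_iff₀ ht2]
      linarith
    · exact hb.integrable_B.const_mul _ |>.mul_const _
    · filter_upwards [hb.smooth, hb.ae_pderiv_eq] with z hsm hp
      have h := (tendsto_taylorRem_smul hb.pos hsm v).add_const (H z)
      rw [zero_add] at h
      refine h.congr' ?_
      filter_upwards [self_mem_nhdsWithin] with t ht0
      have ht : t ≠ 0 := ht0
      simp only [taylorRem, hp.1, hp.2, hF, hH, Pi.smul_apply, smul_eq_mul]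
      have e : ∑ i, ∑ j, t * v i * (t * v j) *
          ((logHess f w₀ z i j + score f w₀ z i * score f w₀ z j) * f z w₀)
          = t ^ 2 * ∑ i, ∑ j, v i * v j *
            ((logHess f w₀ z i j + score f w₀ z i * score f w₀ z j) * f z w₀) := by
        simp only [Finset.mul_sum]
        exact Finset.sum_congr rfl fun i _ => Finset.sum_congr rfl fun j _ => by ring
      rw [e]
      field_simp
      ring
  have hzero : ∫ z, H z ∂ν = 0 := by
    refine tendsto_nhds_unique hlim (tendsto_const_nhds.congr' ?_)
    filter_upwards [hsmall] with t ht using (hF0 t ht).symm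
  have hHint : ∫ z, H z ∂ν = 1 / 2 * ∑ i, ∑ j, v i * v j *
      (∫ z, logHess f w₀ z i j ∂trueLaw ν f w₀
        + ∫ z, score f w₀ z i * score f w₀ z j ∂trueLaw ν f w₀) := by
    simp only [hH]
    rw [integral_const_mul, integral_finsetSum _ fun i _ => integrable_finsetSum _ fun j _ =>
      (hb.integrable_logHess_add hf i j).const_mul _]
    congr 1
    refine Finset.sum_congr rfl fun i _ => ?_
    rw [integral_finsetSum _ fun j _ => (hb.integrable_logHess_add hf i j).const_mul _]
    refine Finset.sum_congr rfl fun j _ => ?_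
    have hss : Integrable (fun z => score f w₀ z i * score f w₀ z j) (trueLaw ν f w₀) :=
      (hb.memLp_score hf i).integrable_mul (hb.memLp_score hf j)
    rw [integral_const_mul, ← hf.integral_trueLaw,
      integral_add ((hb.memLp_logHess hf i j).integrable (by norm_num)) hss]
  rw [hHint] at hzero
  simp only [mul_add, Finset.sum_add_distrib] at hzero
  linarith

end LocalBounds

lemma ae_sampleLaw_forall {Z : Type*} [MeasurableSpace Z] {P : Measure Z} [IsProbabilityMeasure P]
    (n : ℕ) {p : Z → Prop} (h : ∀ᵐ x ∂P, p x) : ∀ᵐ z ∂sampleLaw P n, ∀ k, p (z k) :=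
  ae_all_iff.2 fun k => (measurePreserving_eval (fun _ : Fin n => P) k).quasiMeasurePreserving.ae h

lemma dotProduct_mulVec_self_eq_sum {d : ℕ} (J : Matrix (Fin d) (Fin d) ℝ) (u : Par d) :
    u ⬝ᵥ (J *ᵥ u) = ∑ i, ∑ j, u i * u j * J i j := by
  simp only [dotProduct, Matrix.mulVec, Finset.mul_sum]
  exact Finset.sum_congr rfl fun i _ => Finset.sum_congr rfl fun j _ => by ring

/-! ### Local asymptotic normality -/

section LAN

variable {d : ℕ} {Z : Type*} [MeasurableSpace Z]

/-- The Fisher information at `w₀`, as the second moment matrix of the score. -/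
def scoreCov (ν : Measure Z) (f : Z → Par d → ℝ) (w₀ : Par d) : Matrix (Fin d) (Fin d) ℝ :=
  Matrix.of fun i j => ∫ z, score f w₀ z i * score f w₀ z j ∂trueLaw ν f w₀

/-- The normalised score `n^{-1/2} ∑ s(z_k)` of a sample. -/
def normScore (f : Z → Par d → ℝ) (w₀ : Par d) (n : ℕ) (z : Fin n → Z) : Par d :=
  fun i => (Real.sqrt n)⁻¹ * ∑ k, score f w₀ (z k) i

/-- The log-likelihood ratio of a sample between `w₀ + v` and `w₀`. -/
def logRatio (f : Z → Par d → ℝ) (w₀ : Par d) {n : ℕ} (z : Fin n → Z) (v : Par d) : ℝ :=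
  ∑ k, (Real.log (f (z k) (w₀ + v)) - Real.log (f (z k) w₀))

/-- The supremum over a countable dense subset of `‖u‖ < R` of the scaled remainders. -/
def supRem (f : Z → Par d → ℝ) (w₀ : Par d) (R : ℝ) (n : ℕ) (x : Z) : ENNReal :=
  ⨆ k : ℕ, if ‖TopologicalSpace.denseSeq (Par d) k‖ < R then
    ENNReal.ofReal (n * |taylorRem (fun v => Real.log (f x v)) w₀
      ((Real.sqrt n)⁻¹ • TopologicalSpace.denseSeq (Par d) k)|) else 0

namespace LocalBounds

variable {ν : Measure Z} {W : Set (Par d)}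
  {f : Z → Par d → ℝ} {w₀ : Par d} {r : ℝ} {B G : Z → ℝ}

lemma aemeasurable_taylorRem (hf : IsRegularFamily ν W f w₀) (hb : LocalBounds ν W f w₀ r B G)
    (v : Par d) : AEMeasurable (fun x => taylorRem (fun v => Real.log (f x v)) w₀ v)
      (trueLaw ν f w₀) := by
  unfold taylorRem
  refine (((hf.measurable _).log.sub (hf.measurable _).log).aemeasurable.sub ?_).sub ?_
  · exact Finset.aemeasurable_fun_sum _ fun i _ => (hb.aemeasurable_score hf i).const_mul _
  · exact (Finset.aemeasurable_fun_sum _ fun i _ => Finset.aemeasurable_fun_sum _ fun j _ =>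
      (hb.aemeasurable_logHess hf i j).const_mul _).const_mul _

/-- This is the reason for a countable supremum; `le_supRem` recovers the full ball. -/
lemma aemeasurable_supRem (hf : IsRegularFamily ν W f w₀) (hb : LocalBounds ν W f w₀ r B G)
    (R : ℝ) (n : ℕ) : AEMeasurable (supRem f w₀ R n) (trueLaw ν f w₀) := by
  refine AEMeasurable.iSup fun k => ?_
  by_cases h : ‖TopologicalSpace.denseSeq (Par d) k‖ < R
  · simp only [h, if_true]
    exact ((continuous_abs.measurable.comp_aemeasurable
      (hb.aemeasurable_taylorRem hf _)).const_mul _).ennreal_ofReal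
  · simp only [h, if_false]
    exact aemeasurable_const

lemma norm_inv_sqrt_smul {n : ℕ} (u : Par d) : ‖(Real.sqrt n)⁻¹ • u‖ = (Real.sqrt n)⁻¹ * ‖u‖ := by
  rw [norm_smul, Real.norm_eq_abs, abs_of_nonneg (inv_nonneg.2 (Real.sqrt_nonneg _))]

lemma tendsto_inv_sqrt_mul (R : ℝ) : Tendsto (fun n : ℕ => (Real.sqrt n)⁻¹ * R) atTop (𝓝 0) := by
  have : Tendsto (fun n : ℕ => (Real.sqrt n)⁻¹) atTop (𝓝 0) :=
    tendsto_inv_atTop_zero.comp (Real.tendsto_sqrt_atTop.comp tendsto_natCast_atTop_atTop)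
  simpa using this.mul_const R

lemma norm_inv_sqrt_smul_lt {R δ : ℝ} {n : ℕ} (hn : (Real.sqrt n)⁻¹ * R < δ) {u : Par d}
    (hu : ‖u‖ < R) : ‖(Real.sqrt n)⁻¹ • u‖ < δ := by
  rw [norm_inv_sqrt_smul]
  exact (mul_le_mul_of_nonneg_left hu.le (inv_nonneg.2 (Real.sqrt_nonneg _))).trans_lt hn

/-- The supremum is over all of `‖u‖ < R`, by continuity. -/
lemma le_supRem {Z : Type*} {g : Z → Par d → ℝ} {x : Z}
    (hs : ContDiffOn ℝ 2 (fun v => Real.log (g x v)) (Metric.ball w₀ r)) {R : ℝ} {n : ℕ}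
    (hn : (Real.sqrt n)⁻¹ * R < r) {u : Par d} (hu : ‖u‖ < R) :
    ENNReal.ofReal (n * |taylorRem (fun v => Real.log (g x v)) w₀ ((Real.sqrt n)⁻¹ • u)|)
      ≤ supRem g w₀ R n x := by
  by_contra! hlt
  set F : Par d → ENNReal := fun u =>
    ENNReal.ofReal (n * |taylorRem (fun v => Real.log (g x v)) w₀ ((Real.sqrt n)⁻¹ • u)|) with hF
  have hcl : ContinuousOn (fun u : Par d => Real.log (g x (w₀ + (Real.sqrt n)⁻¹ • u)))
      (Metric.ball 0 R) := by
    refine hs.continuousOn.comp (f := fun u : Par d => w₀ + (Real.sqrt n)⁻¹ • u)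
      (by fun_prop) fun u hu => ?_
    have := norm_inv_sqrt_smul_lt hn (mem_ball_zero_iff.1 hu)
    simpa [mem_ball_iff_norm] using this
  have hc : ContinuousOn F (Metric.ball 0 R) := by
    refine ENNReal.continuous_ofReal.comp_continuousOn (continuousOn_const.mul (ContinuousOn.abs ?_))
    unfold taylorRem
    refine ((hcl.sub continuousOn_const).sub ?_).sub ?_ <;>
    · simp only [Pi.smul_apply]
      fun_prop
  -- The points where the scaled remainder exceeds the supremum form an open set. If it were
  -- nonempty, it would meet the dense sequence.
  have hopen := hc.isOpen_inter_preimage Metric.isOpen_ball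
    (isOpen_Ioi (a := supRem g w₀ R n x))
  obtain ⟨y, hy, k, rfl⟩ := (TopologicalSpace.denseRange_denseSeq (Par d)).inter_open_nonempty _
    hopen ⟨u, mem_ball_zero_iff.2 hu, hlt⟩
  have h1 : ‖TopologicalSpace.denseSeq (Par d) k‖ < R := mem_ball_zero_iff.1 hy.1
  have h2 : F (TopologicalSpace.denseSeq (Par d) k) ≤ supRem g w₀ R n x := by
    refine le_trans ?_ (le_iSup _ k)
    simp only [h1, if_true, hF, le_refl]
  exact absurd h2 (not_le.2 hy.2)

/-- The factor `n` cancels the scaling of ‖u/√n‖². The constant `ε` need not be small: a multiple of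
`G x` gives domination, and a small number from Peano's remainder gives the limit. -/
lemma supRem_le {Z : Type*} {g : Z → Par d → ℝ} {x : Z} {R ε : ℝ} {n : ℕ} (hε : 0 ≤ ε) (hR : 0 < R)
    (h : ∀ v, ‖v‖ < (Real.sqrt n)⁻¹ * R →
      |taylorRem (fun v => Real.log (g x v)) w₀ v| ≤ ε * ‖v‖ ^ 2) (hn : 0 < n) :
    supRem g w₀ R n x ≤ ENNReal.ofReal (ε * R ^ 2) := by
  have hn0 : (0 : ℝ) < n := by exact_mod_cast hn
  refine iSup_le fun k => ?_
  split_ifs with hk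
  · refine ENNReal.ofReal_le_ofReal ?_
    set u := TopologicalSpace.denseSeq (Par d) k
    have hpos : 0 < (Real.sqrt n)⁻¹ := inv_pos.2 (Real.sqrt_pos.2 hn0)
    have hv : ‖(Real.sqrt n)⁻¹ • u‖ < (Real.sqrt n)⁻¹ * R := by
      rw [norm_inv_sqrt_smul]; exact mul_lt_mul_of_pos_left hk hpos
    calc (n : ℝ) * |taylorRem (fun v => Real.log (g x v)) w₀ ((Real.sqrt n)⁻¹ • u)|
        ≤ n * (ε * ((Real.sqrt n)⁻¹ * R) ^ 2) := by
          gcongr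
          exact (h _ hv).trans (by gcongr)
      _ = ε * R ^ 2 := by
          rw [mul_pow, inv_pow, Real.sq_sqrt hn0.le]; field_simp
  · exact zero_le

/-- The remainders of the log-likelihood are negligible in mean, uniformly on compact sets. -/
lemma tendsto_integral_supRem (hf : IsRegularFamily ν W f w₀) (hb : LocalBounds ν W f w₀ r B G)
    {R : ℝ} (hR : 0 < R) :
    (∀ᶠ n : ℕ in atTop, Integrable (fun x => (supRem f w₀ R n x).toReal) (trueLaw ν f w₀)) ∧
    (∀ᶠ n : ℕ in atTop, ∀ᵐ x ∂trueLaw ν f w₀, supRem f w₀ R n x < ⊤) ∧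
    Tendsto (fun n : ℕ => ∫ x, (supRem f w₀ R n x).toReal ∂trueLaw ν f w₀) atTop (𝓝 0) := by
  have := hf.isProbabilityMeasure
  -- Twice `G`, because the second derivatives along the segment are compared with those at `w₀`.
  set bd : Z → ℝ := fun x => (d : ℝ) ^ 2 * (2 * G x) * R ^ 2 with hbd
  have hbdi : Integrable bd (trueLaw ν f w₀) :=
    (((hb.memLp_G.integrable (by norm_num)).const_mul 2).const_mul _).mul_const _
  have hev : ∀ᶠ n : ℕ in atTop, 0 < n ∧ (Real.sqrt n)⁻¹ * R < r :=
    (eventually_gt_atTop 0).and ((tendsto_inv_sqrt_mul R).eventually (gt_mem_nhds hb.pos))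
  have hdom : ∀ᶠ n : ℕ in atTop, ∀ᵐ x ∂trueLaw ν f w₀,
      supRem f w₀ R n x ≤ ENNReal.ofReal (bd x) := by
    filter_upwards [hev] with n hn
    filter_upwards [hb.smooth_log, hb.le_G] with x hs hG
    refine supRem_le (mul_nonneg (by positivity) (mul_nonneg zero_le_two (hb.G_nonneg x))) hR
      (fun v hv => ?_) hn.1
    refine abs_taylor_remainder_le hs (hv.trans hn.2)
      (fun i j => pderiv i (pderiv j fun v => Real.log (f x v)) w₀) fun u hu i j => ?_
    have h1 := hG (w₀ + u) (by simpa [mem_ball_iff_norm] using hu.trans_lt (hv.trans hn.2)) i j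
    have h2 := hG w₀ hb.center_mem i j
    exact (abs_sub _ _).trans (by linarith)
  have hbd0 : ∀ x, 0 ≤ bd x := fun x => by
    have := hb.G_nonneg x
    positivity
  have hmeas : ∀ n, AEStronglyMeasurable (fun x => (supRem f w₀ R n x).toReal) (trueLaw ν f w₀) :=
    fun n => (hb.aemeasurable_supRem hf R n).ennreal_toReal.aestronglyMeasurable
  have hdom' : ∀ᶠ n : ℕ in atTop, ∀ᵐ x ∂trueLaw ν f w₀,
      ‖(supRem f w₀ R n x).toReal‖ ≤ bd x := by
    filter_upwards [hdom] with n hn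
    filter_upwards [hn] with x hx
    rw [Real.norm_eq_abs, abs_of_nonneg ENNReal.toReal_nonneg]
    exact ENNReal.toReal_le_of_le_ofReal (hbd0 x) hx
  refine ⟨hdom'.mono fun n hn => hbdi.mono' (hmeas n) hn,
    hdom.mono fun n hn => hn.mono fun x hx => hx.trans_lt ENNReal.ofReal_lt_top, ?_⟩
  have h := tendsto_integral_filter_of_dominated_convergence (f := fun _ => (0 : ℝ)) bd
    (Eventually.of_forall hmeas) hdom' hbdi (μ := trueLaw ν f w₀) ?_
  · simpa using h
  · filter_upwards [hb.smooth_log] with x hs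
    rw [Metric.tendsto_nhds]
    intro ε hε
    obtain ⟨δ, hδ, h⟩ := exists_abs_taylorRem_le hb.pos hs (ε := ε / 2 / R ^ 2) (by positivity)
    filter_upwards [eventually_gt_atTop 0,
      (tendsto_inv_sqrt_mul R).eventually (gt_mem_nhds hδ)] with n hn0 hn
    have h1 := supRem_le (x := x) (g := f) (by positivity) hR (fun v hv => h v (hv.trans hn)) hn0
    have h2 := ENNReal.toReal_le_of_le_ofReal (by positivity) h1
    rw [Real.dist_eq, sub_zero, abs_of_nonneg ENNReal.toReal_nonneg]
    refine h2.trans_lt ?_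
    rw [div_mul_cancel₀ _ (by positivity)]
    linarith

/-- Local asymptotic normality of the log-likelihood ratio, with an error that is small in mean
uniformly over compact sets of local parameters. -/
theorem exists_lan_remainder (hf : IsRegularFamily ν W f w₀) (hb : LocalBounds ν W f w₀ r B G)
    {R : ℝ} (hR : 0 < R) :
    ∃ ρ : ∀ n : ℕ, (Fin n → Z) → ℝ, (∀ n z, 0 ≤ ρ n z) ∧
      (∀ᶠ n : ℕ in atTop, Integrable (ρ n) (sampleLaw (trueLaw ν f w₀) n)) ∧
      Tendsto (fun n => ∫ z, ρ n z ∂sampleLaw (trueLaw ν f w₀) n) atTop (𝓝 0) ∧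
      ∀ᶠ n : ℕ in atTop, ∀ᵐ z ∂sampleLaw (trueLaw ν f w₀) n, ∀ u : Par d, ‖u‖ < R →
        |logRatio f w₀ z ((Real.sqrt n)⁻¹ • u)
          - (u ⬝ᵥ normScore f w₀ n z - 1 / 2 * (u ⬝ᵥ (scoreCov ν f w₀ *ᵥ u)))| ≤ ρ n z := by
  have := hf.isProbabilityMeasure
  obtain ⟨hi, htop, hlim⟩ := hb.tendsto_integral_supRem hf hR
  set P := trueLaw ν f w₀ with hP
  set a : ℕ → Z → ℝ := fun n x => (supRem f w₀ R n x).toReal with ha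
  set b : ∀ (i j : Fin d) (n : ℕ), (Fin n → Z) → ℝ := fun i j n z =>
    |(n : ℝ)⁻¹ * ∑ k, logHess f w₀ (z k) i j - ∫ x, logHess f w₀ x i j ∂P| with hb'
  have hbi : ∀ i j n, Integrable (b i j n) (sampleLaw P n) := fun i j n =>
    (((integrable_sum_sampleLaw n ((hb.memLp_logHess hf i j).integrable (by norm_num))).const_mul
      _).sub (integrable_const _)).abs
  have hai : ∀ᶠ n : ℕ in atTop,
      Integrable (fun z : Fin n → Z => (n : ℝ)⁻¹ * ∑ k, a n (z k)) (sampleLaw P n) :=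
    hi.mono fun n hn => (integrable_sum_sampleLaw n hn).const_mul _
  have hsi : ∀ n, Integrable (fun z => R ^ 2 * ∑ i, ∑ j, b i j n z) (sampleLaw P n) := fun n =>
    (integrable_finsetSum _ fun i _ => integrable_finsetSum _ fun j _ => hbi i j n).const_mul _
  -- Two sources of error: the average of the suprema of the remainders, and the fluctuation of the
  -- averaged second derivatives about their means, weighted by `R ^ 2` since |u i| ≤ R.
  refine ⟨fun n z => (n : ℝ)⁻¹ * ∑ k, a n (z k) + R ^ 2 * ∑ i, ∑ j, b i j n z,
    fun n z => ?_, ?_, ?_, ?_⟩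
  · exact add_nonneg (mul_nonneg (by positivity) (Finset.sum_nonneg fun _ _ =>
      ENNReal.toReal_nonneg)) (mul_nonneg (by positivity) (Finset.sum_nonneg fun i _ =>
        Finset.sum_nonneg fun j _ => abs_nonneg _))
  · exact hai.mono fun n hn => hn.add (hsi n)
  · have h2 : Tendsto (fun n => R ^ 2 * ∑ i, ∑ j, ∫ z, b i j n z ∂sampleLaw P n) atTop (𝓝 0) := by
      have : Tendsto (fun n => R ^ 2 * ∑ i : Fin d, ∑ j : Fin d, ∫ z, b i j n z ∂sampleLaw P n)
          atTop (𝓝 (R ^ 2 * ∑ i : Fin d, ∑ j : Fin d, 0)) :=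
        (tendsto_finsetSum _ fun i _ => tendsto_finsetSum _ fun j _ =>
          tendsto_integral_abs_average_sub (hb.memLp_logHess hf i j)).const_mul _
      simpa using this
    have h3 := hlim.add h2
    rw [add_zero] at h3
    refine h3.congr' ?_
    filter_upwards [hi, hai, eventually_gt_atTop 0] with n hn hn' hn0
    rw [integral_add hn' (hsi n), integral_const_mul, integral_const_mul,
      integral_sum_sampleLaw n hn, integral_finsetSum _ fun i _ =>
        integrable_finsetSum _ fun j _ => hbi i j n]
    have hn0' : (n : ℝ) ≠ 0 := by positivity
    congr 1
    · field_simp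
    · congr 1
      exact Finset.sum_congr rfl fun i _ => (integral_finsetSum _ fun j _ => hbi i j n).symm
  · filter_upwards [htop, eventually_gt_atTop 0,
      (tendsto_inv_sqrt_mul R).eventually (gt_mem_nhds hb.pos)] with n hn hn0 hnr
    filter_upwards [ae_sampleLaw_forall n hn, ae_sampleLaw_forall n hb.smooth_log] with z hz hs u hu
    have hn0' : (0 : ℝ) < n := by exact_mod_cast hn0
    have hsq : (Real.sqrt n)⁻¹ * (Real.sqrt n)⁻¹ = (n : ℝ)⁻¹ := by
      rw [← mul_inv, Real.mul_self_sqrt hn0'.le]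
    set v := (Real.sqrt n)⁻¹ • u with hv
    have hrem : ∀ k, |taylorRem (fun v => Real.log (f (z k) v)) w₀ v| ≤ (n : ℝ)⁻¹ * a n (z k) := by
      intro k
      have h1 := ENNReal.toReal_mono (hz k).ne (le_supRem (hs k) hnr hu)
      rw [ENNReal.toReal_ofReal (by positivity)] at h1
      rw [← div_eq_inv_mul, le_div_iff₀ hn0', mul_comm]
      exact h1
    have e1 : logRatio f w₀ z v = ∑ k, taylorRem (fun v => Real.log (f (z k) v)) w₀ v
        + u ⬝ᵥ normScore f w₀ n z
        + 1 / 2 * ∑ i, ∑ j, u i * u j * ((n : ℝ)⁻¹ * ∑ k, logHess f w₀ (z k) i j) := by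
      have e2 : u ⬝ᵥ normScore f w₀ n z = ∑ k, ∑ i, v i * score f w₀ (z k) i := by
        simp only [dotProduct, normScore, hv, Pi.smul_apply, smul_eq_mul, Finset.mul_sum]
        rw [Finset.sum_comm]
        exact Finset.sum_congr rfl fun i _ => Finset.sum_congr rfl fun j _ => by ring
      have e3 : 1 / 2 * ∑ i, ∑ j, u i * u j * ((n : ℝ)⁻¹ * ∑ k, logHess f w₀ (z k) i j)
          = ∑ k, 1 / 2 * ∑ i, ∑ j, v i * v j * logHess f w₀ (z k) i j := by
        rw [← Finset.mul_sum]
        congr 1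
        rw [Finset.sum_comm (s := Finset.univ (α := Fin n))]
        refine Finset.sum_congr rfl fun i _ => ?_
        rw [Finset.sum_comm (s := Finset.univ (α := Fin n))]
        refine Finset.sum_congr rfl fun j _ => ?_
        simp only [hv, Pi.smul_apply, smul_eq_mul, Finset.mul_sum, ← hsq]
        exact Finset.sum_congr rfl fun k _ => by ring
      rw [e2, e3, ← Finset.sum_add_distrib, ← Finset.sum_add_distrib]
      refine Finset.sum_congr rfl fun k _ => ?_
      simp only [taylorRem, score, logHess]
      ring
    -- The information identity: the expected second derivatives of the log-likelihood give minus
    -- the Fisher information.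
    have e4 : u ⬝ᵥ (scoreCov ν f w₀ *ᵥ u)
        = -∑ i, ∑ j, u i * u j * ∫ x, logHess f w₀ x i j ∂P := by
      rw [hb.sum_integral_logHess hf, neg_neg, dotProduct_mulVec_self_eq_sum]
      rfl
    have e5 : logRatio f w₀ z v
          - (u ⬝ᵥ normScore f w₀ n z - 1 / 2 * (u ⬝ᵥ (scoreCov ν f w₀ *ᵥ u)))
        = ∑ k, taylorRem (fun v => Real.log (f (z k) v)) w₀ v
          + 1 / 2 * ∑ i, ∑ j, u i * u j * ((n : ℝ)⁻¹ * ∑ k, logHess f w₀ (z k) i j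
            - ∫ x, logHess f w₀ x i j ∂P) := by
      rw [e1, e4]
      simp only [mul_sub, Finset.sum_sub_distrib]
      ring
    rw [e5]
    refine (abs_add_le _ _).trans (add_le_add ?_ ?_)
    · rw [Finset.mul_sum]
      exact (Finset.abs_sum_le_sum_abs _ _).trans (Finset.sum_le_sum fun k _ => hrem k)
    · rw [abs_mul, Finset.mul_sum]
      have h12 : |(1 / 2 : ℝ)| ≤ 1 := by norm_num [abs_of_pos]
      refine (mul_le_of_le_one_left (abs_nonneg _) h12).trans ?_
      refine (Finset.abs_sum_le_sum_abs _ _).trans (Finset.sum_le_sum fun i _ => ?_)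
      rw [Finset.mul_sum]
      refine (Finset.abs_sum_le_sum_abs _ _).trans (Finset.sum_le_sum fun j _ => ?_)
      rw [abs_mul, abs_mul, sq]
      have hui : ∀ i, |u i| ≤ R := fun i => (norm_le_pi_norm u i).trans hu.le
      exact mul_le_mul_of_nonneg_right (mul_le_mul (hui i) (hui j) (abs_nonneg _) hR.le)
        (abs_nonneg _)

end LocalBounds

end LAN

/-! ### Gaussian integrals -/

section Gaussian

variable {d : ℕ}

lemma integrable_exp_neg_mul_dotProduct_self {c : ℝ} (hc : 0 < c) :
    Integrable fun u : Par d => Real.exp (-c * (u ⬝ᵥ u)) := by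
  have h := Integrable.fintype_prod (ι := Fin d) (μ := fun _ => (volume : Measure ℝ))
    (f := fun _ x => Real.exp (-c * x ^ 2)) fun _ => integrable_exp_neg_mul_sq hc
  refine (h.congr (Eventually.of_forall fun u => ?_))
  simp only [← Real.exp_sum, ← Finset.mul_sum, dotProduct, sq]

lemma dotProduct_self_le_norm_sq (u : Par d) : u ⬝ᵥ u ≤ d * ‖u‖ ^ 2 := by
  calc u ⬝ᵥ u ≤ ∑ _i : Fin d, ‖u‖ ^ 2 := Finset.sum_le_sum fun i _ => by
        rw [← sq, ← sq_abs]
        exact pow_le_pow_left₀ (abs_nonneg _) (norm_le_pi_norm u i) 2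
    _ = _ := by simp

/-- The norm here is the sup norm, so u·u ≤ d‖u‖² allows comparison with a product of
one-dimensional Gaussians; `d + 1` avoids division by zero when `d = 0`. -/
lemma integrable_exp_neg_mul_norm_sq {c : ℝ} (hc : 0 < c) :
    Integrable fun u : Par d => Real.exp (-c * ‖u‖ ^ 2) := by
  refine (integrable_exp_neg_mul_dotProduct_self (d := d) (c := c / (d + 1)) (by positivity)).mono'
    (by fun_prop) (Eventually.of_forall fun u => ?_)
  rw [Real.norm_eq_abs, Real.abs_exp, Real.exp_le_exp, neg_mul, neg_mul, neg_le_neg_iff,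
    div_mul_eq_mul_div, div_le_iff₀ (by positivity), mul_assoc]
  refine mul_le_mul_of_nonneg_left ?_ hc.le
  nlinarith [dotProduct_self_le_norm_sq u, sq_nonneg ‖u‖]

/-- The normalising constant of the Gaussian density with precision matrix `J`. -/
def gaussConst (J : Matrix (Fin d) (Fin d) ℝ) : ℝ :=
  ∫ u : Par d, Real.exp (-(1 / 2 * (u ⬝ᵥ (J *ᵥ u))))

variable {J : Matrix (Fin d) (Fin d) ℝ}

-- A nonnegative element of a C⋆-algebra has the form M⋆M. The substitution u ↦ Mu then reduces
-- Gaussian integrals to the standard one.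
open scoped MatrixOrder Matrix.Norms.L2Operator in
lemma exists_sqrt_matrix (hJ : J.PosDef) : ∃ M : Matrix (Fin d) (Fin d) ℝ,
    M.det ≠ 0 ∧ |M.det| = Real.sqrt J.det ∧ ∀ u, u ⬝ᵥ (J *ᵥ u) = (M *ᵥ u) ⬝ᵥ (M *ᵥ u) := by
  obtain ⟨M, hM⟩ := CStarAlgebra.nonneg_iff_eq_star_mul_self.1 hJ.posSemidef.nonneg
  rw [Matrix.star_eq_conjTranspose, Matrix.conjTranspose_eq_transpose_of_trivial] at hM
  have hdet : J.det = M.det ^ 2 := by rw [hM, Matrix.det_mul, Matrix.det_transpose, sq]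
  refine ⟨M, fun h => ?_, ?_, fun u => ?_⟩
  · have := hJ.det_pos
    rw [hdet, h] at this
    simp at this
  · rw [hdet, Real.sqrt_sq_eq_abs]
  · rw [hM, ← Matrix.mulVec_mulVec, Matrix.dotProduct_mulVec, Matrix.vecMul_transpose]

/-- With J = MᵀM, combine ‖u‖ ≤ ‖M⁻¹‖‖Mu‖ with the fact that the square of the sup norm is at most
the Euclidean one. -/
lemma exists_le_dotProduct_mulVec (hJ : J.PosDef) :
    ∃ c > 0, ∀ u : Par d, c * ‖u‖ ^ 2 ≤ u ⬝ᵥ (J *ᵥ u) := by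
  obtain ⟨M, hM, -, hq⟩ := exists_sqrt_matrix hJ
  have hu : IsUnit M.det := isUnit_iff_ne_zero.2 hM
  set L : Par d →L[ℝ] Par d := LinearMap.toContinuousLinearMap (Matrix.mulVecLin M⁻¹)
  have hL : ∀ u, ‖u‖ ≤ ‖L‖ * ‖M *ᵥ u‖ := fun u => by
    have h := L.le_opNorm (M *ᵥ u)
    have e : L (M *ᵥ u) = u := by
      change M⁻¹ *ᵥ (M *ᵥ u) = u
      rw [Matrix.mulVec_mulVec, Matrix.nonsing_inv_mul _ hu, Matrix.one_mulVec]
    rwa [e] at h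
  have hnorm : ∀ x : Par d, ‖x‖ ^ 2 ≤ x ⬝ᵥ x := fun x => by
    have h0 : 0 ≤ x ⬝ᵥ x := Finset.sum_nonneg fun i _ => mul_self_nonneg _
    refine (Real.le_sqrt (norm_nonneg _) h0).1 ((pi_norm_le_iff_of_nonneg
      (Real.sqrt_nonneg _)).2 fun i => ?_)
    rw [Real.norm_eq_abs]
    refine Real.abs_le_sqrt ?_
    rw [sq]
    exact Finset.single_le_sum (f := fun i => x i * x i) (fun i _ => mul_self_nonneg _)
      (Finset.mem_univ i)
  refine ⟨1 / (‖L‖ ^ 2 + 1), by positivity, fun u => ?_⟩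
  rw [hq, div_mul_eq_mul_div, one_mul, div_le_iff₀ (by positivity)]
  have h1 : ‖u‖ ^ 2 ≤ ‖L‖ ^ 2 * ‖M *ᵥ u‖ ^ 2 := by
    rw [← mul_pow]; exact pow_le_pow_left₀ (norm_nonneg _) (hL u) 2
  nlinarith [hnorm (M *ᵥ u), sq_nonneg ‖L‖, sq_nonneg ‖M *ᵥ u‖]

lemma integrable_gauss (hJ : J.PosDef) :
    Integrable fun u : Par d => Real.exp (-(1 / 2 * (u ⬝ᵥ (J *ᵥ u)))) := by
  obtain ⟨c, hc, h⟩ := exists_le_dotProduct_mulVec hJ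
  refine (integrable_exp_neg_mul_norm_sq (d := d) (c := c / 2) (by positivity)).mono' ?_
    (Eventually.of_forall fun u => ?_)
  · simp only [dotProduct_mulVec_self_eq_sum]
    fun_prop
  · rw [Real.norm_eq_abs, Real.abs_exp, Real.exp_le_exp]
    linarith [h u]

lemma gaussConst_pos (hJ : J.PosDef) : 0 < gaussConst J :=
  integral_exp_pos (integrable_gauss hJ)

/-- The normalising constant depends on `J` through its determinant only. -/
lemma log_gaussConst (hJ : J.PosDef) : Real.log (gaussConst J)
    = Real.log (∫ u : Par d, Real.exp (-(1 / 2 * (u ⬝ᵥ u)))) - 1 / 2 * Real.log J.det := by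
  obtain ⟨M, hM, hdet, hq⟩ := exists_sqrt_matrix hJ
  have hmap := Real.map_matrix_volume_pi_eq_smul_volume_pi hM
  have hm : Measurable (Matrix.toLin' M) :=
    (LinearMap.continuous_of_finiteDimensional _).measurable
  have h : gaussConst J = |M.det|⁻¹ * ∫ u : Par d, Real.exp (-(1 / 2 * (u ⬝ᵥ u))) := by
    have h1 : ∫ u, Real.exp (-(1 / 2 * (u ⬝ᵥ u))) ∂(Measure.map (Matrix.toLin' M) volume)
        = gaussConst J := by
      rw [integral_map hm.aemeasurable (by simp only [dotProduct]; fun_prop)]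
      simp only [gaussConst, hq, Matrix.toLin'_apply]
    rw [← h1, hmap, integral_smul_measure, ENNReal.toReal_ofReal (abs_nonneg _), abs_inv,
      smul_eq_mul]
  have hpos : 0 < ∫ u : Par d, Real.exp (-(1 / 2 * (u ⬝ᵥ u))) := by
    have := gaussConst_pos hJ
    rw [h] at this
    exact (mul_pos_iff_of_pos_left (inv_pos.2 (abs_pos.2 hM))).1 this
  rw [h, Real.log_mul (inv_ne_zero (abs_ne_zero.2 hM)) hpos.ne', Real.log_inv, hdet,
    Real.log_sqrt hJ.det_pos.le]
  ring

/-- Completing the square. -/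
lemma dotProduct_sub_quadratic_add {S h v : Par d} (hJ : J.PosDef) (hh : J *ᵥ h = S) :
    (h + v) ⬝ᵥ S - 1 / 2 * ((h + v) ⬝ᵥ (J *ᵥ (h + v)))
      = 1 / 2 * (h ⬝ᵥ S) + -(1 / 2 * (v ⬝ᵥ (J *ᵥ v))) := by
  have hsymm : Jᵀ = J := by
    have := hJ.1
    rwa [Matrix.IsHermitian, Matrix.conjTranspose_eq_transpose_of_trivial] at this
  have h1 : h ⬝ᵥ (J *ᵥ v) = v ⬝ᵥ S := by
    rw [Matrix.dotProduct_mulVec, ← Matrix.mulVec_transpose, hsymm, hh, dotProduct_comm]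
  rw [Matrix.mulVec_add, hh, dotProduct_add, add_dotProduct, add_dotProduct, h1]
  ring

lemma mulVec_inv_mulVec (hJ : J.PosDef) (S : Par d) : J *ᵥ (J⁻¹ *ᵥ S) = S := by
  rw [Matrix.mulVec_mulVec, Matrix.mul_nonsing_inv _ (isUnit_iff_ne_zero.2 hJ.det_pos.ne'),
    Matrix.one_mulVec]

/-- Translate by the maximiser J⁻¹S of the exponent and complete the square. -/
lemma lintegral_gauss (hJ : J.PosDef) (S : Par d) :
    ∫⁻ u : Par d, ENNReal.ofReal (Real.exp (u ⬝ᵥ S - 1 / 2 * (u ⬝ᵥ (J *ᵥ u))))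
      = ENNReal.ofReal (gaussConst J * Real.exp (1 / 2 * ((J⁻¹ *ᵥ S) ⬝ᵥ S))) := by
  rw [← lintegral_add_left_eq_self _ (J⁻¹ *ᵥ S)]
  simp_rw [dotProduct_sub_quadratic_add hJ (mulVec_inv_mulVec hJ S), Real.exp_add]
  rw [← ofReal_integral_eq_lintegral_ofReal ((integrable_gauss hJ).const_mul _)
    (Eventually.of_forall fun u => by positivity), integral_const_mul, mul_comm, gaussConst]

/-- The Gaussian integral over a ball. -/
def gaussBall (J : Matrix (Fin d) (Fin d) ℝ) (R : ℝ) : ℝ :=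
  ∫ u in Metric.ball (0 : Par d) R, Real.exp (-(1 / 2 * (u ⬝ᵥ (J *ᵥ u))))

lemma tendsto_gaussBall (hJ : J.PosDef) :
    Tendsto (fun k : ℕ => gaussBall J k) atTop (𝓝 (gaussConst J)) := by
  have hU : ⋃ k : ℕ, Metric.ball (0 : Par d) k = Set.univ := Metric.iUnion_ball_nat 0
  have h := tendsto_setIntegral_of_monotone (μ := volume)
    (f := fun u : Par d => Real.exp (-(1 / 2 * (u ⬝ᵥ (J *ᵥ u)))))
    (fun k : ℕ => (Metric.isOpen_ball (x := (0 : Par d)) (ε := k)).measurableSet)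
    (fun a b hab => Metric.ball_subset_ball (by exact_mod_cast hab)) (integrable_gauss hJ).integrableOn
  rw [hU, Measure.restrict_univ] at h
  exact h

lemma gaussBall_eq_lintegral (hJ : J.PosDef) (R : ℝ) : ENNReal.ofReal (gaussBall J R)
    = ∫⁻ u in Metric.ball (0 : Par d) R,
      ENNReal.ofReal (Real.exp (-(1 / 2 * (u ⬝ᵥ (J *ᵥ u))))) :=
  ofReal_integral_eq_lintegral_ofReal (integrable_gauss hJ).integrableOn
    (Eventually.of_forall fun _ => (Real.exp_pos _).le)

lemma setLIntegral_ball_add (F : Par d → ENNReal) (h : Par d) (R : ℝ) :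
    ∫⁻ u in Metric.ball h R, F u = ∫⁻ v in Metric.ball (0 : Par d) R, F (h + v) := by
  rw [← lintegral_indicator Metric.isOpen_ball.measurableSet,
    ← lintegral_indicator Metric.isOpen_ball.measurableSet, ← lintegral_add_left_eq_self _ h]
  refine lintegral_congr fun v => ?_
  simp [Set.indicator]

/-- The ball of radius `2 * R` about 0 contains the ball of radius `R` about the Gaussian centre
J⁻¹S. -/
lemma ofReal_gaussBall_le_of_le (hJ : J.PosDef) {R : ℝ} {S : Par d}
    (hS : ‖J⁻¹ *ᵥ S‖ ≤ R) :
    ENNReal.ofReal (gaussBall J R * Real.exp (1 / 2 * ((J⁻¹ *ᵥ S) ⬝ᵥ S)))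
      ≤ ∫⁻ u in Metric.ball (0 : Par d) (2 * R),
        ENNReal.ofReal (Real.exp (u ⬝ᵥ S - 1 / 2 * (u ⬝ᵥ (J *ᵥ u)))) := by
  have hsub : Metric.ball (J⁻¹ *ᵥ S) R ⊆ Metric.ball (0 : Par d) (2 * R) :=
    Metric.ball_subset_ball' (by rw [dist_zero_right]; linarith)
  refine le_trans ?_ (lintegral_mono_set hsub)
  rw [setLIntegral_ball_add]
  simp_rw [dotProduct_sub_quadratic_add hJ (mulVec_inv_mulVec hJ S), Real.exp_add,
    ENNReal.ofReal_mul (Real.exp_pos _).le]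
  rw [lintegral_const_mul' _ _ ENNReal.ofReal_ne_top, ← gaussBall_eq_lintegral hJ, mul_comm,
    ENNReal.ofReal_mul (Real.exp_pos _).le]

/-- A weaker bound valid for every `S`, for samples whose Gaussian centre may lie outside the ball.
Averaging the integrand over u and -u and using e^x + e^{-x} ≥ 2 removes the linear term. -/
lemma ofReal_gaussBall_le (hJ : J.PosDef) {R : ℝ} (hR : 0 ≤ R) (S : Par d) :
    ENNReal.ofReal (gaussBall J R) ≤ ∫⁻ u in Metric.ball (0 : Par d) (2 * R),
      ENNReal.ofReal (Real.exp (u ⬝ᵥ S - 1 / 2 * (u ⬝ᵥ (J *ᵥ u)))) := by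
  refine le_trans ?_ (lintegral_mono_set (Metric.ball_subset_ball (by linarith : R ≤ 2 * R)))
  set F : Par d → Par d → ENNReal := fun S u =>
    ENNReal.ofReal (Real.exp (u ⬝ᵥ S - 1 / 2 * (u ⬝ᵥ (J *ᵥ u)))) with hF
  have hmeas : Measurable (F S) := by
    simp only [hF, dotProduct]
    fun_prop
  have hneg : ∫⁻ u in Metric.ball (0 : Par d) R, F (-S) u
      = ∫⁻ u in Metric.ball (0 : Par d) R, F S u := by
    rw [← lintegral_indicator Metric.isOpen_ball.measurableSet,
      ← lintegral_indicator Metric.isOpen_ball.measurableSet, ← lintegral_neg_eq_self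
        (μ := volume) (f := (Metric.ball (0 : Par d) R).indicator (F S))]
    refine lintegral_congr fun v => ?_
    simp [Set.indicator, hF, Matrix.mulVec_neg]
  have h2 : 2 * ENNReal.ofReal (gaussBall J R)
      ≤ 2 * ∫⁻ u in Metric.ball (0 : Par d) R, F S u := by
    rw [two_mul (∫⁻ u in Metric.ball (0 : Par d) R, F S u)]
    nth_rw 2 [← hneg]
    rw [← lintegral_add_left hmeas, gaussBall_eq_lintegral hJ,
      ← lintegral_const_mul' _ _ (by norm_num)]
    refine lintegral_mono fun u => ?_
    have h2 : (2 : ENNReal) = ENNReal.ofReal 2 := by norm_num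
    simp only [hF]
    rw [← ENNReal.ofReal_add (Real.exp_pos _).le (Real.exp_pos _).le, h2,
      ← ENNReal.ofReal_mul zero_le_two]
    refine ENNReal.ofReal_le_ofReal ?_
    rw [sub_eq_add_neg, sub_eq_add_neg, Real.exp_add, Real.exp_add, ← add_mul, dotProduct_neg]
    refine mul_le_mul_of_nonneg_right ?_ (Real.exp_pos _).le
    linarith [Real.add_one_le_exp (u ⬝ᵥ S), Real.add_one_le_exp (-(u ⬝ᵥ S))]
  exact (ENNReal.mul_le_mul_iff_right (by norm_num) (by norm_num)).1 h2

end Gaussian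

/-! ### The evidence of a sample relative to its true density -/

/-- A prior density on `W`, continuous and positive at `w₀`. -/
structure IsPriorAt {d : ℕ} (W : Set (Par d)) (φ : Par d → ℝ) (w₀ : Par d) : Prop where
  measurable : Measurable φ
  nonneg : ∀ w ∈ W, 0 ≤ φ w
  integral_eq_one : ∫ w in W, φ w = 1
  continuousAt : ContinuousAt φ w₀
  pos : 0 < φ w₀

section Evidence

variable {d : ℕ} {Z : Type*} [MeasurableSpace Z]

/-- The likelihood ratio of a sample between `w` and `w₀`. -/
def likRatio (f : Z → Par d → ℝ) (w₀ : Par d) {n : ℕ} (z : Fin n → Z) (w : Par d) : ℝ :=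
  ∏ k, f (z k) w / f (z k) w₀

/-- The evidence of a sample, divided by its true density. -/
def evidenceRatio (W : Set (Par d)) (f : Z → Par d → ℝ) (φ : Par d → ℝ) (w₀ : Par d) {n : ℕ}
    (z : Fin n → Z) : ENNReal :=
  ∫⁻ w in W, ENNReal.ofReal (likRatio f w₀ z w * φ w)

variable {ν : Measure Z} {W : Set (Par d)} {f : Z → Par d → ℝ} {w₀ : Par d} {φ : Par d → ℝ}

namespace IsPriorAt

lemma lintegral_eq_one (hφ : IsPriorAt W φ w₀) (hW : MeasurableSet W) :
    ∫⁻ w in W, ENNReal.ofReal (φ w) = 1 := by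
  rw [← ofReal_integral_eq_lintegral_ofReal, hφ.integral_eq_one, ENNReal.ofReal_one]
  · exact Integrable.of_integral_ne_zero (by rw [hφ.integral_eq_one]; exact one_ne_zero)
  · exact (ae_restrict_iff' hW).2 (Eventually.of_forall hφ.nonneg)

end IsPriorAt

omit [MeasurableSpace Z] in
lemma likRatio_eq_exp {n : ℕ} {z : Fin n → Z} {v : Par d} (h0 : ∀ k, 0 < f (z k) w₀)
    (hv : ∀ k, 0 < f (z k) (w₀ + v)) :
    likRatio f w₀ z (w₀ + v) = Real.exp (logRatio f w₀ z v) := by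
  rw [likRatio, logRatio, Real.exp_sum]
  refine Finset.prod_congr rfl fun k _ => ?_
  rw [Real.exp_sub, Real.exp_log (hv k), Real.exp_log (h0 k)]

namespace IsRegularFamily

lemma likRatio_nonneg (hf : IsRegularFamily ν W f w₀) {n : ℕ} (z : Fin n → Z) {w : Par d}
    (hw : w ∈ W) : 0 ≤ likRatio f w₀ z w :=
  Finset.prod_nonneg fun _ _ => div_nonneg (hf.nonneg _ _ hw) (hf.nonneg _ _ hf.mem)

lemma measurable_likRatio (hf : IsRegularFamily ν W f w₀) (n : ℕ) :
    Measurable fun p : (Fin n → Z) × Par d => likRatio f w₀ p.1 p.2 := by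
  refine Finset.measurable_fun_prod _ fun k _ => ?_
  have h1 : Measurable fun p : (Fin n → Z) × Par d => f (p.1 k) p.2 :=
    hf.measurable_uncurry.comp (g := fun z : Z × Par d => f z.1 z.2)
      (f := fun p : (Fin n → Z) × Par d => (p.1 k, p.2))
      (((measurable_pi_apply k).comp measurable_fst).prodMk measurable_snd)
  have h2 : Measurable fun p : (Fin n → Z) × Par d => f (p.1 k) w₀ :=
    (hf.measurable w₀).comp ((measurable_pi_apply k).comp measurable_fst)
  exact h1.div h2

lemma measurable_evidenceRatio (hf : IsRegularFamily ν W f w₀) (hφ : IsPriorAt W φ w₀) (n : ℕ) :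
    Measurable fun z : Fin n → Z => evidenceRatio W f φ w₀ z :=
  Measurable.lintegral_prod_right' (f := fun p : (Fin n → Z) × Par d =>
    ENNReal.ofReal (likRatio f w₀ p.1 p.2 * φ p.2))
    ((hf.measurable_likRatio n).mul (hφ.measurable.comp measurable_snd)).ennreal_ofReal

/-- Only an inequality: where f(x, w₀) = 0 the quotient is 0 by convention, so the mass that `w`
puts there is lost. -/
lemma lintegral_ratio_mul_le (hf : IsRegularFamily ν W f w₀) {w : Par d} (hw : w ∈ W)
    {F : Z → ENNReal} (hF : Measurable F) :
    ∫⁻ x, ENNReal.ofReal (f x w / f x w₀) * F x ∂trueLaw ν f w₀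
      ≤ ∫⁻ x, ENNReal.ofReal (f x w) * F x ∂ν := by
  rw [trueLaw, lintegral_withDensity_eq_lintegral_mul _ (hf.measurable w₀).ennreal_ofReal
    (g := fun x => ENNReal.ofReal (f x w / f x w₀) * F x) (((hf.measurable w).div (hf.measurable w₀)).ennreal_ofReal.mul hF)]
  refine lintegral_mono fun x => ?_
  simp only [Pi.mul_apply]
  rw [← mul_assoc, ← ENNReal.ofReal_mul (hf.nonneg x _ hf.mem)]
  gcongr
  rcases eq_or_ne (f x w₀) 0 with h | h
  · rw [h, zero_mul]; exact hf.nonneg x w hw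
  · rw [mul_div_cancel₀ _ h]

/-- Change of measure from `w₀` to `w` for functions of product form. -/
lemma lintegral_likRatio_mul_le (hf : IsRegularFamily ν W f w₀) {w : Par d} (hw : w ∈ W) (n : ℕ)
    {F : Z → ENNReal} (hF : Measurable F) :
    ∫⁻ z, ENNReal.ofReal (likRatio f w₀ z w) * ∏ k, F (z k) ∂sampleLaw (trueLaw ν f w₀) n
      ≤ (∫⁻ x, ENNReal.ofReal (f x w) * F x ∂ν) ^ n := by
  have := hf.isProbabilityMeasure
  have e : ∀ z : Fin n → Z, ENNReal.ofReal (likRatio f w₀ z w) * ∏ k, F (z k)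
      = ∏ k, ENNReal.ofReal (f (z k) w / f (z k) w₀) * F (z k) := fun z => by
    rw [likRatio, ENNReal.ofReal_prod_of_nonneg fun k _ =>
      div_nonneg (hf.nonneg _ _ hw) (hf.nonneg _ _ hf.mem), Finset.prod_mul_distrib]
  simp_rw [e]
  rw [lintegral_prod_sampleLaw n
    (F := fun x => ENNReal.ofReal (f x w / f x w₀) * F x)
    (((hf.measurable w).div (hf.measurable w₀)).ennreal_ofReal.mul hF)]
  exact pow_le_pow_left₀ (zero_le) (hf.lintegral_ratio_mul_le hw hF) n

lemma lintegral_likRatio_le (hf : IsRegularFamily ν W f w₀) {w : Par d} (hw : w ∈ W) (n : ℕ) :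
    ∫⁻ z, ENNReal.ofReal (likRatio f w₀ z w) ∂sampleLaw (trueLaw ν f w₀) n ≤ 1 := by
  have h := hf.lintegral_likRatio_mul_le hw n (F := fun _ => 1) measurable_const
  simp only [Finset.prod_const_one, mul_one] at h
  rwa [← ofReal_integral_eq_lintegral_ofReal (hf.integrable hw)
    (Eventually.of_forall fun z => hf.nonneg z _ hw), hf.integral_eq_one _ hw,
    ENNReal.ofReal_one, one_pow] at h

/-- Tonelli: each likelihood ratio has mean at most 1 and the prior has mass 1. This yields almost
sure finiteness and, through log y ≤ y - 1, the upper half of the integrability of the log-evidence.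
-/
lemma lintegral_evidenceRatio_le (hf : IsRegularFamily ν W f w₀) (hφ : IsPriorAt W φ w₀) (n : ℕ) :
    ∫⁻ z, evidenceRatio W f φ w₀ z ∂sampleLaw (trueLaw ν f w₀) n ≤ 1 := by
  have := hf.isProbabilityMeasure
  have hm : Measurable fun p : (Fin n → Z) × Par d =>
      ENNReal.ofReal (likRatio f w₀ p.1 p.2 * φ p.2) :=
    ((hf.measurable_likRatio n).mul (hφ.measurable.comp measurable_snd)).ennreal_ofReal
  simp only [evidenceRatio]
  rw [lintegral_lintegral_swap hm.aemeasurable, ← hφ.lintegral_eq_one hf.measurableSet]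
  refine setLIntegral_mono hφ.measurable.ennreal_ofReal fun w hw => ?_
  simp_rw [ENNReal.ofReal_mul (hf.likRatio_nonneg _ hw)]
  rw [lintegral_mul_const' _ _ ENNReal.ofReal_ne_top]
  exact mul_le_of_le_one_left' (hf.lintegral_likRatio_le hw n)

lemma ae_evidenceRatio_lt_top (hf : IsRegularFamily ν W f w₀) (hφ : IsPriorAt W φ w₀) (n : ℕ) :
    ∀ᵐ z ∂sampleLaw (trueLaw ν f w₀) n, evidenceRatio W f φ w₀ z < ⊤ :=
  ae_lt_top (hf.measurable_evidenceRatio hφ n)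
    ((hf.lintegral_evidenceRatio_le hφ n).trans_lt ENNReal.one_lt_top).ne

/-- The bridge from Bochner integrals of the model to `evidenceRatio`. Finiteness is not needed: for
an infinite evidence both sides are 0. -/
lemma integral_prod_mul_prior (hf : IsRegularFamily ν W f w₀) (hφ : IsPriorAt W φ w₀) {n : ℕ}
    {z : Fin n → Z} (h0 : ∀ k, 0 < f (z k) w₀) :
    ∫ w in W, (∏ k, f (z k) w) * φ w
      = (∏ k, f (z k) w₀) * (evidenceRatio W f φ w₀ z).toReal := by
  have hne : ∏ k, f (z k) w₀ ≠ 0 := (Finset.prod_pos fun k _ => h0 k).ne'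
  have e : ∀ w, (∏ k, f (z k) w) * φ w = (∏ k, f (z k) w₀) * (likRatio f w₀ z w * φ w) := by
    intro w
    rw [likRatio, Finset.prod_div_distrib, ← mul_assoc, mul_div_cancel₀ _ hne]
  simp_rw [e]
  rw [integral_const_mul, integral_eq_lintegral_of_nonneg_ae, evidenceRatio]
  · exact (ae_restrict_iff' hf.measurableSet).2
      (Eventually.of_forall fun w hw => mul_nonneg (hf.likRatio_nonneg z hw) (hφ.nonneg w hw))
  · exact (((hf.measurable_likRatio n).comp (measurable_const.prodMk measurable_id)).mul
      hφ.measurable).aestronglyMeasurable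

end IsRegularFamily

namespace LocalBounds

variable {r : ℝ} {B G : Z → ℝ}

/-- A lower bound for the evidence that is valid for every sample size. -/
lemma exists_le_evidenceRatio (hf : IsRegularFamily ν W f w₀) (hb : LocalBounds ν W f w₀ r B G)
    (hφ : IsPriorAt W φ w₀) :
    ∃ c : ℝ, 0 < c ∧ ∃ g : Z → ℝ, Integrable g (trueLaw ν f w₀) ∧ ∀ n : ℕ,
      ∀ᵐ z ∂sampleLaw (trueLaw ν f w₀) n,
        ENNReal.ofReal (c * Real.exp (-∑ k, g (z k))) ≤ evidenceRatio W f φ w₀ z := by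
  have := hf.isProbabilityMeasure
  obtain ⟨δ, hδ, hδφ⟩ := Metric.eventually_nhds_iff_ball.1
    (hφ.continuousAt.eventually (lt_mem_nhds (half_lt_self hφ.pos)))
  set s := min δ r with hs
  have hs0 : 0 < s := lt_min hδ hb.pos
  set V := (volume (Metric.ball w₀ s)).toReal with hV
  have hV0 : 0 < V := ENNReal.toReal_pos (Metric.measure_ball_pos _ _ hs0).ne'
    measure_ball_lt_top.ne
  -- `g` bounds the loss of log-likelihood anywhere in the ball: the linear term through the scores,
  -- the quadratic one through `G`.
  set g : Z → ℝ := fun x => ∑ i, r * |score f w₀ x i| + (d : ℝ) ^ 2 * G x * r ^ 2 with hg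
  refine ⟨φ w₀ / 2 * V, mul_pos (half_pos hφ.pos) hV0, g, ?_, fun n => ?_⟩
  · exact (integrable_finsetSum _ fun i _ =>
      ((hb.memLp_score hf i).integrable (by norm_num)).abs.const_mul r).add
      (((hb.memLp_G.integrable (by norm_num)).const_mul _).mul_const _)
  filter_upwards [ae_sampleLaw_forall n hb.smooth_log, ae_sampleLaw_forall n hb.le_G,
    ae_sampleLaw_forall n hb.pos_ae] with z hz hG hpos
  have hsub : Metric.ball w₀ s ⊆ W := (Metric.ball_subset_ball (min_le_right _ _)).trans hb.subset
  have hpt : ∀ w ∈ Metric.ball w₀ s,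
      φ w₀ / 2 * Real.exp (-∑ k, g (z k)) ≤ likRatio f w₀ z w * φ w := by
    intro w hw
    have hwr : w ∈ Metric.ball w₀ r := Metric.ball_subset_ball (min_le_right _ _) hw
    have hv : ‖w - w₀‖ < r := mem_ball_iff_norm.1 hwr
    have he : w = w₀ + (w - w₀) := by simp
    rw [mul_comm (φ w₀ / 2)]
    refine mul_le_mul ?_ (hδφ w (Metric.ball_subset_ball (min_le_left _ _) hw)).le
      (half_pos hφ.pos).le (hf.likRatio_nonneg z (hsub hw))
    rw [he, likRatio_eq_exp (fun k => hpos k _ hb.center_mem) (fun k => by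
      rw [← he]; exact hpos k _ hwr), Real.exp_le_exp, logRatio, ← Finset.sum_neg_distrib]
    refine Finset.sum_le_sum fun k _ => ?_
    have h := abs_taylor_remainder_le (hz k) hv (fun _ _ => 0) (C := G (z k)) fun u hu i j => by
      rw [sub_zero]
      exact hG k _ (by simpa [mem_ball_iff_norm] using hu.trans_lt hv) i j
    simp only [mul_zero, Finset.sum_const_zero, sub_zero] at h
    have h1 := (abs_le.1 h).1
    have h2 : |∑ i, (w - w₀) i * pderiv i (fun v => Real.log (f (z k) v)) w₀|
        ≤ ∑ i, r * |score f w₀ (z k) i| := by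
      refine (Finset.abs_sum_le_sum_abs _ _).trans (Finset.sum_le_sum fun i _ => ?_)
      rw [abs_mul]
      exact mul_le_mul_of_nonneg_right ((norm_le_pi_norm (w - w₀) i).trans hv.le) (abs_nonneg _)
    have h3 : (d : ℝ) ^ 2 * G (z k) * ‖w - w₀‖ ^ 2 ≤ (d : ℝ) ^ 2 * G (z k) * r ^ 2 := by
      have := hb.G_nonneg (z k)
      gcongr
    have h4 := (abs_le.1 h2).1
    simp only [hg]
    linarith
  calc ENNReal.ofReal (φ w₀ / 2 * V * Real.exp (-∑ k, g (z k)))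
      = ENNReal.ofReal (φ w₀ / 2 * Real.exp (-∑ k, g (z k))) * volume (Metric.ball w₀ s) := by
        rw [← ENNReal.ofReal_toReal (measure_ball_lt_top (μ := volume) (x := w₀) (r := s)).ne,
          ← ENNReal.ofReal_mul (mul_nonneg (half_pos hφ.pos).le (Real.exp_pos _).le)]
        congr 1
        ring
    _ = ∫⁻ _ in Metric.ball w₀ s, ENNReal.ofReal (φ w₀ / 2 * Real.exp (-∑ k, g (z k))) := by
        rw [setLIntegral_const]
    _ ≤ ∫⁻ w in Metric.ball w₀ s, ENNReal.ofReal (likRatio f w₀ z w * φ w) :=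
        setLIntegral_mono' Metric.isOpen_ball.measurableSet fun w hw =>
          ENNReal.ofReal_le_ofReal (hpt w hw)
    _ ≤ _ := lintegral_mono_set hsub

lemma ae_evidenceRatio_pos (hf : IsRegularFamily ν W f w₀) (hb : LocalBounds ν W f w₀ r B G)
    (hφ : IsPriorAt W φ w₀) (n : ℕ) :
    ∀ᵐ z ∂sampleLaw (trueLaw ν f w₀) n, 0 < (evidenceRatio W f φ w₀ z).toReal := by
  obtain ⟨c, hc, g, -, h⟩ := hb.exists_le_evidenceRatio hf hφ
  filter_upwards [h n, hf.ae_evidenceRatio_lt_top hφ n] with z hz hz'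
  refine ENNReal.toReal_pos (fun h0 => ?_) hz'.ne
  rw [h0, nonpos_iff_eq_zero, ENNReal.ofReal_eq_zero] at hz
  exact absurd hz (not_le.2 (mul_pos hc (Real.exp_pos _)))

/-- The expected log-evidence exists for every sample size. -/
theorem integrable_log_evidenceRatio (hf : IsRegularFamily ν W f w₀)
    (hb : LocalBounds ν W f w₀ r B G) (hφ : IsPriorAt W φ w₀) (n : ℕ) :
    Integrable (fun z => Real.log (evidenceRatio W f φ w₀ z).toReal)
      (sampleLaw (trueLaw ν f w₀) n) := by
  have := hf.isProbabilityMeasure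
  obtain ⟨c, hc, g, hg, h⟩ := hb.exists_le_evidenceRatio hf hφ
  have hY : Integrable (fun z => (evidenceRatio W f φ w₀ z).toReal)
      (sampleLaw (trueLaw ν f w₀) n) :=
    integrable_toReal_of_lintegral_ne_top (hf.measurable_evidenceRatio hφ n).aemeasurable
      ((hf.lintegral_evidenceRatio_le hφ n).trans_lt ENNReal.one_lt_top).ne
  -- Above, log y ≤ y - 1; below, log c - ∑ g. The three summands dominate both bounds.
  refine ((hY.add (integrable_const |Real.log c|)).add (integrable_sum_sampleLaw n hg).abs).mono'
    (hf.measurable_evidenceRatio hφ n).ennreal_toReal.log.aestronglyMeasurable ?_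
  filter_upwards [h n, hf.ae_evidenceRatio_lt_top hφ n, hb.ae_evidenceRatio_pos hf hφ n]
    with z hz hz' hpos
  have h1 : c * Real.exp (-∑ k, g (z k)) ≤ (evidenceRatio W f φ w₀ z).toReal :=
    (ENNReal.ofReal_le_iff_le_toReal hz'.ne).1 hz
  have h2 := Real.log_le_log (mul_pos hc (Real.exp_pos _)) h1
  rw [Real.log_mul hc.ne' (Real.exp_pos _).ne', Real.log_exp] at h2
  have h3 := Real.log_le_sub_one_of_pos hpos
  simp only [Pi.add_apply]
  rw [Real.norm_eq_abs, abs_le]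
  constructor <;> linarith [neg_abs_le (Real.log c), abs_nonneg (Real.log c),
    le_abs_self (∑ k, g (z k)), abs_nonneg (∑ k, g (z k))]

end LocalBounds

-- The substitution w = w₀ + u/√n has Jacobian n^{-d/2}, the source of the term (d/2) log n. The
-- indicator keeps the image of `W` out of the domain of integration.
omit [MeasurableSpace Z] in
lemma ofReal_mul_evidenceRatio {W : Set (Par d)} (hW : MeasurableSet W) {n : ℕ} (hn : 0 < n)
    (z : Fin n → Z) :
    ENNReal.ofReal (Real.sqrt n ^ d) * evidenceRatio W f φ w₀ z
      = ∫⁻ u : Par d, W.indicator (fun w => ENNReal.ofReal (likRatio f w₀ z w * φ w))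
          (w₀ + (Real.sqrt n)⁻¹ • u) := by
  have hs : 0 < Real.sqrt n := Real.sqrt_pos.2 (by exact_mod_cast hn)
  set F := W.indicator (fun w => ENNReal.ofReal (likRatio f w₀ z w * φ w)) with hF
  have h1 : evidenceRatio W f φ w₀ z = ∫⁻ w, F (w₀ + w) := by
    rw [lintegral_add_left_eq_self, hF, lintegral_indicator hW, evidenceRatio]
  have he := (Homeomorph.smulOfNeZero (Real.sqrt n)⁻¹ (inv_ne_zero hs.ne')
    (α := Par d)).measurableEmbedding.lintegral_map (μ := volume) (fun w => F (w₀ + w))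
  have hmap := Measure.map_addHaar_smul (volume : Measure (Par d)) (inv_ne_zero hs.ne')
  change ∫⁻ w, F (w₀ + w) ∂(Measure.map (fun x => (Real.sqrt n)⁻¹ • x) volume)
    = ∫⁻ u, F (w₀ + (Real.sqrt n)⁻¹ • u) at he
  rw [← he, hmap, lintegral_smul_measure, h1, smul_eq_mul]
  congr 2
  rw [abs_of_pos (by positivity)]
  simp

end Evidence

/-! ### Moments of the normalised score -/

section Score

variable {d : ℕ} {Z : Type*} [MeasurableSpace Z] {ν : Measure Z} {W : Set (Par d)}
  {f : Z → Par d → ℝ} {w₀ : Par d} {φ : Par d → ℝ} {r : ℝ} {B G : Z → ℝ}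

/-- The quadratic form `S ⬝ J⁻¹ S`. -/
def invQuad (J : Matrix (Fin d) (Fin d) ℝ) (S : Par d) : ℝ := (J⁻¹ *ᵥ S) ⬝ᵥ S

lemma invQuad_eq_sum (J : Matrix (Fin d) (Fin d) ℝ) (S : Par d) :
    invQuad J S = ∑ i, ∑ j, J⁻¹ i j * (S i * S j) := by
  rw [invQuad, dotProduct_comm, dotProduct_mulVec_self_eq_sum]
  exact Finset.sum_congr rfl fun i _ => Finset.sum_congr rfl fun j _ => by ring

lemma invQuad_nonneg {J : Matrix (Fin d) (Fin d) ℝ} (hJ : J.PosDef) (S : Par d) :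
    0 ≤ invQuad J S := by
  rw [invQuad, dotProduct_comm]
  simpa using hJ.inv.posSemidef.dotProduct_mulVec_nonneg S

namespace LocalBounds

lemma memLp_normScore (hf : IsRegularFamily ν W f w₀) (hb : LocalBounds ν W f w₀ r B G)
    (n : ℕ) (i : Fin d) :
    MemLp (fun z => normScore f w₀ n z i) 2 (sampleLaw (trueLaw ν f w₀) n) := by
  have := hf.isProbabilityMeasure
  exact (memLp_sum_sampleLaw n (hb.memLp_score hf i)).const_mul _

lemma integral_normScore_mul (hf : IsRegularFamily ν W f w₀) (hb : LocalBounds ν W f w₀ r B G)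
    {n : ℕ} (hn : 0 < n) (i j : Fin d) :
    ∫ z, normScore f w₀ n z i * normScore f w₀ n z j ∂sampleLaw (trueLaw ν f w₀) n
      = scoreCov ν f w₀ i j := by
  have := hf.isProbabilityMeasure
  have hn0 : (0 : ℝ) < n := by exact_mod_cast hn
  have hsq : (Real.sqrt n)⁻¹ * (Real.sqrt n)⁻¹ = (n : ℝ)⁻¹ := by
    rw [← mul_inv, Real.mul_self_sqrt hn0.le]
  have e : ∀ z : Fin n → Z, normScore f w₀ n z i * normScore f w₀ n z j
      = (n : ℝ)⁻¹ * ((∑ k, score f w₀ (z k) i) * ∑ k, score f w₀ (z k) j) := fun z => by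
    rw [normScore, normScore, ← hsq]; ring
  simp_rw [e]
  rw [integral_const_mul, integral_mul_sum_sampleLaw n (hb.memLp_score hf i) (hb.memLp_score hf j)
    (hb.integral_score hf i) (hb.integral_score hf j), scoreCov, Matrix.of_apply]
  field_simp

lemma integrable_invQuad (hf : IsRegularFamily ν W f w₀) (hb : LocalBounds ν W f w₀ r B G)
    (n : ℕ) : Integrable (fun z => invQuad (scoreCov ν f w₀) (normScore f w₀ n z))
      (sampleLaw (trueLaw ν f w₀) n) := by
  simp_rw [invQuad_eq_sum]
  exact integrable_finsetSum _ fun i _ => integrable_finsetSum _ fun j _ =>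
    ((hb.memLp_normScore hf n i).integrable_mul (hb.memLp_normScore hf n j)).const_mul _

/-- The mean is the trace of J⁻¹J. This is the origin of the constant d/2 in the expansion. -/
lemma integral_invQuad (hf : IsRegularFamily ν W f w₀) (hb : LocalBounds ν W f w₀ r B G)
    (hJ : (scoreCov ν f w₀).PosDef) {n : ℕ} (hn : 0 < n) :
    ∫ z, invQuad (scoreCov ν f w₀) (normScore f w₀ n z) ∂sampleLaw (trueLaw ν f w₀) n = d := by
  have hint : ∀ i j, Integrable (fun z => normScore f w₀ n z i * normScore f w₀ n z j)
      (sampleLaw (trueLaw ν f w₀) n) := fun i j =>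
    (hb.memLp_normScore hf n i).integrable_mul (hb.memLp_normScore hf n j)
  have hsymm : ∀ i j, scoreCov ν f w₀ i j = scoreCov ν f w₀ j i := fun i j => by
    simp only [scoreCov, Matrix.of_apply, mul_comm]
  have hA : ∀ i, Integrable (fun z => ∑ j, (scoreCov ν f w₀)⁻¹ i j *
      (normScore f w₀ n z i * normScore f w₀ n z j)) (sampleLaw (trueLaw ν f w₀) n) :=
    fun i => integrable_finsetSum _ fun j _ => (hint i j).const_mul _
  simp_rw [invQuad_eq_sum]
  rw [integral_finsetSum _ fun i _ => hA i]
  have h1 : ∀ i, ∫ z, ∑ j, (scoreCov ν f w₀)⁻¹ i j * (normScore f w₀ n z i * normScore f w₀ n z j)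
      ∂sampleLaw (trueLaw ν f w₀) n = ((scoreCov ν f w₀)⁻¹ * scoreCov ν f w₀) i i := fun i => by
    have hA' : ∀ j, Integrable (fun z => (scoreCov ν f w₀)⁻¹ i j *
        (normScore f w₀ n z i * normScore f w₀ n z j)) (sampleLaw (trueLaw ν f w₀) n) :=
      fun j => (hint i j).const_mul _
    rw [integral_finsetSum _ fun j _ => hA' j, Matrix.mul_apply]
    refine Finset.sum_congr rfl fun j _ => ?_
    rw [integral_const_mul, hb.integral_normScore_mul hf hn, hsymm]
  simp_rw [h1]
  rw [Matrix.nonsing_inv_mul _ (isUnit_iff_ne_zero.2 hJ.det_pos.ne')]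
  simp

/-- Uniform integrability of the squared norm of the normalised score. -/
lemma uniformIntegrable_normScore (hf : IsRegularFamily ν W f w₀)
    (hb : LocalBounds ν W f w₀ r B G) {ε : ℝ} (hε : 0 < ε) :
    ∃ R : ℝ, 0 < R ∧ ∀ᶠ n : ℕ in atTop, ∃ U : (Fin n → Z) → ℝ,
      Integrable U (sampleLaw (trueLaw ν f w₀) n) ∧
      ∫ z, U z ∂sampleLaw (trueLaw ν f w₀) n ≤ ε ∧ (∀ z, 0 ≤ U z) ∧
      ∀ z : Fin n → Z, R < ‖normScore f w₀ n z‖ → ‖normScore f w₀ n z‖ ^ 2 ≤ U z := by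
  have := hf.isProbabilityMeasure
  have h := fun i => uniformIntegrable_normalized_sum_sq (hb.memLp_score hf i)
    (hb.integral_score hf i) (ε := ε / (d + 1)) (by positivity)
  choose R hR hU using h
  refine ⟨∑ i, R i + 1, by have := Finset.sum_nonneg fun i (_ : i ∈ Finset.univ) => (hR i).le
                           linarith, ?_⟩
  filter_upwards [eventually_all.2 hU] with n hn
  choose U hUi hUε hU0 hUle using hn
  refine ⟨fun z => ∑ i, U i z, integrable_finsetSum _ fun i _ => hUi i, ?_,
    fun z => Finset.sum_nonneg fun i _ => hU0 i z, fun z hz => ?_⟩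
  · rw [integral_finsetSum _ fun i _ => hUi i]
    calc _ ≤ ∑ _i : Fin d, ε / (d + 1) := Finset.sum_le_sum fun i _ => hUε i
      _ = ε * (d / (d + 1)) := by simp; ring
      _ ≤ ε := mul_le_of_le_one_right hε.le ((div_le_one (by positivity)).2 (by linarith))
  · set S := normScore f w₀ n z with hS
    set U' := ∑ i, U i z with hU'
    have hU'0 : 0 ≤ U' := Finset.sum_nonneg fun i _ => hU0 i z
    have hRsum : 0 ≤ ∑ i, R i := Finset.sum_nonneg fun i _ => (hR i).le
    -- A coordinate beyond its own `R i` is at most the square root of `U'`; the others stay below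
    -- the common threshold.
    have hmax : ‖S‖ ≤ max (∑ i, R i + 1) (Real.sqrt U') := by
      refine (pi_norm_le_iff_of_nonneg (le_max_of_le_right (Real.sqrt_nonneg _))).2 fun i => ?_
      rw [Real.norm_eq_abs]
      have hRi : R i ≤ ∑ i, R i := Finset.single_le_sum (fun i _ => (hR i).le) (Finset.mem_univ i)
      by_cases hi : R i < |S i|
      · refine le_max_of_le_right (Real.abs_le_sqrt ((hUle i z hi).trans ?_))
        exact Finset.single_le_sum (f := fun i => U i z) (fun i _ => hU0 i z) (Finset.mem_univ i)
      · exact le_max_of_le_left (by linarith)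
    have h2 : ‖S‖ ≤ Real.sqrt U' := (le_max_iff.1 hmax).resolve_left (not_le.2 hz)
    calc ‖S‖ ^ 2 ≤ Real.sqrt U' ^ 2 := pow_le_pow_left₀ (norm_nonneg _) h2 2
      _ = U' := Real.sq_sqrt hU'0

/-! ### Lower bound for the expected log-evidence -/

lemma exists_bounds_inv (J : Matrix (Fin d) (Fin d) ℝ) : ∃ K₁ K₂ : ℝ, 0 ≤ K₁ ∧ 0 ≤ K₂ ∧
    ∀ S : Par d, ‖J⁻¹ *ᵥ S‖ ≤ K₁ * ‖S‖ ∧ 1 / 2 * invQuad J S ≤ K₂ * ‖S‖ ^ 2 := by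
  set L : Par d →L[ℝ] Par d := LinearMap.toContinuousLinearMap (Matrix.mulVecLin J⁻¹)
  have hL : ∀ S, ‖J⁻¹ *ᵥ S‖ ≤ ‖L‖ * ‖S‖ := fun S => L.le_opNorm S
  refine ⟨‖L‖, d * ‖L‖, norm_nonneg _, by positivity, fun S => ⟨hL S, ?_⟩⟩
  have h1 : invQuad J S ≤ ∑ _i : Fin d, ‖L‖ * ‖S‖ * ‖S‖ := by
    rw [invQuad, dotProduct]
    refine Finset.sum_le_sum fun i _ => le_trans (le_abs_self _) ?_
    rw [abs_mul]
    exact mul_le_mul ((norm_le_pi_norm _ i).trans (hL S)) (norm_le_pi_norm S i) (abs_nonneg _)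
      (by positivity)
  have h2 : ∑ _i : Fin d, ‖L‖ * ‖S‖ * ‖S‖ = d * ‖L‖ * ‖S‖ ^ 2 := by simp; ring
  have h3 : 0 ≤ d * ‖L‖ * ‖S‖ ^ 2 := by positivity
  rw [h2] at h1
  linarith

/-- A pointwise lower bound for the evidence at the scale `n^{-1/2}`. -/
lemma le_log_evidenceRatio (hW : MeasurableSet W)
    {n : ℕ} (hn : 0 < n) {R c ρ : ℝ} (hc : 0 < c)
    {z : Fin n → Z} (hfin : evidenceRatio W f φ w₀ z < ⊤)
    (hloc : ∀ u : Par d, ‖u‖ < 2 * R → w₀ + (Real.sqrt n)⁻¹ • u ∈ W ∧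
      c ≤ φ (w₀ + (Real.sqrt n)⁻¹ • u) ∧ (∀ k, 0 < f (z k) (w₀ + (Real.sqrt n)⁻¹ • u)))
    (h0 : ∀ k, 0 < f (z k) w₀)
    (hρ : ∀ u : Par d, ‖u‖ < 2 * R → |logRatio f w₀ z ((Real.sqrt n)⁻¹ • u)
          - (u ⬝ᵥ normScore f w₀ n z - 1 / 2 * (u ⬝ᵥ (scoreCov ν f w₀ *ᵥ u)))| ≤ ρ)
    {b : ℝ} (hball : ENNReal.ofReal (Real.exp b)
      ≤ ∫⁻ u in Metric.ball (0 : Par d) (2 * R), ENNReal.ofReal (Real.exp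
        (u ⬝ᵥ normScore f w₀ n z - 1 / 2 * (u ⬝ᵥ (scoreCov ν f w₀ *ᵥ u))))) :
    Real.log c - ρ + b ≤ Real.log (evidenceRatio W f φ w₀ z).toReal + d / 2 * Real.log n := by
  have hn0 : (0 : ℝ) < n := by exact_mod_cast hn
  have hs : 0 < Real.sqrt n := Real.sqrt_pos.2 hn0
  have hlow : ENNReal.ofReal (Real.exp (Real.log c - ρ + b))
      ≤ ENNReal.ofReal (Real.sqrt n ^ d) * evidenceRatio W f φ w₀ z := by
    rw [ofReal_mul_evidenceRatio hW hn]
    calc ENNReal.ofReal (Real.exp (Real.log c - ρ + b))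
        = ENNReal.ofReal (c * Real.exp (-ρ)) * ENNReal.ofReal (Real.exp b) := by
          rw [← ENNReal.ofReal_mul (by positivity), Real.exp_add, sub_eq_add_neg, Real.exp_add,
            Real.exp_log hc]
      _ ≤ ENNReal.ofReal (c * Real.exp (-ρ)) *
          ∫⁻ u in Metric.ball (0 : Par d) (2 * R), ENNReal.ofReal (Real.exp
            (u ⬝ᵥ normScore f w₀ n z - 1 / 2 * (u ⬝ᵥ (scoreCov ν f w₀ *ᵥ u)))) := by gcongr
      _ = ∫⁻ u in Metric.ball (0 : Par d) (2 * R), ENNReal.ofReal (c * Real.exp (-ρ)) *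
            ENNReal.ofReal (Real.exp
              (u ⬝ᵥ normScore f w₀ n z - 1 / 2 * (u ⬝ᵥ (scoreCov ν f w₀ *ᵥ u)))) :=
          (lintegral_const_mul' _ _ ENNReal.ofReal_ne_top).symm
      _ ≤ ∫⁻ u in Metric.ball (0 : Par d) (2 * R),
            W.indicator (fun w => ENNReal.ofReal (likRatio f w₀ z w * φ w))
              (w₀ + (Real.sqrt n)⁻¹ • u) := by
          refine setLIntegral_mono' Metric.isOpen_ball.measurableSet fun u hu => ?_
          have hu' : ‖u‖ < 2 * R := mem_ball_zero_iff.1 hu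
          obtain ⟨h1, h2, h3⟩ := hloc u hu'
          rw [Set.indicator_of_mem h1, likRatio_eq_exp h0 h3, ← ENNReal.ofReal_mul (by positivity)]
          refine ENNReal.ofReal_le_ofReal ?_
          rw [mul_assoc, ← Real.exp_add, mul_comm]
          refine mul_le_mul (Real.exp_le_exp.2 ?_) h2 hc.le (Real.exp_pos _).le
          linarith [(abs_le.1 (hρ u hu')).1]
      _ ≤ _ := setLIntegral_le_lintegral _ _
  rw [← ENNReal.ofReal_toReal hfin.ne, ← ENNReal.ofReal_mul (by positivity)] at hlow
  have hpos : 0 < Real.sqrt n ^ d * (evidenceRatio W f φ w₀ z).toReal := by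
    by_contra! hle
    rw [ENNReal.ofReal_eq_zero.2 hle, nonpos_iff_eq_zero, ENNReal.ofReal_eq_zero] at hlow
    exact absurd hlow (not_le.2 (Real.exp_pos _))
  have h1 := (ENNReal.ofReal_le_ofReal_iff hpos.le).1 hlow
  rw [← Real.le_log_iff_exp_le hpos, Real.log_mul (by positivity)
    ((mul_pos_iff_of_pos_left (by positivity)).1 hpos).ne', Real.log_pow, Real.log_sqrt hn0.le]
    at h1
  linarith

/-- Integrates the pointwise bound `le_log_evidenceRatio`. The loss ε is spent in four quarters:
replacing the prior by its local lower bound, truncating the Gaussian integral to a ball, the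
remainder ρ, and the samples with a large score. -/
theorem eventually_le_integral_log_evidenceRatio (hf : IsRegularFamily ν W f w₀)
    (hb : LocalBounds ν W f w₀ r B G) (hφ : IsPriorAt W φ w₀) (hJ : (scoreCov ν f w₀).PosDef)
    {ε : ℝ} (hε : 0 < ε) :
    ∀ᶠ n : ℕ in atTop, Real.log (gaussConst (scoreCov ν f w₀)) + Real.log (φ w₀) + d / 2 - ε
      ≤ ∫ z, Real.log (evidenceRatio W f φ w₀ z).toReal ∂sampleLaw (trueLaw ν f w₀) n
        + d / 2 * Real.log n := by
  have := hf.isProbabilityMeasure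
  set J := scoreCov ν f w₀ with hJdef
  obtain ⟨K₁, K₂, hK₁, hK₂, hK⟩ := exists_bounds_inv J
  obtain ⟨R₁, hR₁, hUI⟩ := hb.uniformIntegrable_normScore hf (ε := ε / (4 * (K₂ + 1)))
    (by positivity)
  have hCpos := gaussConst_pos hJ
  have hlogball : ∀ᶠ k : ℕ in atTop, 0 < gaussBall J k ∧
      Real.log (gaussConst J) - ε / 4 < Real.log (gaussBall J k) :=
    ((tendsto_gaussBall hJ).eventually (lt_mem_nhds hCpos)).and
      (((tendsto_gaussBall hJ).log hCpos.ne').eventually (lt_mem_nhds (by linarith)))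
  -- The ball carries almost all of the Gaussian integral, and it contains the centre J⁻¹S whenever
  -- ‖S‖ ≤ R₁.
  obtain ⟨k, ⟨hk0, hk⟩, hkR, hk1⟩ := (hlogball.and
    ((tendsto_natCast_atTop_atTop.eventually_ge_atTop (K₁ * R₁)).and
      (eventually_gt_atTop 0))).exists
  set R : ℝ := (k : ℝ) with hR
  have hRpos : 0 < R := Nat.cast_pos.2 hk1
  obtain ⟨ρ, hρ0, hρi, hρlim, hρ⟩ := hb.exists_lan_remainder hf (R := 2 * R) (by positivity)
  set c := φ w₀ * Real.exp (-(ε / 4)) with hc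
  have hcpos : 0 < c := mul_pos hφ.pos (Real.exp_pos _)
  have hclt : c < φ w₀ := mul_lt_of_lt_one_right hφ.pos (by
    rw [Real.exp_lt_one_iff]; linarith)
  have hlogc : Real.log c = Real.log (φ w₀) - ε / 4 := by
    rw [hc, Real.log_mul hφ.pos.ne' (Real.exp_pos _).ne', Real.log_exp]; ring
  obtain ⟨δ, hδ, hδφ⟩ := Metric.eventually_nhds_iff_ball.1
    (hφ.continuousAt.eventually (lt_mem_nhds hclt))
  filter_upwards [hUI, hρi, hρ, hρlim.eventually (gt_mem_nhds (by positivity : 0 < ε / 4)),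
    eventually_gt_atTop 0,
    (tendsto_inv_sqrt_mul (2 * R)).eventually (gt_mem_nhds (lt_min hδ hb.pos))]
    with n hUn hρin hρn hρε hn hnδ
  obtain ⟨U, hUi, hUε, hU0, hU⟩ := hUn
  have hpt : ∀ᵐ z ∂sampleLaw (trueLaw ν f w₀) n,
      Real.log (φ w₀) - ε / 4 - ρ n z + (Real.log (gaussBall J R)
        + 1 / 2 * invQuad J (normScore f w₀ n z) - K₂ * U z)
      ≤ Real.log (evidenceRatio W f φ w₀ z).toReal + d / 2 * Real.log n := by
    filter_upwards [hρn, hf.ae_evidenceRatio_lt_top hφ n, ae_sampleLaw_forall n hb.pos_ae]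
      with z hz hfin hpos
    set S := normScore f w₀ n z with hS
    have hloc : ∀ u : Par d, ‖u‖ < 2 * R → w₀ + (Real.sqrt n)⁻¹ • u ∈ W ∧
        c ≤ φ (w₀ + (Real.sqrt n)⁻¹ • u) ∧
        (∀ k, 0 < f (z k) (w₀ + (Real.sqrt n)⁻¹ • u)) := fun u hu => by
      have hlt := norm_inv_sqrt_smul_lt hnδ hu
      have hr : w₀ + (Real.sqrt n)⁻¹ • u ∈ Metric.ball w₀ r := by
        simpa [mem_ball_iff_norm] using hlt.trans_le (min_le_right _ _)
      exact ⟨hb.subset hr, (hδφ _ (by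
        simpa [mem_ball_iff_norm] using hlt.trans_le (min_le_left _ _))).le,
        fun k => hpos k _ hr⟩
    rw [← hlogc]
    refine le_log_evidenceRatio hf.measurableSet hn hcpos hfin hloc
      (fun k => hpos k _ hb.center_mem) hz ?_
    have hexp : Real.exp (Real.log (gaussBall J R) + 1 / 2 * invQuad J S - K₂ * U z)
        = gaussBall J R * Real.exp (1 / 2 * invQuad J S - K₂ * U z) := by
      rw [add_sub_assoc, Real.exp_add, Real.exp_log hk0]
    rw [hexp]
    have hKU : 0 ≤ K₂ * U z := mul_nonneg hK₂ (hU0 z)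
    -- For moderate scores the centred Gaussian bound applies. For large ones the term `K₂ * U z`
    -- outweighs half the quadratic form, and the bound without the exponential factor is enough.
    rcases le_or_gt ‖S‖ R₁ with hle | hlt
    · refine le_trans (ENNReal.ofReal_le_ofReal ?_) (ofReal_gaussBall_le_of_le hJ
        (((hK S).1.trans (mul_le_mul_of_nonneg_left hle hK₁)).trans hkR))
      refine mul_le_mul_of_nonneg_left (Real.exp_le_exp.2 ?_) hk0.le
      rw [invQuad]
      rw [invQuad] at *
      linarith
    · refine le_trans (ENNReal.ofReal_le_ofReal ?_) (ofReal_gaussBall_le hJ hRpos.le S)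
      refine mul_le_of_le_one_right hk0.le (Real.exp_le_one_iff.2 ?_)
      have h1 := mul_le_mul_of_nonneg_left (hU z hlt) hK₂
      linarith [(hK S).2]
  have hlogi := hb.integrable_log_evidenceRatio hf hφ n
  have hqi := hb.integrable_invQuad hf n
  have h := integral_mono_ae ((((integrable_const (Real.log (φ w₀) - ε / 4)).sub' hρin).fun_add
    (((integrable_const (Real.log (gaussBall J R))).fun_add (hqi.const_mul (1 / 2))).sub'
      (hUi.const_mul K₂)))) (hlogi.fun_add (integrable_const (d / 2 * Real.log n))) hpt
  rw [integral_add ((integrable_const (Real.log (φ w₀) - ε / 4)).sub' hρin)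
    (((integrable_const (Real.log (gaussBall J R))).fun_add (hqi.const_mul (1 / 2))).sub'
      (hUi.const_mul K₂)), integral_sub (integrable_const _) hρin,
    integral_sub ((integrable_const (Real.log (gaussBall J R))).fun_add (hqi.const_mul (1 / 2)))
      (hUi.const_mul K₂), integral_add (integrable_const _) (hqi.const_mul (1 / 2)),
    integral_add hlogi (integrable_const _), integral_const_mul, integral_const_mul,
    hb.integral_invQuad hf hJ hn] at h
  simp only [integral_const, probReal_univ, one_smul] at h
  have hKε : K₂ * ∫ z, U z ∂sampleLaw (trueLaw ν f w₀) n ≤ ε / 4 := by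
    refine (mul_le_mul_of_nonneg_left hUε hK₂).trans ?_
    have : K₂ * (ε / (4 * (K₂ + 1))) = ε / 4 * (K₂ / (K₂ + 1)) := by field_simp
    rw [this]
    exact mul_le_of_le_one_right (by positivity) ((div_le_one (by positivity)).2 (by linarith))
  linarith

end LocalBounds

end Score

/-! ### Upper bound for the expected log-evidence -/

/-- A finite family of bounded statistics whose expectations separate `w₀` from the other
parameters, at a linear rate near `w₀`. -/
structure IsSeparating {d : ℕ} {Z ι : Type*} [MeasurableSpace Z] (ν : Measure Z)
    (W : Set (Par d)) (f : Z → Par d → ℝ) (w₀ : Par d) (ψ : ι → Z → ℝ) (A c : ℝ) : Prop where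
  measurable : ∀ k, Measurable (ψ k)
  bound : ∀ k z, |ψ k z| ≤ A
  pos : 0 < c
  sep : ∀ w ∈ W, ∃ k, c * min ‖w - w₀‖ 1
    ≤ |∫ z, ψ k z * f z w ∂ν - ∫ z, ψ k z ∂trueLaw ν f w₀|

section Upper

variable {d : ℕ} {Z : Type*} [MeasurableSpace Z] {ν : Measure Z} {W : Set (Par d)}
  {f : Z → Par d → ℝ} {w₀ : Par d} {φ : Par d → ℝ} {r : ℝ} {B G : Z → ℝ}

/-- The squared deviation of the sample mean of `ψ` from `m`, times the sample size. -/
def deviationSq (ψ : Z → ℝ) (m : ℝ) {n : ℕ} (z : Fin n → Z) : ℝ :=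
  (∑ k, (ψ (z k) - m)) ^ 2 / n

lemma measurable_deviationSq {ψ : Z → ℝ} (hψ : Measurable ψ) (m : ℝ) (n : ℕ) :
    Measurable fun z : Fin n → Z => deviationSq ψ m z :=
  ((Finset.measurable_fun_sum _ fun k _ =>
    ((hψ.comp (measurable_pi_apply k)).sub_const m)).pow_const 2).div_const _

namespace IsRegularFamily

lemma abs_integral_mul_le (hf : IsRegularFamily ν W f w₀) {ψ : Z → ℝ} {A : ℝ}
    (hA : ∀ z, |ψ z| ≤ A) {w : Par d} (hw : w ∈ W) : |∫ z, ψ z * f z w ∂ν| ≤ A := by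
  have h : ‖∫ z, ψ z * f z w ∂ν‖ ≤ ∫ z, A * f z w ∂ν := by
    refine norm_integral_le_of_norm_le ((hf.integrable hw).const_mul A)
      (Eventually.of_forall fun z => ?_)
    rw [norm_mul, Real.norm_eq_abs, Real.norm_eq_abs, abs_of_nonneg (hf.nonneg z w hw)]
    exact mul_le_mul_of_nonneg_right (hA z) (hf.nonneg z w hw)
  rwa [integral_const_mul, hf.integral_eq_one w hw, mul_one] at h

/-- Under the parameter `w`, the deviation of a bounded statistic from a value other than its
expectation is exponentially unlikely to be small. -/
lemma lintegral_likRatio_mul_exp_deviationSq_le (hf : IsRegularFamily ν W f w₀)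
    {ψ : Z → ℝ} {A : ℝ} (hψ : Measurable ψ) (hA : ∀ z, |ψ z| ≤ A) {m : ℝ} (hm : |m| ≤ A)
    {η : ℝ} (hη : 0 < η) {w : Par d} (hw : w ∈ W) {n : ℕ} (hn : 0 < n) :
    ∫⁻ z, ENNReal.ofReal (likRatio f w₀ z w) * ENNReal.ofReal (Real.exp (-(η * deviationSq ψ m z)))
        ∂sampleLaw (trueLaw ν f w₀) n
      ≤ ENNReal.ofReal (Real.exp
        (-(η / (1 + 16 * η * A ^ 2) * n * (∫ z, ψ z * f z w ∂ν - m) ^ 2))) := by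
  have hn0 : (0 : ℝ) < n := by exact_mod_cast hn
  set Δ := ∫ z, ψ z * f z w ∂ν - m with hΔ
  -- The square D²/n is bounded below by its tangent at D = nκΔ, so the exponential factorises over
  -- the sample with slope `l`. Per observation the exponent is then ηΔ²(κ²(1 + 16ηA²) - 2κ), and
  -- this `κ` minimises it.
  set κ := 1 / (1 + 16 * η * A ^ 2) with hκ
  have hden : 0 < 1 + 16 * η * A ^ 2 := by positivity
  have hκpos : 0 < κ := by positivity
  have hκ1 : (1 + 16 * η * A ^ 2) * κ = 1 := by rw [hκ]; field_simp
  set l := 2 * η * κ * Δ with hl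
  have hA0 : 0 ≤ A := (abs_nonneg m).trans hm
  have hΔA : |Δ| ≤ 2 * A :=
    (abs_sub _ _).trans (by linarith [hf.abs_integral_mul_le hA hw])
  have hψm : ∀ x, |ψ x - m| ≤ 2 * A := fun x => (abs_sub _ _).trans (by linarith [hA x])
  have hsmall : ∀ x, |-(l * (ψ x - m))| ≤ 1 := fun x => by
    rw [abs_neg, abs_mul, hl, abs_mul, abs_of_pos (by positivity : 0 < 2 * η * κ)]
    calc 2 * η * κ * |Δ| * |ψ x - m| ≤ 2 * η * κ * (2 * A) * (2 * A) := by
          gcongr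
          exact hψm x
      _ ≤ (1 + 16 * η * A ^ 2) * κ := by nlinarith [mul_nonneg hη.le (sq_nonneg A), hκpos]
      _ = 1 := hκ1
  have hexp : ∀ x, Real.exp (-(l * (ψ x - m))) ≤ 1 - l * (ψ x - m) + 4 * A ^ 2 * l ^ 2 := by
    intro x
    have h1 := (abs_le.1 (Real.abs_exp_sub_one_sub_id_le (hsmall x))).2
    have h2 : (-(l * (ψ x - m))) ^ 2 ≤ 4 * A ^ 2 * l ^ 2 := by
      rw [neg_sq, mul_pow, ← sq_abs (ψ x - m)]
      have := pow_le_pow_left₀ (abs_nonneg _) (hψm x) 2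
      nlinarith [sq_nonneg l]
    linarith
  have hψf : Integrable (fun x => ψ x * f x w) ν :=
    (hf.integrable hw).bdd_mul hψ.aestronglyMeasurable (Eventually.of_forall hA)
  have hone : ∫⁻ x, ENNReal.ofReal (f x w) * ENNReal.ofReal (Real.exp (-(l * (ψ x - m)))) ∂ν
      ≤ ENNReal.ofReal (Real.exp (-(l * Δ) + 4 * A ^ 2 * l ^ 2)) := by
    have hi : Integrable (fun x => (1 + l * m + 4 * A ^ 2 * l ^ 2) * f x w - l * (ψ x * f x w)) ν :=
      ((hf.integrable hw).const_mul _).sub (hψf.const_mul l)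
    have hpt : ∀ x, f x w * Real.exp (-(l * (ψ x - m)))
        ≤ (1 + l * m + 4 * A ^ 2 * l ^ 2) * f x w - l * (ψ x * f x w) := fun x => by
      have := mul_le_mul_of_nonneg_left (hexp x) (hf.nonneg x w hw)
      linarith
    calc _ ≤ ∫⁻ x, ENNReal.ofReal
          ((1 + l * m + 4 * A ^ 2 * l ^ 2) * f x w - l * (ψ x * f x w)) ∂ν := by
          refine lintegral_mono fun x => ?_
          rw [← ENNReal.ofReal_mul (hf.nonneg x w hw)]
          exact ENNReal.ofReal_le_ofReal (hpt x)
      _ = ENNReal.ofReal (∫ x, ((1 + l * m + 4 * A ^ 2 * l ^ 2) * f x w - l * (ψ x * f x w)) ∂ν) :=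
          (ofReal_integral_eq_lintegral_ofReal hi (Eventually.of_forall fun x =>
            (mul_nonneg (hf.nonneg x w hw) (Real.exp_pos _).le).trans (hpt x))).symm
      _ ≤ _ := by
          rw [integral_sub ((hf.integrable hw).const_mul _) (hψf.const_mul l), integral_const_mul,
            integral_const_mul, hf.integral_eq_one w hw]
          refine ENNReal.ofReal_le_ofReal (le_trans (le_of_eq ?_) (Real.add_one_le_exp _))
          rw [hΔ]; ring
  have hpt : ∀ z : Fin n → Z, ENNReal.ofReal (Real.exp (-(η * deviationSq ψ m z)))
      ≤ ENNReal.ofReal (Real.exp (n * (η * κ ^ 2 * Δ ^ 2))) *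
        ∏ k, ENNReal.ofReal (Real.exp (-(l * (ψ (z k) - m)))) := fun z => by
    rw [← ENNReal.ofReal_prod_of_nonneg fun _ _ => (Real.exp_pos _).le, ← Real.exp_sum,
      ← ENNReal.ofReal_mul (Real.exp_pos _).le, ← Real.exp_add]
    refine ENNReal.ofReal_le_ofReal (Real.exp_le_exp.2 ?_)
    rw [Finset.sum_neg_distrib, ← Finset.mul_sum, deviationSq]
    set D := ∑ k, (ψ (z k) - m)
    have h : 0 ≤ η * ((D - n * (κ * Δ)) ^ 2 / n) := by positivity
    have e : η * ((D - n * (κ * Δ)) ^ 2 / n)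
        = η * (D ^ 2 / n) - l * D + n * (η * κ ^ 2 * Δ ^ 2) := by
      rw [hl]; field_simp; ring
    linarith
  calc _ ≤ ∫⁻ z, ENNReal.ofReal (Real.exp (n * (η * κ ^ 2 * Δ ^ 2))) *
          (ENNReal.ofReal (likRatio f w₀ z w) *
            ∏ k, ENNReal.ofReal (Real.exp (-(l * (ψ (z k) - m))))) ∂sampleLaw (trueLaw ν f w₀) n := by
        refine lintegral_mono fun z => ?_
        rw [mul_left_comm]
        exact mul_le_mul_right (hpt z) _
    _ ≤ ENNReal.ofReal (Real.exp (n * (η * κ ^ 2 * Δ ^ 2))) *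
          (ENNReal.ofReal (Real.exp (-(l * Δ) + 4 * A ^ 2 * l ^ 2))) ^ n := by
        rw [lintegral_const_mul' _ _ ENNReal.ofReal_ne_top]
        gcongr
        refine (hf.lintegral_likRatio_mul_le hw n
          (F := fun x => ENNReal.ofReal (Real.exp (-(l * (ψ x - m))))) ?_).trans
          (pow_le_pow_left₀ zero_le hone n)
        exact (Real.measurable_exp.comp ((hψ.sub_const m).const_mul l).neg).ennreal_ofReal
    _ ≤ _ := by
        rw [← ENNReal.ofReal_pow (Real.exp_pos _).le, ← Real.exp_nat_mul,
          ← ENNReal.ofReal_mul (Real.exp_pos _).le, ← Real.exp_add]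
        refine ENNReal.ofReal_le_ofReal (Real.exp_le_exp.2 (le_of_eq ?_))
        have e : η / (1 + 16 * η * A ^ 2) = η * κ := by rw [hκ]; ring
        rw [e, hl]
        have : η * κ ^ 2 * Δ ^ 2 + (-(2 * η * κ * Δ * Δ) + 4 * A ^ 2 * (2 * η * κ * Δ) ^ 2)
            = η * κ * Δ ^ 2 * ((1 + 16 * η * A ^ 2) * κ) - 2 * (η * κ * Δ ^ 2) := by ring
        rw [hκ1] at this
        linear_combination (n : ℝ) * this

lemma integrable_deviationSq (hf : IsRegularFamily ν W f w₀) {ψ : Z → ℝ} {A : ℝ}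
    (hψ : Measurable ψ) (hA : ∀ z, |ψ z| ≤ A) (m : ℝ) (n : ℕ) :
    Integrable (fun z => deviationSq ψ m z) (sampleLaw (trueLaw ν f w₀) n) := by
  have := hf.isProbabilityMeasure
  have hL : MemLp (fun x => ψ x - m) 2 (trueLaw ν f w₀) :=
    (MemLp.of_bound hψ.aestronglyMeasurable A (Eventually.of_forall hA)).sub (memLp_const m)
  exact (memLp_sum_sampleLaw n hL).integrable_sq.div_const _

lemma integral_deviationSq_le (hf : IsRegularFamily ν W f w₀) {ψ : Z → ℝ} {A : ℝ}
    (hψ : Measurable ψ) (hA : ∀ z, |ψ z| ≤ A) {n : ℕ} (hn : 0 < n) :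
    ∫ z, deviationSq ψ (∫ x, ψ x ∂trueLaw ν f w₀) z ∂sampleLaw (trueLaw ν f w₀) n
      ≤ 4 * A ^ 2 := by
  have := hf.isProbabilityMeasure
  have hn0 : (0 : ℝ) < n := by exact_mod_cast hn
  set m := ∫ x, ψ x ∂trueLaw ν f w₀ with hm
  have hψL : MemLp ψ 2 (trueLaw ν f w₀) :=
    MemLp.of_bound hψ.aestronglyMeasurable A (Eventually.of_forall hA)
  have hψi := hψL.integrable (by norm_num : (1 : ENNReal) ≤ 2)
  have hL : MemLp (fun x => ψ x - m) 2 (trueLaw ν f w₀) := hψL.sub (memLp_const m)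
  have h0 : ∫ x, (ψ x - m) ∂trueLaw ν f w₀ = 0 := by
    rw [integral_sub hψi (integrable_const _)]; simp [hm]
  have hmA : |m| ≤ A := by
    rw [hm, hf.integral_trueLaw]; exact hf.abs_integral_mul_le hA hf.mem
  simp only [deviationSq]
  rw [integral_div, integral_sq_sum_sampleLaw n hL h0, mul_div_cancel_left₀ _ hn0.ne']
  calc ∫ x, (ψ x - m) ^ 2 ∂trueLaw ν f w₀ ≤ ∫ _, 4 * A ^ 2 ∂trueLaw ν f w₀ := by
        refine integral_mono_of_nonneg (Eventually.of_forall fun x => sq_nonneg _)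
          (integrable_const _) (Eventually.of_forall fun x => ?_)
        have h1 : |ψ x - m| ≤ 2 * A := (abs_sub _ _).trans (by linarith [hA x])
        have h2 := pow_le_pow_left₀ (abs_nonneg _) h1 2
        rw [sq_abs] at h2
        simp only
        linarith
    _ = 4 * A ^ 2 := by simp

lemma measurable_localEvidence (hf : IsRegularFamily ν W f w₀) (hφ : IsPriorAt W φ w₀) (n : ℕ)
    (t : ℝ) : Measurable fun p : (Fin n → Z) × Par d =>
      W.indicator (fun w => ENNReal.ofReal (likRatio f w₀ p.1 w * φ w)) (w₀ + t • p.2) := by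
  have hm : Measurable fun p : (Fin n → Z) × Par d => (p.1, w₀ + t • p.2) := by fun_prop
  have h : Measurable ((Prod.snd ⁻¹' W).indicator fun p : (Fin n → Z) × Par d =>
      ENNReal.ofReal (likRatio f w₀ p.1 p.2 * φ p.2)) :=
    ((hf.measurable_likRatio n).mul (hφ.measurable.comp measurable_snd)).ennreal_ofReal.indicator
      (measurable_snd hf.measurableSet)
  exact h.comp hm

end IsRegularFamily

/-- The penalty built from a family of statistics. -/
def penalty {ι : Type*} [Fintype ι] (ν : Measure Z) (f : Z → Par d → ℝ) (w₀ : Par d)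
    (ψ : ι → Z → ℝ) {n : ℕ} (z : Fin n → Z) : ℝ :=
  ∑ k, deviationSq (ψ k) (∫ x, ψ k x ∂trueLaw ν f w₀) z

namespace IsSeparating

variable {ι : Type*} [Fintype ι] {ψ : ι → Z → ℝ} {A c : ℝ}

/-- The summands of the penalty are nonnegative, so it suffices to keep the one statistic that
separates `w`. -/
lemma lintegral_likRatio_mul_exp_penalty_le (hs : IsSeparating ν W f w₀ ψ A c)
    (hf : IsRegularFamily ν W f w₀) {η : ℝ} (hη : 0 < η) {w : Par d} (hw : w ∈ W) {n : ℕ}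
    (hn : 0 < n) :
    ∫⁻ z, ENNReal.ofReal (likRatio f w₀ z w) * ENNReal.ofReal (Real.exp (-(η * penalty ν f w₀ ψ z)))
        ∂sampleLaw (trueLaw ν f w₀) n
      ≤ ENNReal.ofReal (Real.exp
        (-(η / (1 + 16 * η * A ^ 2) * c ^ 2 * (n * min ‖w - w₀‖ 1 ^ 2)))) := by
  obtain ⟨k, hk⟩ := hs.sep w hw
  have hm : |∫ x, ψ k x ∂trueLaw ν f w₀| ≤ A := by
    rw [hf.integral_trueLaw]; exact hf.abs_integral_mul_le (hs.bound k) hf.mem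
  refine le_trans (lintegral_mono fun z => ?_)
    ((hf.lintegral_likRatio_mul_exp_deviationSq_le (hs.measurable k) (hs.bound k) hm hη hw hn).trans
      ?_)
  · refine mul_le_mul_right (ENNReal.ofReal_le_ofReal (Real.exp_le_exp.2 (neg_le_neg ?_))) _
    refine mul_le_mul_of_nonneg_left ?_ hη.le
    exact Finset.single_le_sum
      (f := fun k => deviationSq (ψ k) (∫ x, ψ k x ∂trueLaw ν f w₀) z)
      (fun k _ => by rw [deviationSq]; positivity) (Finset.mem_univ k)
  · refine ENNReal.ofReal_le_ofReal (Real.exp_le_exp.2 (neg_le_neg ?_))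
    have h0 : 0 ≤ c * min ‖w - w₀‖ 1 := mul_nonneg hs.pos.le (le_min (norm_nonneg _) zero_le_one)
    have h1 := pow_le_pow_left₀ h0 hk 2
    rw [sq_abs, mul_pow] at h1
    have hden : 0 < 1 + 16 * η * A ^ 2 := by positivity
    calc _ = η / (1 + 16 * η * A ^ 2) * n * (c ^ 2 * min ‖w - w₀‖ 1 ^ 2) := by ring
      _ ≤ _ := by gcongr

lemma measurable_penalty (hs : IsSeparating ν W f w₀ ψ A c) (n : ℕ) :
    Measurable fun z : Fin n → Z => penalty ν f w₀ ψ z :=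
  Finset.measurable_fun_sum _ fun k _ => measurable_deviationSq (hs.measurable k) _ n

lemma integrable_penalty (hs : IsSeparating ν W f w₀ ψ A c) (hf : IsRegularFamily ν W f w₀)
    (n : ℕ) : Integrable (fun z => penalty ν f w₀ ψ z) (sampleLaw (trueLaw ν f w₀) n) :=
  integrable_finsetSum _ fun k _ =>
    hf.integrable_deviationSq (hs.measurable k) (hs.bound k) _ n

/-- Bounded in `n`, so under the true law the penalty costs only O(η) in mean. -/
lemma integral_penalty_le (hs : IsSeparating ν W f w₀ ψ A c) (hf : IsRegularFamily ν W f w₀)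
    {n : ℕ} (hn : 0 < n) : ∫ z, penalty ν f w₀ ψ z ∂sampleLaw (trueLaw ν f w₀) n
      ≤ Fintype.card ι * (4 * A ^ 2) := by
  simp only [penalty]
  rw [integral_finsetSum _ fun k _ =>
    hf.integrable_deviationSq (hs.measurable k) (hs.bound k) _ n]
  refine (Finset.sum_le_sum fun k _ =>
    hf.integral_deviationSq_le (hs.measurable k) (hs.bound k) hn).trans (le_of_eq ?_)
  simp

end IsSeparating

end Upper

/-! ### The evidence in local coordinates and its expectation under the penalty. -/

section Upper

variable {d : ℕ} {Z : Type*} [MeasurableSpace Z] {ν : Measure Z} {W : Set (Par d)}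
  {f : Z → Par d → ℝ} {w₀ : Par d} {φ : Par d → ℝ} {r : ℝ} {B G : Z → ℝ}

/-- The integrand of the evidence in the local coordinate `u = n^{1/2} (w - w₀)`. -/
def localEvidence (W : Set (Par d)) (f : Z → Par d → ℝ) (φ : Par d → ℝ) (w₀ : Par d) {n : ℕ}
    (z : Fin n → Z) (u : Par d) : ENNReal :=
  W.indicator (fun w => ENNReal.ofReal (likRatio f w₀ z w * φ w)) (w₀ + (Real.sqrt n)⁻¹ • u)

/-- The prior in the local coordinate. -/
def localPrior (W : Set (Par d)) (φ : Par d → ℝ) (w₀ : Par d) (n : ℕ) (u : Par d) : ENNReal :=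
  W.indicator (fun w => ENNReal.ofReal (φ w)) (w₀ + (Real.sqrt n)⁻¹ • u)

lemma localEvidence_eq (hf : IsRegularFamily ν W f w₀) {n : ℕ} (z : Fin n → Z) (u : Par d) :
    localEvidence W f φ w₀ z u = localPrior W φ w₀ n u *
      ENNReal.ofReal (likRatio f w₀ z (w₀ + (Real.sqrt n)⁻¹ • u)) := by
  rw [localEvidence, localPrior]
  by_cases h : w₀ + (Real.sqrt n)⁻¹ • u ∈ W
  · rw [Set.indicator_of_mem h, Set.indicator_of_mem h,
      ENNReal.ofReal_mul (hf.likRatio_nonneg z h), mul_comm]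
  · rw [Set.indicator_of_notMem h, Set.indicator_of_notMem h, zero_mul]

lemma lintegral_localPrior (hW : MeasurableSet W) (hφ : IsPriorAt W φ w₀) {n : ℕ} (hn : 0 < n) :
    ∫⁻ u, localPrior W φ w₀ n u = ENNReal.ofReal (Real.sqrt n ^ d) := by
  -- For a family constantly equal to 1 the evidence is the prior mass.
  have h := ofReal_mul_evidenceRatio (f := fun (_ : Unit) (_ : Par d) => (1 : ℝ)) (φ := φ)
    (w₀ := w₀) hW hn (fun _ => ())
  simp only [evidenceRatio, likRatio, div_one, Finset.prod_const_one, one_mul,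
    hφ.lintegral_eq_one hW, mul_one] at h
  exact h.symm

variable {ι : Type*} [Fintype ι] {ψ : ι → Z → ℝ} {A c : ℝ}

/-- The expected local evidence, weighted by the penalty. -/
lemma lintegral_localEvidence_mul_exp_penalty_le (hf : IsRegularFamily ν W f w₀)
    (hs : IsSeparating ν W f w₀ ψ A c) {η : ℝ} (hη : 0 < η) {n : ℕ} (hn : 0 < n) (u : Par d) :
    ∫⁻ z, localEvidence W f φ w₀ z u * ENNReal.ofReal (Real.exp (-(η * penalty ν f w₀ ψ z)))
        ∂sampleLaw (trueLaw ν f w₀) n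
      ≤ localPrior W φ w₀ n u * ENNReal.ofReal (Real.exp (-(η / (1 + 16 * η * A ^ 2) * c ^ 2 *
          (n * min ((Real.sqrt n)⁻¹ * ‖u‖) 1 ^ 2)))) := by
  simp_rw [localEvidence_eq hf, mul_assoc]
  by_cases h : w₀ + (Real.sqrt n)⁻¹ • u ∈ W
  · have hne : localPrior W φ w₀ n u ≠ ⊤ := by
      rw [localPrior, Set.indicator_of_mem h]; exact ENNReal.ofReal_ne_top
    rw [lintegral_const_mul' _ _ hne]
    refine mul_le_mul_right ((hs.lintegral_likRatio_mul_exp_penalty_le hf hη h hn).trans ?_) _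
    rw [add_sub_cancel_left, LocalBounds.norm_inv_sqrt_smul]
    simp only [mul_assoc, le_refl]
  · rw [localPrior, Set.indicator_of_notMem h]; simp

lemma lintegral_localEvidence_le (hf : IsRegularFamily ν W f w₀) {n : ℕ} (u : Par d) :
    ∫⁻ z, localEvidence W f φ w₀ z u ∂sampleLaw (trueLaw ν f w₀) n ≤ localPrior W φ w₀ n u := by
  simp_rw [localEvidence_eq hf]
  by_cases h : w₀ + (Real.sqrt n)⁻¹ • u ∈ W
  · have hne : localPrior W φ w₀ n u ≠ ⊤ := by
      rw [localPrior, Set.indicator_of_mem h]; exact ENNReal.ofReal_ne_top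
    rw [lintegral_const_mul' _ _ hne]
    exact mul_le_of_le_one_right' (hf.lintegral_likRatio_le h n)
  · rw [localPrior, Set.indicator_of_notMem h]; simp

/-- The contribution of the far part of the parameter set. -/
lemma lintegral_far_le (hf : IsRegularFamily ν W f w₀) (hφ : IsPriorAt W φ w₀)
    (hs : IsSeparating ν W f w₀ ψ A c) {η : ℝ} (hη : 0 < η) {n : ℕ} (hn : 0 < n)
    {δ b κ : ℝ} (hδ : δ ≤ 1) (hδ0 : 0 ≤ δ)
    (hκ : κ = η / (1 + 16 * η * A ^ 2) * c ^ 2)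
    (hb : ∀ w ∈ Metric.ball w₀ δ, φ w ≤ b) (s : Set (Par d)) :
    ∫⁻ z, (∫⁻ u in s, localEvidence W f φ w₀ z u *
        ENNReal.ofReal (Real.exp (-(η * penalty ν f w₀ ψ z)))) ∂sampleLaw (trueLaw ν f w₀) n
      ≤ ENNReal.ofReal b * (∫⁻ u in s, ENNReal.ofReal (Real.exp (-κ * ‖u‖ ^ 2)))
        + ENNReal.ofReal (Real.exp (-(κ * δ ^ 2) * n) * Real.sqrt n ^ d) := by
  have := hf.isProbabilityMeasure
  have hn0 : (0 : ℝ) < n := by exact_mod_cast hn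
  have hsn : 0 < Real.sqrt n := Real.sqrt_pos.2 hn0
  have hκ0 : 0 ≤ κ := by rw [hκ]; positivity
  have hm1 : Measurable fun p : (Fin n → Z) × Par d => localEvidence W f φ w₀ p.1 p.2 :=
    hf.measurable_localEvidence hφ n _
  have hm : Measurable fun p : (Fin n → Z) × Par d => localEvidence W f φ w₀ p.1 p.2 *
      ENNReal.ofReal (Real.exp (-(η * penalty ν f w₀ ψ p.1))) :=
    hm1.mul (Real.measurable_exp.comp
      (((hs.measurable_penalty n).comp measurable_fst).const_mul η).neg).ennreal_ofReal
  have hmw : Measurable fun u : Par d => w₀ + (Real.sqrt n)⁻¹ • u := by fun_prop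
  have hmp : Measurable (localPrior W φ w₀ n) :=
    (hφ.measurable.ennreal_ofReal.indicator hf.measurableSet).comp hmw
  rw [lintegral_lintegral_swap hm.aemeasurable]
  calc _ ≤ ∫⁻ u in s, (ENNReal.ofReal b * ENNReal.ofReal (Real.exp (-κ * ‖u‖ ^ 2))
          + ENNReal.ofReal (Real.exp (-(κ * δ ^ 2) * n)) * localPrior W φ w₀ n u) := by
        refine lintegral_mono fun u => ?_
        refine (lintegral_localEvidence_mul_exp_penalty_le hf hs hη hn u).trans ?_
        rw [← hκ]
        set x := (Real.sqrt n)⁻¹ * ‖u‖ with hx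
        have hx0 : 0 ≤ x := by positivity
        have hnx : n * x ^ 2 = ‖u‖ ^ 2 := by
          rw [hx, mul_pow, inv_pow, Real.sq_sqrt hn0.le]; field_simp
        -- Within distance δ of `w₀` the prior is at most `b` and the penalty yields Gaussian decay
        -- in u. Beyond it the factor e^{-κδ²n} beats the total local prior mass n^{d/2}.
        rcases lt_or_ge x δ with hlt | hge
        · refine le_trans ?_ (le_self_add)
          rw [min_eq_left (hlt.le.trans hδ), hnx, neg_mul]
          refine mul_le_mul_left ?_ _
          rw [localPrior]
          refine (Set.indicator_le_self _ _ _).trans (ENNReal.ofReal_le_ofReal (hb _ ?_))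
          rw [mem_ball_iff_norm, add_sub_cancel_left, LocalBounds.norm_inv_sqrt_smul]
          exact hlt
        · refine le_trans ?_ (le_add_self)
          rw [mul_comm]
          refine mul_le_mul_left (ENNReal.ofReal_le_ofReal (Real.exp_le_exp.2 ?_)) _
          have h1 : δ ^ 2 ≤ min x 1 ^ 2 := pow_le_pow_left₀ hδ0 (le_min hge hδ) 2
          have h2 : κ * δ ^ 2 * n ≤ κ * (n * min x 1 ^ 2) := by
            calc κ * δ ^ 2 * n = κ * (n * δ ^ 2) := by ring
              _ ≤ _ := by gcongr
          linarith
    _ = ENNReal.ofReal b * (∫⁻ u in s, ENNReal.ofReal (Real.exp (-κ * ‖u‖ ^ 2)))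
          + ENNReal.ofReal (Real.exp (-(κ * δ ^ 2) * n)) * ∫⁻ u in s, localPrior W φ w₀ n u := by
        rw [lintegral_add_right _ (hmp.const_mul _), lintegral_const_mul' _ _ ENNReal.ofReal_ne_top,
          lintegral_const_mul' _ _ ENNReal.ofReal_ne_top]
    _ ≤ _ := by
        rw [ENNReal.ofReal_mul (Real.exp_pos _).le, ← lintegral_localPrior hf.measurableSet hφ hn]
        gcongr
        exact Measure.restrict_le_self

/-- The contribution of a bounded set of local parameters. -/
lemma lintegral_near_le (hf : IsRegularFamily ν W f w₀) (hφ : IsPriorAt W φ w₀) {n : ℕ}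
    {δ b R : ℝ} (hb : ∀ w ∈ Metric.ball w₀ δ, φ w ≤ b) (hδ : (Real.sqrt n)⁻¹ * R < δ) :
    ∫⁻ z, (∫⁻ u in Metric.ball (0 : Par d) R, localEvidence W f φ w₀ z u)
        ∂sampleLaw (trueLaw ν f w₀) n
      ≤ ENNReal.ofReal b * volume (Metric.ball (0 : Par d) R) := by
  have := hf.isProbabilityMeasure
  have hm1 : Measurable fun p : (Fin n → Z) × Par d => localEvidence W f φ w₀ p.1 p.2 :=
    hf.measurable_localEvidence hφ n _
  rw [lintegral_lintegral_swap hm1.aemeasurable, ← setLIntegral_const]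
  refine setLIntegral_mono' Metric.isOpen_ball.measurableSet fun u hu => ?_
  refine (lintegral_localEvidence_le hf u).trans ?_
  rw [localPrior]
  refine (Set.indicator_le_self _ _ _).trans (ENNReal.ofReal_le_ofReal (hb _ ?_))
  rw [mem_ball_iff_norm, add_sub_cancel_left]
  exact LocalBounds.norm_inv_sqrt_smul_lt hδ (mem_ball_zero_iff.1 hu)

/-- On samples with a small remainder, the near part of the evidence is at most Gaussian. -/
lemma setLIntegral_localEvidence_le (hf : IsRegularFamily ν W f w₀)
    (hJ : (scoreCov ν f w₀).PosDef) {n : ℕ} {δ b R ρ : ℝ} (hb0 : 0 ≤ b)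
    (hb : ∀ w ∈ Metric.ball w₀ δ, φ w ≤ b) (hδ : (Real.sqrt n)⁻¹ * R < δ) {z : Fin n → Z}
    (h0 : ∀ k, 0 < f (z k) w₀)
    (hpos : ∀ w ∈ Metric.ball w₀ δ, ∀ k, 0 < f (z k) w)
    (hρ : ∀ u : Par d, ‖u‖ < R → |logRatio f w₀ z ((Real.sqrt n)⁻¹ • u)
          - (u ⬝ᵥ normScore f w₀ n z - 1 / 2 * (u ⬝ᵥ (scoreCov ν f w₀ *ᵥ u)))| ≤ ρ) :
    ∫⁻ u in Metric.ball (0 : Par d) R, localEvidence W f φ w₀ z u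
      ≤ ENNReal.ofReal (b * Real.exp ρ * (gaussConst (scoreCov ν f w₀) *
        Real.exp (1 / 2 * invQuad (scoreCov ν f w₀) (normScore f w₀ n z)))) := by
  calc _ ≤ ∫⁻ u in Metric.ball (0 : Par d) R, ENNReal.ofReal (b * Real.exp ρ) *
          ENNReal.ofReal (Real.exp
            (u ⬝ᵥ normScore f w₀ n z - 1 / 2 * (u ⬝ᵥ (scoreCov ν f w₀ *ᵥ u)))) := by
        refine setLIntegral_mono' Metric.isOpen_ball.measurableSet fun u hu => ?_
        have hu' : ‖u‖ < R := mem_ball_zero_iff.1 hu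
        have hw : w₀ + (Real.sqrt n)⁻¹ • u ∈ Metric.ball w₀ δ := by
          rw [mem_ball_iff_norm, add_sub_cancel_left]
          exact LocalBounds.norm_inv_sqrt_smul_lt hδ hu'
        rw [localEvidence_eq hf, likRatio_eq_exp h0 (hpos _ hw),
          ENNReal.ofReal_mul hb0, mul_assoc, ← ENNReal.ofReal_mul (Real.exp_pos _).le,
          ← Real.exp_add]
        gcongr
        · rw [localPrior]
          exact (Set.indicator_le_self _ _ _).trans (ENNReal.ofReal_le_ofReal (hb _ hw))
        · linarith [(abs_le.1 (hρ u hu')).2]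
    _ = ENNReal.ofReal (b * Real.exp ρ) * ∫⁻ u in Metric.ball (0 : Par d) R,
          ENNReal.ofReal (Real.exp
            (u ⬝ᵥ normScore f w₀ n z - 1 / 2 * (u ⬝ᵥ (scoreCov ν f w₀ *ᵥ u)))) :=
        lintegral_const_mul' _ _ ENNReal.ofReal_ne_top
    _ ≤ ENNReal.ofReal (b * Real.exp ρ) * ∫⁻ u : Par d,
          ENNReal.ofReal (Real.exp
            (u ⬝ᵥ normScore f w₀ n z - 1 / 2 * (u ⬝ᵥ (scoreCov ν f w₀ *ᵥ u)))) := by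
        gcongr
        exact Measure.restrict_le_self
    _ = _ := by
        rw [lintegral_gauss hJ, ← ENNReal.ofReal_mul (by positivity), invQuad]

lemma tendsto_lintegral_compl_ball {κ : ℝ} (hκ : 0 < κ) :
    Tendsto (fun k : ℕ => ∫⁻ u in (Metric.ball (0 : Par d) k)ᶜ,
      ENNReal.ofReal (Real.exp (-κ * ‖u‖ ^ 2))) atTop (𝓝 0) := by
  have hi := (integrable_exp_neg_mul_norm_sq (d := d) hκ).lintegral_lt_top
  have hI : ⋂ k : ℕ, (Metric.ball (0 : Par d) k)ᶜ = ∅ := by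
    rw [← Set.compl_iUnion, Metric.iUnion_ball_nat, Set.compl_univ]
  have h := tendsto_measure_iInter_atTop
    (μ := volume.withDensity fun u : Par d => ENNReal.ofReal (Real.exp (-κ * ‖u‖ ^ 2)))
    (s := fun k : ℕ => (Metric.ball (0 : Par d) k)ᶜ)
    (fun k => Metric.isOpen_ball.measurableSet.compl.nullMeasurableSet)
    (fun a b hab => Set.compl_subset_compl.2 (Metric.ball_subset_ball (by exact_mod_cast hab)))
    ⟨0, by
      rw [withDensity_apply _ Metric.isOpen_ball.measurableSet.compl]
      exact ((setLIntegral_le_lintegral _ _).trans_lt hi).ne⟩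
  rw [hI, measure_empty] at h
  refine h.congr fun k => ?_
  exact withDensity_apply _ Metric.isOpen_ball.measurableSet.compl

lemma tendsto_exp_neg_mul_mul_sqrt_pow {κ : ℝ} (hκ : 0 < κ) (d : ℕ) :
    Tendsto (fun n : ℕ => Real.exp (-κ * n) * Real.sqrt n ^ d) atTop (𝓝 0) := by
  have h : Tendsto (fun x : ℝ => x ^ d * Real.exp (-κ * x)) atTop (𝓝 0) := by
    simpa using tendsto_rpow_mul_exp_neg_mul_atTop_nhds_zero d κ hκ
  refine squeeze_zero' (Eventually.of_forall fun n => by positivity) ?_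
    (h.comp tendsto_natCast_atTop_atTop)
  filter_upwards [eventually_ge_atTop 1] with n hn
  have hn1 : (1 : ℝ) ≤ n := by exact_mod_cast hn
  simp only [Function.comp]
  rw [mul_comm]
  gcongr
  exact (Real.sqrt_le_left (by positivity)).2 (by nlinarith)

namespace LocalBounds

/-- The tangent of the logarithm at `c₀`, applied to Y e^{-T}, replaces E log Y by E T and E[Y
e^{-T}]. It then suffices that E T ≤ d/2 + 2τ and E[Y e^{-T}] ≤ c₀(1 + 4τ), where τ = ε/8. -/
theorem eventually_integral_log_evidenceRatio_le (hf : IsRegularFamily ν W f w₀)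
    (hb : LocalBounds ν W f w₀ r B G) (hφ : IsPriorAt W φ w₀) (hJ : (scoreCov ν f w₀).PosDef)
    (hs : IsSeparating ν W f w₀ ψ A c) {ε : ℝ} (hε : 0 < ε) :
    ∀ᶠ n : ℕ in atTop,
      ∫ z, Real.log (evidenceRatio W f φ w₀ z).toReal ∂sampleLaw (trueLaw ν f w₀) n
        + d / 2 * Real.log n
      ≤ Real.log (gaussConst (scoreCov ν f w₀)) + Real.log (φ w₀) + d / 2 + ε := by
  have := hf.isProbabilityMeasure
  set J := scoreCov ν f w₀ with hJdef
  have hC := gaussConst_pos hJ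
  set c₀ := φ w₀ * gaussConst J with hc₀
  have hc₀pos : 0 < c₀ := mul_pos hφ.pos hC
  have hc := hs.pos
  set τ := ε / 8 with hτ
  have hτ0 : 0 < τ := by positivity
  set η := τ / (Fintype.card ι * (4 * A ^ 2) + 1) with hη
  have hη0 : 0 < η := by positivity
  set κ := η / (1 + 16 * η * A ^ 2) * c ^ 2 with hκ
  have hκ0 : 0 < κ := by positivity
  -- The factor 1 + τ is split into two square roots: one bounds the variation of the prior near
  -- `w₀`, the other the factor e^ρ on samples with ρ ≤ ε₂.
  set b := φ w₀ * Real.exp (Real.log (1 + τ) / 2) with hb'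
  have hb0 : 0 < b := mul_pos hφ.pos (Real.exp_pos _)
  set ε₂ := Real.log (1 + τ) / 2 with hε₂
  have hε₂0 : 0 < ε₂ := half_pos (Real.log_pos (by linarith))
  have hφb : φ w₀ < b := lt_mul_of_one_lt_right hφ.pos (Real.one_lt_exp_iff.2 hε₂0)
  have hbexp : b * Real.exp ε₂ * gaussConst J = c₀ * (1 + τ) := by
    have : Real.exp ε₂ * Real.exp ε₂ = 1 + τ := by
      rw [← Real.exp_add, hε₂, add_halves, Real.exp_log (by linarith)]
    rw [hb', hc₀]
    linear_combination φ w₀ * gaussConst J * this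
  have hfar : Tendsto (fun k : ℕ => ENNReal.ofReal b * ∫⁻ u in (Metric.ball (0 : Par d) k)ᶜ,
      ENNReal.ofReal (Real.exp (-κ * ‖u‖ ^ 2))) atTop (𝓝 0) := by
    have := ENNReal.Tendsto.const_mul (tendsto_lintegral_compl_ball (d := d) hκ0)
      (Or.inr (ENNReal.ofReal_ne_top (r := b)))
    rwa [mul_zero] at this
  obtain ⟨k, hk, hk0⟩ := ((hfar.eventually (gt_mem_nhds (ENNReal.ofReal_pos.2
    (mul_pos hc₀pos hτ0)))).and (eventually_gt_atTop 0)).exists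
  set R : ℝ := (k : ℝ) with hR
  have hR0 : 0 < R := Nat.cast_pos.2 hk0
  set V := (volume (Metric.ball (0 : Par d) R)).toReal with hV
  have hV0 : 0 ≤ V := ENNReal.toReal_nonneg
  obtain ⟨K, hK0, hK⟩ : ∃ K : ℝ, 0 < K ∧ Real.exp (-K) * (b * V) ≤ c₀ * τ := by
    have h1 : Tendsto (fun K : ℝ => Real.exp (-K) * (b * V)) atTop (𝓝 (0 * (b * V))) :=
      (Real.tendsto_exp_neg_atTop_nhds_zero).mul_const _
    rw [zero_mul] at h1
    obtain ⟨K, h2, h3⟩ := ((h1.eventually (gt_mem_nhds (mul_pos hc₀pos hτ0))).and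
      (eventually_gt_atTop 0)).exists
    exact ⟨K, h3, h2.le⟩
  obtain ⟨ρ, hρ0, hρi, hρlim, hρ⟩ := hb.exists_lan_remainder hf hR0
  obtain ⟨δ₁, hδ₁, hδφ⟩ := Metric.eventually_nhds_iff_ball.1
    (hφ.continuousAt.eventually (gt_mem_nhds hφb))
  set δ := min (min δ₁ r) 1 with hδ
  have hδ0 : 0 < δ := lt_min (lt_min hδ₁ hb.pos) one_pos
  have hδ1 : δ ≤ 1 := min_le_right _ _
  have hδr : δ ≤ r := (min_le_left _ _).trans (min_le_right _ _)
  have hδφ' : ∀ w ∈ Metric.ball w₀ δ, φ w ≤ b := fun w hw =>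
    (hδφ w (Metric.ball_subset_ball ((min_le_left _ _).trans (min_le_left _ _)) hw)).le
  filter_upwards [hρi, hρ, hρlim.eventually (gt_mem_nhds
    (by positivity : 0 < τ * ε₂ / K)), eventually_gt_atTop 0,
    (tendsto_inv_sqrt_mul R).eventually (gt_mem_nhds hδ0),
    (tendsto_exp_neg_mul_mul_sqrt_pow (by positivity : 0 < κ * δ ^ 2) d).eventually
      (gt_mem_nhds (mul_pos hc₀pos hτ0))] with n hρin hρn hρε hn hnδ hnexp
  set Pn := sampleLaw (trueLaw ν f w₀) n with hPn
  have hn0 : (0 : ℝ) < n := by exact_mod_cast hn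
  have hsn : 0 < Real.sqrt n := Real.sqrt_pos.2 hn0
  have hqi := hb.integrable_invQuad hf n
  have hpi := hs.integrable_penalty hf n
  have hlogi := hb.integrable_log_evidenceRatio hf hφ n
  -- The first term of `T` cancels the random factor of the Gaussian integral, the second damps the
  -- samples with a large remainder, and the penalty damps the distant parameters.
  set T : (Fin n → Z) → ℝ := fun z => 1 / 2 * invQuad J (normScore f w₀ n z)
    + (K / ε₂ * ρ n z + η * penalty ν f w₀ ψ z) with hT
  have hTi : Integrable T Pn :=
    (hqi.const_mul _).add ((hρin.const_mul _).add (hpi.const_mul _))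
  have hTle : ∫ z, T z ∂Pn ≤ d / 2 + 2 * τ := by
    simp only [hT]
    rw [integral_add (hqi.const_mul _) ((hρin.const_mul _).fun_add (hpi.const_mul _)),
      integral_add (hρin.const_mul _) (hpi.const_mul _), integral_const_mul, integral_const_mul,
      integral_const_mul, hb.integral_invQuad hf hJ hn]
    have h1 : K / ε₂ * ∫ z, ρ n z ∂Pn ≤ τ := by
      calc K / ε₂ * ∫ z, ρ n z ∂Pn ≤ K / ε₂ * (τ * ε₂ / K) := by gcongr
        _ = τ := by field_simp
    have h2 : η * ∫ z, penalty ν f w₀ ψ z ∂Pn ≤ τ := by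
      calc η * ∫ z, penalty ν f w₀ ψ z ∂Pn ≤ η * (Fintype.card ι * (4 * A ^ 2)) :=
            mul_le_mul_of_nonneg_left (hs.integral_penalty_le hf hn) hη0.le
        _ = τ * ((Fintype.card ι * (4 * A ^ 2)) / (Fintype.card ι * (4 * A ^ 2) + 1)) := by
            rw [hη]; ring
        _ ≤ τ := mul_le_of_le_one_right hτ0.le ((div_le_one (by positivity)).2 (by linarith))
    linarith
  have hpen0 : ∀ z : Fin n → Z, 0 ≤ penalty ν f w₀ ψ z := fun z =>
    Finset.sum_nonneg fun k _ => by rw [deviationSq]; positivity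
  set N₂ : (Fin n → Z) → ENNReal := fun z => ENNReal.ofReal (Real.exp (-K)) *
    ∫⁻ u in Metric.ball (0 : Par d) R, localEvidence W f φ w₀ z u with hN₂
  set N₃ : (Fin n → Z) → ENNReal := fun z => ∫⁻ u in (Metric.ball (0 : Par d) R)ᶜ,
    localEvidence W f φ w₀ z u * ENNReal.ofReal (Real.exp (-(η * penalty ν f w₀ ψ z))) with hN₃
  have hm1 : Measurable fun p : (Fin n → Z) × Par d => localEvidence W f φ w₀ p.1 p.2 :=
    hf.measurable_localEvidence hφ n _
  have hN₂m : Measurable N₂ := (Measurable.lintegral_prod_right' hm1).const_mul _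
  set Y : (Fin n → Z) → ℝ := fun z => Real.sqrt n ^ d * (evidenceRatio W f φ w₀ z).toReal with hY
  have hpt : ∀ᵐ z ∂Pn, ENNReal.ofReal (Y z * Real.exp (-T z))
      ≤ ENNReal.ofReal (c₀ * (1 + τ)) + (N₂ z + N₃ z) := by
    filter_upwards [hρn, hf.ae_evidenceRatio_lt_top hφ n, ae_sampleLaw_forall n hb.pos_ae]
      with z hz hfin hpos
    have hq0 := invQuad_nonneg hJ (normScore f w₀ n z)
    have hYz : ENNReal.ofReal (Y z) = (∫⁻ u in Metric.ball (0 : Par d) R, localEvidence W f φ w₀ z u)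
        + ∫⁻ u in (Metric.ball (0 : Par d) R)ᶜ, localEvidence W f φ w₀ z u := by
      rw [lintegral_add_compl _ Metric.isOpen_ball.measurableSet, hY,
        ENNReal.ofReal_mul (by positivity), ENNReal.ofReal_toReal hfin.ne,
        ofReal_mul_evidenceRatio hf.measurableSet hn]
      rfl
    rw [ENNReal.ofReal_mul (by positivity), hYz, add_mul, ← add_assoc]
    refine add_le_add ?_ ?_
    · rcases le_or_gt (ρ n z) ε₂ with hle | hlt
      · refine le_trans ?_ le_self_add
        have h1 := setLIntegral_localEvidence_le hf hJ hb0.le hδφ' hnδ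
          (fun k => hpos k _ hb.center_mem)
          (fun w hw k => hpos k w (Metric.ball_subset_ball hδr hw)) hz
        refine (mul_le_mul_left h1 _).trans ?_
        rw [← ENNReal.ofReal_mul (by positivity)]
        refine ENNReal.ofReal_le_ofReal ?_
        rw [← hbexp]
        have h2 : Real.exp (1 / 2 * invQuad J (normScore f w₀ n z)) * Real.exp (-T z) ≤ 1 := by
          rw [← Real.exp_add, Real.exp_le_one_iff]
          have h3 : 0 ≤ K / ε₂ * ρ n z := mul_nonneg (by positivity) (hρ0 n z)
          have h4 := mul_nonneg hη0.le (hpen0 z)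
          simp only [hT]
          linarith
        calc _ = b * Real.exp (ρ n z) * gaussConst J *
              (Real.exp (1 / 2 * invQuad J (normScore f w₀ n z)) * Real.exp (-T z)) := by ring
          _ ≤ b * Real.exp (ρ n z) * gaussConst J * 1 := by gcongr
          _ ≤ b * Real.exp ε₂ * gaussConst J := by rw [mul_one]; gcongr
      · refine le_trans ?_ le_add_self
        rw [mul_comm, hN₂]
        refine mul_le_mul_left (ENNReal.ofReal_le_ofReal (Real.exp_le_exp.2 (neg_le_neg ?_))) _
        have h3 : K ≤ K / ε₂ * ρ n z := by
          rw [div_mul_eq_mul_div, le_div_iff₀ hε₂0]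
          exact mul_le_mul_of_nonneg_left hlt.le hK0.le
        have h4 := mul_nonneg hη0.le (hpen0 z)
        simp only [hT]
        linarith
    · rw [← lintegral_mul_const' _ _ ENNReal.ofReal_ne_top]
      refine lintegral_mono fun u => ?_
      refine mul_le_mul_right (ENNReal.ofReal_le_ofReal (Real.exp_le_exp.2 (neg_le_neg ?_))) _
      have h3 : 0 ≤ K / ε₂ * ρ n z := mul_nonneg (by positivity) (hρ0 n z)
      simp only [hT]
      linarith
  have hN₂le : ∫⁻ z, N₂ z ∂Pn ≤ ENNReal.ofReal (c₀ * τ) := by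
    rw [hN₂, lintegral_const_mul' _ _ ENNReal.ofReal_ne_top]
    calc _ ≤ ENNReal.ofReal (Real.exp (-K)) *
          (ENNReal.ofReal b * volume (Metric.ball (0 : Par d) R)) := by
          gcongr
          exact lintegral_near_le hf hφ hδφ' hnδ
      _ = ENNReal.ofReal (Real.exp (-K) * (b * V)) := by
          rw [ENNReal.ofReal_mul (Real.exp_pos _).le, ENNReal.ofReal_mul hb0.le, hV,
            ENNReal.ofReal_toReal measure_ball_lt_top.ne]
      _ ≤ _ := ENNReal.ofReal_le_ofReal hK
  have hN₃le : ∫⁻ z, N₃ z ∂Pn ≤ ENNReal.ofReal (c₀ * τ) + ENNReal.ofReal (c₀ * τ) :=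
    (lintegral_far_le hf hφ hs hη0 hn hδ1 hδ0.le hκ hδφ' _).trans
      (add_le_add hk.le (ENNReal.ofReal_le_ofReal hnexp.le))
  have hlint : ∫⁻ z, ENNReal.ofReal (Y z * Real.exp (-T z)) ∂Pn
      ≤ ENNReal.ofReal (c₀ * (1 + 4 * τ)) := by
    calc _ ≤ ∫⁻ z, (ENNReal.ofReal (c₀ * (1 + τ)) + (N₂ z + N₃ z)) ∂Pn := lintegral_mono_ae hpt
      _ = ENNReal.ofReal (c₀ * (1 + τ)) + (∫⁻ z, N₂ z ∂Pn + ∫⁻ z, N₃ z ∂Pn) := by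
          rw [lintegral_add_left measurable_const, lintegral_add_left hN₂m]
          simp
      _ ≤ ENNReal.ofReal (c₀ * (1 + τ)) + (ENNReal.ofReal (c₀ * τ)
            + (ENNReal.ofReal (c₀ * τ) + ENNReal.ofReal (c₀ * τ))) := by gcongr
      _ = _ := by
          rw [← ENNReal.ofReal_add (by positivity) (by positivity),
            ← ENNReal.ofReal_add (by positivity) (by positivity),
            ← ENNReal.ofReal_add (by positivity) (by positivity)]
          congr 1; ring
  have hYT0 : ∀ z, 0 ≤ Y z * Real.exp (-T z) := fun z =>
    mul_nonneg (mul_nonneg (by positivity) ENNReal.toReal_nonneg) (Real.exp_pos _).le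
  have hYTm : AEStronglyMeasurable (fun z => Y z * Real.exp (-T z)) Pn :=
    (((hf.measurable_evidenceRatio hφ n).ennreal_toReal.const_mul _).aestronglyMeasurable).mul
      (Real.continuous_exp.comp_aestronglyMeasurable hTi.1.neg)
  have hYTi : Integrable (fun z => Y z * Real.exp (-T z)) Pn := by
    refine ⟨hYTm, ?_⟩
    rw [hasFiniteIntegral_iff_ofReal (Eventually.of_forall hYT0)]
    exact hlint.trans_lt ENNReal.ofReal_lt_top
  have hYTle : ∫ z, Y z * Real.exp (-T z) ∂Pn ≤ c₀ * (1 + 4 * τ) := by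
    rw [integral_eq_lintegral_of_nonneg_ae (Eventually.of_forall hYT0) hYTm]
    exact ENNReal.toReal_le_of_le_ofReal (by positivity) hlint
  have hfinal : ∀ᵐ z ∂Pn, Real.log (evidenceRatio W f φ w₀ z).toReal + d / 2 * Real.log n
      ≤ T z + (Real.log c₀ - 1) + c₀⁻¹ * (Y z * Real.exp (-T z)) := by
    filter_upwards [hb.ae_evidenceRatio_pos hf hφ n] with z hz
    have hYpos : 0 < Y z := mul_pos (by positivity) hz
    have h1 : Real.log (Y z) = Real.log (evidenceRatio W f φ w₀ z).toReal + d / 2 * Real.log n := by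
      rw [hY, Real.log_mul (by positivity) hz.ne', Real.log_pow, Real.log_sqrt hn0.le]
      ring
    have h2 := Real.log_le_sub_one_of_pos
      (mul_pos (inv_pos.2 hc₀pos) (mul_pos hYpos (Real.exp_pos (-T z))))
    rw [Real.log_mul (inv_pos.2 hc₀pos).ne' (mul_pos hYpos (Real.exp_pos _)).ne',
      Real.log_mul hYpos.ne' (Real.exp_pos _).ne', Real.log_exp, Real.log_inv, h1] at h2
    linarith
  have h := integral_mono_ae (hlogi.fun_add (integrable_const (d / 2 * Real.log n)))
    ((hTi.fun_add (integrable_const (Real.log c₀ - 1))).fun_add (hYTi.const_mul c₀⁻¹)) hfinal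
  rw [integral_add hlogi (integrable_const _),
    integral_add (hTi.fun_add (integrable_const (Real.log c₀ - 1))) (hYTi.const_mul c₀⁻¹),
    integral_add hTi (integrable_const _), integral_const_mul c₀⁻¹] at h
  simp only [integral_const, probReal_univ, one_smul] at h
  have h5 : c₀⁻¹ * ∫ z, Y z * Real.exp (-T z) ∂Pn ≤ 1 + 4 * τ := by
    rw [inv_mul_le_iff₀ hc₀pos]; exact hYTle
  have h6 : Real.log c₀ = Real.log (φ w₀) + Real.log (gaussConst J) :=
    Real.log_mul hφ.pos.ne' hC.ne'
  linarith

end LocalBounds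

end Upper

/-! ### Separating statistics -/

section Separation

variable {d : ℕ} {Z : Type*} [MeasurableSpace Z] {ν : Measure Z} {W : Set (Par d)}
  {f : Z → Par d → ℝ} {w₀ : Par d} {φ : Par d → ℝ} {r : ℝ} {B G : Z → ℝ}

namespace LocalBounds

lemma dotProduct_scoreCov_mulVec (hf : IsRegularFamily ν W f w₀) (hb : LocalBounds ν W f w₀ r B G)
    (v : Par d) :
    v ⬝ᵥ (scoreCov ν f w₀ *ᵥ v) = ∫ z, (∑ i, v i * score f w₀ z i) ^ 2 ∂trueLaw ν f w₀ := by
  have hi : ∀ i j, Integrable (fun z => score f w₀ z i * score f w₀ z j) (trueLaw ν f w₀) :=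
    fun i j => (hb.memLp_score hf i).integrable_mul (hb.memLp_score hf j)
  rw [dotProduct_mulVec_self_eq_sum]
  have h : ∀ z, (∑ i, v i * score f w₀ z i) ^ 2
      = ∑ i, ∑ j, v i * v j * (score f w₀ z i * score f w₀ z j) := fun z => by
    rw [sq, Finset.sum_mul_sum]
    exact Finset.sum_congr rfl fun i _ => Finset.sum_congr rfl fun j _ => by ring
  simp_rw [h]
  rw [integral_finsetSum _ fun i _ => integrable_finsetSum _ fun j _ => (hi i j).const_mul _]
  refine Finset.sum_congr rfl fun i _ => ?_
  rw [integral_finsetSum _ fun j _ => (hi i j).const_mul _]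
  exact Finset.sum_congr rfl fun j _ => by rw [integral_const_mul]; rfl

/-- A family with separating statistics has a positive definite Fisher information matrix. -/
theorem posDef_scoreCov (hf : IsRegularFamily ν W f w₀) (hb : LocalBounds ν W f w₀ r B G)
    {ι : Type*} {ψ : ι → Z → ℝ} {A c : ℝ} (hs : IsSeparating ν W f w₀ ψ A c) :
    (scoreCov ν f w₀).PosDef := by
  refine Matrix.PosDef.of_dotProduct_mulVec_pos ?_ fun v hv => ?_
  · ext i j
    simp only [scoreCov, Matrix.conjTranspose_apply, Matrix.of_apply, star_trivial]
    exact integral_congr_ae (Eventually.of_forall fun z => mul_comm _ _)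
  rw [star_trivial, hb.dotProduct_scoreCov_mulVec hf]
  refine lt_of_le_of_ne (integral_nonneg fun z => sq_nonneg _) fun h0 => ?_
  have hsq : Integrable (fun z => (∑ i, v i * score f w₀ z i) ^ 2) (trueLaw ν f w₀) :=
    (memLp_finsetSum _ fun i _ => (hb.memLp_score hf i).const_mul (v i)).integrable_sq
  have hae := (integral_eq_zero_iff_of_nonneg (fun z => sq_nonneg _) hsq).1 h0.symm
  have hnv : 0 < ‖v‖ := norm_pos_iff.2 hv
  set C := (d : ℝ) ^ 2 * A * (∫ z, B z ∂ν) with hC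
  -- If the quadratic form vanishes at `v`, the score in direction `v` is 0 almost surely. The means
  -- of the statistics then move only by O(t²) along `v`, against the linear rate of separation.
  have key : ∀ t : ℝ, 0 < t → t * ‖v‖ < r → t * ‖v‖ ≤ 1 → c ≤ C * (t * ‖v‖) := by
    intro t ht htr ht1
    have hn : ‖t • v‖ = t * ‖v‖ := by rw [norm_smul, Real.norm_of_nonneg ht.le]
    obtain ⟨k, hk⟩ := hs.sep (w₀ + t • v) (hb.subset (by simpa [mem_ball_iff_norm, hn] using htr))
    rw [add_sub_cancel_left, hn, min_eq_left ht1] at hk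
    have h1 := hb.abs_integral_expansion_le hf (hs.measurable k) (hs.bound k) (hn ▸ htr)
    have h2 : ∑ i, (t • v) i * ∫ z, ψ k z * score f w₀ z i ∂trueLaw ν f w₀ = 0 := by
      have hi : ∀ i, Integrable (fun z => ψ k z * score f w₀ z i) (trueLaw ν f w₀) := fun i =>
        have := hf.isProbabilityMeasure
        ((hb.memLp_score hf i).integrable (by norm_num)).bdd_mul
          (hs.measurable k).aestronglyMeasurable (Eventually.of_forall (hs.bound k))
      simp_rw [← integral_const_mul]
      rw [← integral_finsetSum _ fun i _ => (hi i).const_mul _]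
      refine integral_eq_zero_of_ae ?_
      filter_upwards [hae] with z hz
      have hz' : ∑ i, v i * score f w₀ z i = 0 := by simpa using hz
      calc ∑ i, (t • v) i * (ψ k z * score f w₀ z i)
          = t * ψ k z * ∑ i, v i * score f w₀ z i := by
            rw [Finset.mul_sum]
            exact Finset.sum_congr rfl fun i _ => by simp only [Pi.smul_apply, smul_eq_mul]; ring
        _ = 0 := by rw [hz', mul_zero]
    rw [h2, sub_zero, hn] at h1
    have h3 : c * (t * ‖v‖) ≤ C * (t * ‖v‖) * (t * ‖v‖) := by
      rw [mul_assoc, ← sq]; exact hk.trans h1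
    exact le_of_mul_le_mul_right h3 (mul_pos ht hnv)
  set s := min (min (r / 2) 1) (c / (2 * (|C| + 1))) with hsdef
  have hs0 : 0 < s := lt_min (lt_min (by linarith [hb.pos]) one_pos)
    (div_pos hs.pos (by positivity))
  have h4 := key (s / ‖v‖) (by positivity)
  rw [div_mul_cancel₀ _ hnv.ne'] at h4
  have h5 := h4 (((min_le_left _ _).trans (min_le_left _ _)).trans_lt (by linarith [hb.pos]))
    ((min_le_left _ _).trans (min_le_right _ _))
  have h6 : s ≤ c / (2 * (|C| + 1)) := min_le_right _ _
  rw [le_div_iff₀ (by positivity)] at h6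
  nlinarith [le_abs_self C, hs.pos, abs_nonneg C]

/-- Bounded approximations of the scores separate `w₀` from the parameters close to it. -/
theorem exists_local_separation (hf : IsRegularFamily ν W f w₀) (hb : LocalBounds ν W f w₀ r B G)
    (hJ : (scoreCov ν f w₀).PosDef) :
    ∃ (ψ : Fin d → Z → ℝ) (A c δ : ℝ), (∀ i, Measurable (ψ i)) ∧ (∀ i z, |ψ i z| ≤ A) ∧ 0 < c ∧
      0 < δ ∧ ∀ v, v ≠ 0 → ‖v‖ < δ → w₀ + v ∈ W → ∃ i, c * ‖v‖
        ≤ |∫ z, ψ i z * f z (w₀ + v) ∂ν - ∫ z, ψ i z ∂trueLaw ν f w₀| := by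
  have := hf.isProbabilityMeasure
  set J := scoreCov ν f w₀ with hJdef
  obtain ⟨c₁, hc₁, hc₁J⟩ := exists_le_dotProduct_mulVec hJ
  set S := 1 + ∑ j, J j j with hS
  have hJjj : ∀ j, 0 ≤ J j j := fun j => integral_nonneg fun z => mul_self_nonneg _
  have hS1 : 1 ≤ S := by
    have := Finset.sum_nonneg fun j (_ : j ∈ Finset.univ) => hJjj j
    linarith
  -- `η` is small enough that replacing the scores by bounded functions changes the quadratic form
  -- of `J` by at most (c₁/2)‖v‖².
  set η := c₁ / (2 * ((d : ℝ) ^ 2 + 1) * S) with hη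
  have hη0 : 0 < η := by positivity
  choose φ hφ using fun i => exists_simpleFunc_integral_sq_sub_le (hb.memLp_score hf i)
    (pow_pos hη0 2)
  choose A₀ hA₀ using fun i => (φ i).exists_forall_norm_le
  set A := ∑ i, |A₀ i| with hAdef
  have hA : ∀ i z, |φ i z| ≤ A := fun i z => ((hA₀ i z).trans (le_abs_self _)).trans
    (Finset.single_le_sum (f := fun i => |A₀ i|) (fun j _ => abs_nonneg _) (Finset.mem_univ i))
  have hA0 : 0 ≤ A := Finset.sum_nonneg fun j _ => abs_nonneg _
  have hsL := hb.memLp_score hf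
  have hφL : ∀ i, MemLp (φ i) 2 (trueLaw ν f w₀) := fun i =>
    MemLp.of_bound (φ i).aestronglyMeasurable A (Eventually.of_forall (hA i))
  have happrox : ∀ i j, |∫ z, φ i z * score f w₀ z j ∂trueLaw ν f w₀ - J i j| ≤ η * S := by
    intro i j
    have hi1 : Integrable (fun z => φ i z * score f w₀ z j) (trueLaw ν f w₀) :=
      (hφL i).integrable_mul (hsL j)
    have hi2 : ∀ i, Integrable (fun z => score f w₀ z i * score f w₀ z j) (trueLaw ν f w₀) :=
      fun i => (hsL i).integrable_mul (hsL j)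
    have hd : Integrable (fun z => (score f w₀ z i - φ i z) ^ 2) (trueLaw ν f w₀) :=
      ((hsL i).sub (hφL i)).integrable_sq
    rw [abs_sub_comm, hJdef, scoreCov, Matrix.of_apply]
    have e : ∫ z, score f w₀ z i * score f w₀ z j ∂trueLaw ν f w₀
        - ∫ z, φ i z * score f w₀ z j ∂trueLaw ν f w₀
        = ∫ z, (score f w₀ z i - φ i z) * score f w₀ z j ∂trueLaw ν f w₀ := by
      rw [← integral_sub (hi2 i) hi1]
      exact integral_congr_ae (Eventually.of_forall fun z => by simp [sub_mul])
    rw [e]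
    have hb1 : ‖∫ z, (score f w₀ z i - φ i z) * score f w₀ z j ∂trueLaw ν f w₀‖
        ≤ ∫ z, (η⁻¹ * (score f w₀ z i - φ i z) ^ 2 + η * (score f w₀ z j * score f w₀ z j))
          ∂trueLaw ν f w₀ := by
      refine norm_integral_le_of_norm_le ((hd.const_mul η⁻¹).add
        ((hi2 j).const_mul η)) (Eventually.of_forall fun z => ?_)
      set a := score f w₀ z i - φ i z
      set b := score f w₀ z j
      -- Weighted mean inequality; the weight turns the squared L² error η² into η.
      have h1 : |a * b| ≤ η⁻¹ * a ^ 2 + η * (b * b) := by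
        have e1 : η⁻¹ * a ^ 2 + η * (b * b) - |a * b|
            = η⁻¹ * ((|a| - η / 2 * |b|) ^ 2 + 3 / 4 * (η * |b|) ^ 2) := by
          rw [abs_mul, ← sq_abs a, ← sq, ← sq_abs b]
          field_simp
          ring
        have : 0 ≤ η⁻¹ * ((|a| - η / 2 * |b|) ^ 2 + 3 / 4 * (η * |b|) ^ 2) := by positivity
        linarith
      exact h1
    rw [integral_add (hd.const_mul η⁻¹)
      ((hi2 j).const_mul η), integral_const_mul, integral_const_mul] at hb1
    have h2 : η⁻¹ * ∫ z, (score f w₀ z i - φ i z) ^ 2 ∂trueLaw ν f w₀ ≤ η := by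
      rw [inv_mul_le_iff₀ hη0, ← sq]; exact hφ i
    have h3 : J j j ≤ ∑ j, J j j :=
      Finset.single_le_sum (f := fun j => J j j) (fun j _ => hJjj j) (Finset.mem_univ j)
    have h4 : ∫ z, score f w₀ z j * score f w₀ z j ∂trueLaw ν f w₀ = J j j := rfl
    rw [h4] at hb1
    refine hb1.trans ?_
    rw [hS, mul_add, mul_one]
    gcongr
  set C := (d : ℝ) ^ 2 * A * (∫ z, B z ∂ν) with hC
  have hC0 : 0 ≤ C := by
    have : 0 ≤ ∫ z, B z ∂ν := integral_nonneg fun z => hb.B_nonneg z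
    positivity
  refine ⟨fun i => φ i, A, c₁ / (8 * (d + 1)), min r (c₁ / (8 * (d * C + 1))),
    fun i => (φ i).measurable, hA, by positivity, lt_min hb.pos (by positivity), ?_⟩
  intro v hv0 hv _
  -- If no statistic moved enough, v·Ev would be at most (c₁/4)‖v‖², while it lies within (c₁/2)‖v‖²
  -- of v·Jv ≥ c₁‖v‖².
  by_contra! hcon
  have hnv : 0 < ‖v‖ := norm_pos_iff.2 hv0
  have hvr : ‖v‖ < r := hv.trans_le (min_le_left _ _)
  have hvc : ‖v‖ < c₁ / (8 * (d * C + 1)) := hv.trans_le (min_le_right _ _)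
  have hvi : ∀ i, |v i| ≤ ‖v‖ := fun i => norm_le_pi_norm v i
  set D : Fin d → ℝ := fun i => ∫ z, φ i z * f z (w₀ + v) ∂ν - ∫ z, φ i z ∂trueLaw ν f w₀ with hD
  set E : Fin d → Fin d → ℝ := fun i j => ∫ z, φ i z * score f w₀ z j ∂trueLaw ν f w₀ with hE
  have hexp : ∀ i, |D i - ∑ j, v j * E i j| ≤ C * ‖v‖ ^ 2 := fun i =>
    hb.abs_integral_expansion_le hf (φ i).measurable (hA i) hvr
  have h1 : ∀ i, v i * ∑ j, v j * E i j ≤ ‖v‖ * (c₁ / (8 * (d + 1)) * ‖v‖ + C * ‖v‖ ^ 2) := by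
    intro i
    refine (le_abs_self _).trans ?_
    rw [abs_mul]
    refine mul_le_mul (hvi i) ?_ (abs_nonneg _) (norm_nonneg _)
    have := (hcon i).le
    have h2 := hexp i
    rw [abs_sub_comm] at h2
    calc |∑ j, v j * E i j| = |(∑ j, v j * E i j - D i) + D i| := by rw [sub_add_cancel]
      _ ≤ _ := (abs_add_le _ _).trans (by linarith)
  have h2 : ∑ i, v i * ∑ j, v j * E i j ≤ d * (‖v‖ * (c₁ / (8 * (d + 1)) * ‖v‖ + C * ‖v‖ ^ 2)) := by
    refine (Finset.sum_le_sum fun i _ => h1 i).trans ?_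
    simp
  have h3 : |∑ i, v i * ∑ j, v j * E i j - v ⬝ᵥ (J *ᵥ v)| ≤ d ^ 2 * (η * S * ‖v‖ ^ 2) := by
    rw [dotProduct_mulVec_self_eq_sum]
    have e : ∑ i, v i * ∑ j, v j * E i j - ∑ i, ∑ j, v i * v j * J i j
        = ∑ i, ∑ j, v i * v j * (E i j - J i j) := by
      rw [← Finset.sum_sub_distrib]
      refine Finset.sum_congr rfl fun i _ => ?_
      rw [Finset.mul_sum, ← Finset.sum_sub_distrib]
      exact Finset.sum_congr rfl fun j _ => by ring
    rw [e]
    refine (Finset.abs_sum_le_sum_abs _ _).trans ((Finset.sum_le_sum fun i _ =>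
      (Finset.abs_sum_le_sum_abs _ _).trans (Finset.sum_le_sum fun j _ =>
        (?_ : _ ≤ η * S * ‖v‖ ^ 2))).trans ?_)
    · rw [abs_mul, abs_mul, mul_comm, sq]
      exact mul_le_mul (happrox i j) (mul_le_mul (hvi i) (hvi j) (abs_nonneg _) (norm_nonneg _))
        (by positivity) (by positivity)
    · simp only [Finset.sum_const, Finset.card_univ, Fintype.card_fin, nsmul_eq_mul]
      exact le_of_eq (by ring)
  have h4 := hc₁J v
  have h5 : (d : ℝ) ^ 2 * (η * S * ‖v‖ ^ 2) ≤ c₁ / 2 * ‖v‖ ^ 2 := by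
    have : (d : ℝ) ^ 2 * (η * S) ≤ c₁ / 2 := by
      rw [hη, div_mul_eq_mul_div, mul_div_assoc', div_le_iff₀ (by positivity)]
      nlinarith [mul_pos hc₁ (zero_lt_one.trans_le hS1)]
    nlinarith [sq_nonneg ‖v‖]
  have h6 : (d : ℝ) * (‖v‖ * (c₁ / (8 * (d + 1)) * ‖v‖ + C * ‖v‖ ^ 2)) ≤ c₁ / 4 * ‖v‖ ^ 2 := by
    have e1 : (d : ℝ) * (c₁ / (8 * (d + 1))) ≤ c₁ / 8 := by
      rw [mul_div_assoc', div_le_div_iff₀ (by positivity) (by positivity)]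
      nlinarith
    have e2 : (d : ℝ) * C * ‖v‖ ≤ c₁ / 8 := by
      rw [lt_div_iff₀ (by positivity)] at hvc
      nlinarith
    have e3 : (d : ℝ) * (‖v‖ * (c₁ / (8 * (d + 1)) * ‖v‖ + C * ‖v‖ ^ 2))
        = (d * (c₁ / (8 * (d + 1))) + d * C * ‖v‖) * ‖v‖ ^ 2 := by ring
    rw [e3]
    gcongr
    linarith
  have h7 := (abs_le.1 h3).1
  have h8 : 0 < c₁ * ‖v‖ ^ 2 := by positivity
  linarith

/-- The asymptotic expansion of the expected log-evidence. -/
theorem tendsto_integral_log_evidenceRatio (hf : IsRegularFamily ν W f w₀)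
    (hb : LocalBounds ν W f w₀ r B G) (hφ : IsPriorAt W φ w₀) {ι : Type*} [Fintype ι]
    {ψ : ι → Z → ℝ} {A c : ℝ} (hs : IsSeparating ν W f w₀ ψ A c) :
    Tendsto (fun n : ℕ => ∫ z, Real.log (evidenceRatio W f φ w₀ z).toReal
        ∂sampleLaw (trueLaw ν f w₀) n + d / 2 * Real.log n) atTop
      (𝓝 (Real.log (gaussConst (scoreCov ν f w₀)) + Real.log (φ w₀) + d / 2)) := by
  have hJ := hb.posDef_scoreCov hf hs
  rw [Metric.tendsto_nhds]
  intro ε hε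
  filter_upwards [eventually_le_integral_log_evidenceRatio hf hb hφ hJ (half_pos hε),
    eventually_integral_log_evidenceRatio_le hf hb hφ hJ hs (half_pos hε)] with n h1 h2
  rw [Real.dist_eq, abs_lt]
  constructor <;> linarith

end LocalBounds

end Separation

/-! ### Separating statistics from stable identifiability -/

section Identifiability

universe u

/-- A probability measure outside the weak closure of a set is separated from it by finitely many
bounded continuous functions. -/
lemma exists_finset_separating {X : Type u} [MeasurableSpace X] [TopologicalSpace X]
    [OpensMeasurableSpace X] {P : ProbabilityMeasure X} {F : Set (ProbabilityMeasure X)}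
    (hP : P ∉ closure F) :
    ∃ (I : Finset (BoundedContinuousFunction X ℝ)) (ε : BoundedContinuousFunction X ℝ → ℝ),
      (∀ g, 0 < ε g) ∧ ∀ Q ∈ F, ∃ g ∈ I, ε g ≤ |∫ x, g x ∂(Q : Measure X) - ∫ x, g x ∂(P : Measure X)| := by
  set Φ : ProbabilityMeasure X → BoundedContinuousFunction X ℝ → ℝ :=
    fun Q g => ∫ x, g x ∂(Q : Measure X) with hΦ
  -- The weak topology is induced by integration against all bounded continuous functions. A basic
  -- neighbourhood in the product topology constrains only finitely many of them.
  have hle : comap Φ (𝓝 (Φ P)) ≤ 𝓝 P := by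
    have h : Tendsto (fun Q : ProbabilityMeasure X => Q) (comap Φ (𝓝 (Φ P))) (𝓝 P) := by
      rw [ProbabilityMeasure.tendsto_iff_forall_integral_tendsto]
      exact tendsto_pi_nhds.1 (tendsto_comap (f := Φ) (x := 𝓝 (Φ P)))
    simpa [Tendsto] using h
  have hF : Fᶜ ∈ 𝓝 P := by
    rw [← mem_interior_iff_mem_nhds, interior_compl]; exact hP
  obtain ⟨t, ht, htF⟩ := mem_comap.1 (hle hF)
  rw [nhds_pi, mem_pi'] at ht
  obtain ⟨I, s, hs, hst⟩ := ht
  choose ε hε hεs using fun g => Metric.mem_nhds_iff.1 (hs g)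
  refine ⟨I, ε, hε, fun Q hQ => ?_⟩
  by_contra! hcon
  exact htF (hst fun g hg => hεs g (by simpa [Real.dist_eq] using hcon g hg)) hQ

variable {d : ℕ} {W : Set (Par d)} {w₀ : Par d} {r : ℝ}

/-- Weak identifiability of `w₀` yields statistics that separate it from the parameters outside a
neighbourhood. -/
lemma IsRegularFamily.exists_far_separation {X : Type u} [MeasurableSpace X] [TopologicalSpace X]
    [TopologicalSpace.PseudoMetrizableSpace X] [TopologicalSpace.SeparableSpace X] [BorelSpace X]
    {ν : Measure X} {f : X → Par d → ℝ} (hf : IsRegularFamily ν W f w₀)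
    (hident : ∀ u : ℕ → Par d, (∀ k, u k ∈ W) →
      (∀ g : BoundedContinuousFunction X ℝ, Tendsto (fun k => ∫ x, g x * f x (u k) ∂ν) atTop
        (𝓝 (∫ x, g x * f x w₀ ∂ν))) → Tendsto u atTop (𝓝 w₀)) {δ : ℝ} (hδ : 0 < δ) :
    ∃ (I : Finset (BoundedContinuousFunction X ℝ)) (ε : BoundedContinuousFunction X ℝ → ℝ),
      (∀ g, 0 < ε g) ∧ ∀ w ∈ W, δ ≤ ‖w - w₀‖ → ∃ g ∈ I,
        ε g ≤ |∫ x, g x * f x w ∂ν - ∫ x, g x ∂trueLaw ν f w₀| := by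
  let Q : W → ProbabilityMeasure X := fun w => ⟨trueLaw ν f w, hf.isProbabilityMeasure_trueLaw w.2⟩
  have hQ : ∀ (w : W) (g : X → ℝ), ∫ x, g x ∂(Q w : Measure X) = ∫ x, g x * f x w ∂ν :=
    fun w g => hf.integral_trueLaw_of_mem w.2 g
  have hcl : Q ⟨w₀, hf.mem⟩ ∉ closure (Q '' {w | δ ≤ ‖(w : Par d) - w₀‖}) := by
    -- The weak topology is metrizable on a separable metrizable space, so identifiability along
    -- sequences is enough.
    rw [mem_closure_iff_seq_limit]
    rintro ⟨x, hx, hlim⟩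
    choose u hu hux using hx
    rw [ProbabilityMeasure.tendsto_iff_forall_integral_tendsto] at hlim
    have h := hident (fun k => u k) (fun k => (u k).2) fun g => by
      have h := hlim g
      simp_rw [← hux, hQ] at h
      exact h
    obtain ⟨k, hk⟩ := (h.eventually (Metric.ball_mem_nhds _ hδ)).exists
    rw [dist_eq_norm] at hk
    exact absurd (hu k) (not_le.2 hk)
  obtain ⟨I, ε, hε, h⟩ := exists_finset_separating hcl
  refine ⟨I, ε, hε, fun w hw hwδ => ?_⟩
  obtain ⟨g, hg, hgε⟩ := h (Q ⟨w, hw⟩) ⟨⟨w, hw⟩, hwδ, rfl⟩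
  exact ⟨g, hg, by rwa [hQ] at hgε⟩

/-- Joins the statistics near `w₀` with those that work away from it. -/
theorem LocalBounds.exists_isSeparating {X : Type u} [MeasurableSpace X] [TopologicalSpace X]
    [TopologicalSpace.PseudoMetrizableSpace X] [TopologicalSpace.SeparableSpace X] [BorelSpace X]
    {ν : Measure X} {f : X → Par d → ℝ} {B G : X → ℝ} (hf : IsRegularFamily ν W f w₀)
    (hb : LocalBounds ν W f w₀ r B G) (hJ : (scoreCov ν f w₀).PosDef)
    (hident : ∀ u : ℕ → Par d, (∀ k, u k ∈ W) →
      (∀ g : BoundedContinuousFunction X ℝ, Tendsto (fun k => ∫ x, g x * f x (u k) ∂ν) atTop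
        (𝓝 (∫ x, g x * f x w₀ ∂ν))) → Tendsto u atTop (𝓝 w₀)) :
    ∃ (ι : Type u) (_ : Fintype ι) (ψ : ι → X → ℝ) (A c : ℝ), IsSeparating ν W f w₀ ψ A c := by
  obtain ⟨ψ, A, c, δ, hψ, hA, hc, hδ, hloc⟩ := hb.exists_local_separation hf hJ
  obtain ⟨I, ε, hε, hfar⟩ := hf.exists_far_separation hident hδ
  -- A product of numbers in (0, 1] instead of a minimum, so that an empty `I` needs no separate
  -- case.
  set c₂ := ∏ g ∈ I, min (ε g) 1 with hc₂
  have hc₂0 : 0 < c₂ := Finset.prod_pos fun g _ => lt_min (hε g) one_pos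
  have hc₂le : ∀ g ∈ I, c₂ ≤ ε g := fun g hg => by
    classical
    rw [hc₂, ← Finset.mul_prod_erase I _ hg]
    exact (mul_le_of_le_one_right (lt_min (hε g) one_pos).le
      (Finset.prod_le_one (fun g _ => (lt_min (hε g) one_pos).le) fun g _ => min_le_right _ _)).trans
      (min_le_left _ _)
  -- The zero statistic `none` serves the parameter `w₀` itself, also when the two other families
  -- are empty.
  refine ⟨Option (Fin d ⊕ I), inferInstance, fun k => match k with
    | none => fun _ => 0
    | some (Sum.inl i) => ψ i
    | some (Sum.inr g) => fun x => (g : BoundedContinuousFunction X ℝ) x,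
    |A| + ∑ g ∈ I, ‖g‖, min c c₂, ?_, ?_, lt_min hc hc₂0, ?_⟩
  · rintro (_ | i | g)
    · exact measurable_const
    · exact hψ i
    · exact (g : BoundedContinuousFunction X ℝ).continuous.measurable
  · have hS : 0 ≤ ∑ g ∈ I, ‖g‖ := Finset.sum_nonneg fun g _ => norm_nonneg g
    rintro (_ | i | g) x
    · simpa using add_nonneg (abs_nonneg A) hS
    · exact ((hA i x).trans (le_abs_self A)).trans (le_add_of_nonneg_right hS)
    · exact (((g : BoundedContinuousFunction X ℝ).norm_coe_le_norm x).trans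
        (Finset.single_le_sum (f := fun g => ‖g‖) (fun g _ => norm_nonneg g) g.2)).trans
        (le_add_of_nonneg_left (abs_nonneg A))
  · intro w hw
    have hm0 : 0 ≤ min ‖w - w₀‖ 1 := le_min (norm_nonneg _) zero_le_one
    by_cases h0 : w = w₀
    · exact ⟨none, by simp [h0]⟩
    rcases lt_or_ge ‖w - w₀‖ δ with h1 | h1
    · obtain ⟨i, hi⟩ := hloc (w - w₀) (sub_ne_zero.2 h0) h1 (by simpa using hw)
      rw [add_sub_cancel] at hi
      exact ⟨some (Sum.inl i), (mul_le_mul (min_le_left _ _) (min_le_left _ _) hm0 hc.le).trans hi⟩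
    · obtain ⟨g, hg, hgε⟩ := hfar w hw h1
      refine ⟨some (Sum.inr ⟨g, hg⟩), ((mul_le_mul (min_le_right _ _) (min_le_right _ _) hm0
        hc₂0.le).trans ?_).trans hgε⟩
      rw [mul_one]
      exact hc₂le g hg

end Identifiability

/-! ### From statistics of the observable to statistics of labelled data. -/

section Lift

variable {d : ℕ} {W : Set (Par d)} {w₀ : Par d} {X Λ : Type*} [MeasurableSpace X] [Fintype Λ]
  [MeasurableSpace Λ] [MeasurableSingletonClass Λ] {μ : Measure X} [SFinite μ]
  {f : X → Par d → ℝ} {g : X × Λ → Par d → ℝ}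

/-- Statistics of the observable keep their expectations under a family on observables with labels
whose marginal is the family of the observable. -/
lemma IsRegularFamily.integral_fst_mul (hg : IsRegularFamily (μ.prod Measure.count) W g w₀)
    (hsum : ∀ x w, ∑ t, g (x, t) w = f x w) {ψ : X → ℝ} (hψ : Measurable ψ) {A : ℝ}
    (hA : ∀ x, |ψ x| ≤ A) {w : Par d} (hw : w ∈ W) :
    ∫ z, ψ z.1 * g z w ∂μ.prod Measure.count = ∫ x, ψ x * f x w ∂μ := by
  have hi : Integrable (fun z : X × Λ => ψ z.1 * g z w) (μ.prod Measure.count) :=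
    (hg.integrable hw).bdd_mul (hψ.comp measurable_fst).aestronglyMeasurable
      (Eventually.of_forall fun z => hA z.1)
  rw [integral_prod _ hi]
  refine integral_congr_ae (Eventually.of_forall fun x => ?_)
  simp only [integral_count, ← Finset.mul_sum, hsum]

/-- A statistic that ignores the labels has the same mean under both families. Hence neither
identifiability nor definiteness has to be assumed for the labelled data. -/
lemma IsSeparating.comp_fst {ι : Type*} {ψ : ι → X → ℝ} {A c : ℝ} (hf : IsRegularFamily μ W f w₀)
    (hg : IsRegularFamily (μ.prod Measure.count) W g w₀)
    (hsum : ∀ x w, ∑ t, g (x, t) w = f x w) (hs : IsSeparating μ W f w₀ ψ A c) :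
    IsSeparating (μ.prod Measure.count) W g w₀ (fun k (z : X × Λ) => ψ k z.1) A c where
  measurable k := (hs.measurable k).comp measurable_fst
  bound k z := hs.bound k z.1
  pos := hs.pos
  sep w hw := by
    obtain ⟨k, hk⟩ := hs.sep w hw
    refine ⟨k, ?_⟩
    rwa [hg.integral_trueLaw, hg.integral_fst_mul hsum (hs.measurable k) (hs.bound k) hw,
      hg.integral_fst_mul hsum (hs.measurable k) (hs.bound k) hg.mem, ← hf.integral_trueLaw]

end Lift

/-! ### Samples of observables with labels -/

section Labelled

variable {d : ℕ} {X Λ : Type*}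

/-- The conditional probability of the labels `T` given the observations `x`. -/
def condProb (f : X → Par d → ℝ) (g : X × Λ → Par d → ℝ) (w₀ : Par d) {n : ℕ} (x : Fin n → X)
    (T : Fin n → Λ) : ℝ :=
  ∏ i, g (x i, T i) w₀ / f (x i) w₀

/-- Observations together with their labels. -/
def withLabels {n : ℕ} (T : Fin n → Λ) (x : Fin n → X) : Fin n → X × Λ := fun i => (x i, T i)

variable [MeasurableSpace X] [Fintype Λ] [MeasurableSpace Λ] [MeasurableSingletonClass Λ]
  {μ : Measure X} [SigmaFinite μ] {W : Set (Par d)} {w₀ : Par d} {φ : Par d → ℝ}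
  {f : X → Par d → ℝ} {g : X × Λ → Par d → ℝ}

omit [Fintype Λ] [MeasurableSingletonClass Λ] in
lemma measurable_withLabels {n : ℕ} (T : Fin n → Λ) :
    Measurable (withLabels T : (Fin n → X) → Fin n → X × Λ) :=
  measurable_pi_lambda _ fun i => (measurable_pi_apply i).prodMk measurable_const

omit [MeasurableSingletonClass Λ] [SigmaFinite μ] [MeasurableSpace X] [MeasurableSpace Λ] in
lemma sum_condProb (hsum : ∀ x w, ∑ t, g (x, t) w = f x w) {n : ℕ} {x : Fin n → X}
    (hx : ∀ i, 0 < f (x i) w₀) : ∑ T, condProb f g w₀ x T = 1 := by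
  classical
  simp only [condProb]
  rw [← Fintype.prod_sum fun i t => g (x i, t) w₀ / f (x i) w₀]
  refine Finset.prod_eq_one fun i _ => ?_
  rw [← Finset.sum_div, hsum, div_self (hx i).ne']

namespace IsRegularFamily

omit [Fintype Λ] [MeasurableSingletonClass Λ] [SigmaFinite μ] in
lemma condProb_nonneg (hf : IsRegularFamily μ W f w₀)
    (hg : IsRegularFamily (μ.prod Measure.count) W g w₀) {n : ℕ} (x : Fin n → X) (T : Fin n → Λ) :
    0 ≤ condProb f g w₀ x T :=
  Finset.prod_nonneg fun _ _ => div_nonneg (hg.nonneg _ _ hg.mem) (hf.nonneg _ _ hf.mem)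

omit [Fintype Λ] [MeasurableSingletonClass Λ] [SigmaFinite μ] in
lemma measurable_condProb (hf : IsRegularFamily μ W f w₀)
    (hg : IsRegularFamily (μ.prod Measure.count) W g w₀) {n : ℕ} (T : Fin n → Λ) :
    Measurable fun x : Fin n → X => condProb f g w₀ x T :=
  Finset.measurable_fun_prod _ fun i _ =>
    ((hg.measurable w₀).comp ((measurable_pi_apply i).prodMk measurable_const)).div
      ((hf.measurable w₀).comp (measurable_pi_apply i))

omit [Fintype Λ] [MeasurableSingletonClass Λ] [SigmaFinite μ] in
lemma measurable_indicator_condDensity (hf : IsRegularFamily μ W f w₀)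
    (hg : IsRegularFamily (μ.prod Measure.count) W g w₀) {s : Set (X × Λ)} (hs : MeasurableSet s)
    (t : Λ) : Measurable (((fun x : X => (x, t)) ⁻¹' s).indicator fun x =>
      ENNReal.ofReal (g (x, t) w₀ / f x w₀)) :=
  have hpair : Measurable fun x : X => (x, t) := measurable_id.prodMk measurable_const
  (((hg.measurable w₀).comp hpair).div (hf.measurable w₀)).ennreal_ofReal.indicator (hpair hs)

/-- Disintegration of the law of one labelled observation. Where f(x, w₀) = 0 the conditional
density is 0/0 = 0, which is harmless because the nonnegative g(x, t, w₀) sum to 0 there. -/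
lemma trueLaw_prod_apply (hf : IsRegularFamily μ W f w₀)
    (hg : IsRegularFamily (μ.prod Measure.count) W g w₀)
    (hsum : ∀ x w, ∑ t, g (x, t) w = f x w) {s : Set (X × Λ)} (hs : MeasurableSet s) :
    trueLaw (μ.prod Measure.count) g w₀ s
      = ∑ t, ∫⁻ x, ((fun x => (x, t)) ⁻¹' s).indicator
          (fun x => ENNReal.ofReal (g (x, t) w₀ / f x w₀)) x ∂trueLaw μ f w₀ := by
  rw [trueLaw, withDensity_apply _ hs, ← lintegral_indicator hs,
    lintegral_prod_symm' _ ((hg.measurable w₀).ennreal_ofReal.indicator hs), lintegral_count,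
    tsum_fintype]
  refine Finset.sum_congr rfl fun t _ => ?_
  rw [trueLaw, lintegral_withDensity_eq_lintegral_mul _ (hf.measurable w₀).ennreal_ofReal
    (hf.measurable_indicator_condDensity hg hs t)]
  refine lintegral_congr fun x => ?_
  rw [Pi.mul_apply]
  by_cases hx : (x, t) ∈ s
  · rw [Set.indicator_of_mem hx, Set.indicator_of_mem (s := (fun x : X => (x, t)) ⁻¹' s) hx,
      ← ENNReal.ofReal_mul (hf.nonneg _ _ hf.mem)]
    congr 1
    rcases eq_or_ne (f x w₀) 0 with h0 | h0
    · rw [h0, zero_mul]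
      rw [← hsum] at h0
      exact (Finset.sum_eq_zero_iff_of_nonneg fun t _ => hg.nonneg _ _ hg.mem).1 h0 t
        (Finset.mem_univ t)
    · field_simp
  · rw [Set.indicator_of_notMem hx,
      Set.indicator_of_notMem (s := (fun x : X => (x, t)) ⁻¹' s) hx, mul_zero]

/-- The law of a labelled sample: the observations are drawn first, the labels given them. -/
theorem sampleLaw_prod_eq_sum (hf : IsRegularFamily μ W f w₀)
    (hg : IsRegularFamily (μ.prod Measure.count) W g w₀)
    (hsum : ∀ x w, ∑ t, g (x, t) w = f x w) (n : ℕ) :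
    sampleLaw (trueLaw (μ.prod Measure.count) g w₀) n
      = ∑ T : Fin n → Λ, ((sampleLaw (trueLaw μ f w₀) n).withDensity fun x =>
          ENNReal.ofReal (condProb f g w₀ x T)).map (withLabels T) := by
  classical
  have := hf.isProbabilityMeasure
  have := hg.isProbabilityMeasure
  refine Measure.pi_eq fun s hs => ?_
  have hbox : MeasurableSet (Set.univ.pi s) := MeasurableSet.univ_pi hs
  simp_rw [hf.trueLaw_prod_apply hg hsum (hs _)]
  -- Product measures are determined on boxes, where a product of sums over single labels expands
  -- into a sum over label sequences.
  rw [Finset.prod_univ_sum, Fintype.piFinset_univ, Measure.finsetSum_apply]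
  refine Finset.sum_congr rfl fun T _ => ?_
  rw [Measure.map_apply (measurable_withLabels T) hbox,
    withDensity_apply _ (measurable_withLabels T hbox),
    ← lintegral_indicator (measurable_withLabels T hbox),
    ← lintegral_prod_apply_sampleLaw fun i =>
      hf.measurable_indicator_condDensity hg (hs i) (T i)]
  refine lintegral_congr fun x => ?_
  by_cases hx : ∀ i, (x i, T i) ∈ s i
  · rw [Set.indicator_of_mem (by simpa [withLabels] using hx), condProb,
      ENNReal.ofReal_prod_of_nonneg fun i _ =>
        div_nonneg (hg.nonneg _ _ hg.mem) (hf.nonneg _ _ hf.mem)]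
    exact Finset.prod_congr rfl fun i _ => 
      (Set.indicator_of_mem (s := (fun x : X => (x, T i)) ⁻¹' s i) (hx i)
        (fun x => ENNReal.ofReal (g (x, T i) w₀ / f x w₀))).symm
  · rw [Set.indicator_of_notMem (by simpa [withLabels] using hx)]
    push Not at hx
    obtain ⟨i, hi⟩ := hx
    exact (Finset.prod_eq_zero (Finset.mem_univ i)
      (Set.indicator_of_notMem (s := (fun x : X => (x, T i)) ⁻¹' s i) hi _)).symm

/-- Label sequences of conditional probability 0 carry no mass in the law of the labelled sample,
hence their exclusion. -/
lemma ae_withLabels (hf : IsRegularFamily μ W f w₀)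
    (hg : IsRegularFamily (μ.prod Measure.count) W g w₀)
    (hsum : ∀ x w, ∑ t, g (x, t) w = f x w) {n : ℕ} {p : (Fin n → X × Λ) → Prop}
    (hp : ∀ᵐ z ∂sampleLaw (trueLaw (μ.prod Measure.count) g w₀) n, p z) :
    ∀ᵐ x ∂sampleLaw (trueLaw μ f w₀) n, ∀ T, condProb f g w₀ x T ≠ 0 → p (withLabels T x) := by
  rw [hf.sampleLaw_prod_eq_sum hg hsum] at hp
  refine ae_all_iff.2 fun T => ?_
  have h1 := ae_mono (Finset.single_le_sum (f := fun T : Fin n → Λ =>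
    ((sampleLaw (trueLaw μ f w₀) n).withDensity fun x =>
      ENNReal.ofReal (condProb f g w₀ x T)).map (withLabels T)) (fun T _ => Measure.zero_le _)
    (Finset.mem_univ T)) hp
  have h2 := ae_of_ae_map (measurable_withLabels T).aemeasurable h1
  rw [ae_withDensity_iff (hf.measurable_condProb hg T).ennreal_ofReal] at h2
  filter_upwards [h2] with x hx hT
  exact hx (by simpa using (hf.condProb_nonneg hg x T).lt_of_ne' hT)

lemma integrable_condProb_mul (hf : IsRegularFamily μ W f w₀)
    (hg : IsRegularFamily (μ.prod Measure.count) W g w₀)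
    (hsum : ∀ x w, ∑ t, g (x, t) w = f x w) {n : ℕ} {F : (Fin n → X × Λ) → ℝ}
    (hF : Integrable F (sampleLaw (trueLaw (μ.prod Measure.count) g w₀) n)) (T : Fin n → Λ) :
    Integrable (fun x => condProb f g w₀ x T * F (withLabels T x))
      (sampleLaw (trueLaw μ f w₀) n) := by
  rw [hf.sampleLaw_prod_eq_sum hg hsum, integrable_finsetSum_measure] at hF
  have h := (hF T (Finset.mem_univ T)).comp_measurable (measurable_withLabels T)
  rw [integrable_withDensity_iff_integrable_smul' (hf.measurable_condProb hg T).ennreal_ofReal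
    (Eventually.of_forall fun _ => ENNReal.ofReal_lt_top)] at h
  simpa only [ENNReal.toReal_ofReal (hf.condProb_nonneg hg _ T), smul_eq_mul,
    Function.comp_apply] using h

lemma integral_sampleLaw_prod (hf : IsRegularFamily μ W f w₀)
    (hg : IsRegularFamily (μ.prod Measure.count) W g w₀)
    (hsum : ∀ x w, ∑ t, g (x, t) w = f x w) {n : ℕ} {F : (Fin n → X × Λ) → ℝ}
    (hF : Integrable F (sampleLaw (trueLaw (μ.prod Measure.count) g w₀) n)) :
    ∫ z, F z ∂sampleLaw (trueLaw (μ.prod Measure.count) g w₀) n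
      = ∑ T, ∫ x, condProb f g w₀ x T * F (withLabels T x) ∂sampleLaw (trueLaw μ f w₀) n := by
  rw [hf.sampleLaw_prod_eq_sum hg hsum] at hF ⊢
  rw [integrable_finsetSum_measure] at hF
  rw [integral_finsetSum_measure hF]
  refine Finset.sum_congr rfl fun T _ => ?_
  rw [integral_map (measurable_withLabels T).aemeasurable (hF T (Finset.mem_univ T)).1,
    integral_withDensity_eq_integral_toReal_smul (hf.measurable_condProb hg T).ennreal_ofReal
    (Eventually.of_forall fun _ => ENNReal.ofReal_lt_top)]
  simp only [ENNReal.toReal_ofReal (hf.condProb_nonneg hg _ T), smul_eq_mul]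

end IsRegularFamily

/-- The divergence between the true and the estimated conditional law of the labels, expressed by
the evidence ratios. -/
def evidenceLoss (W : Set (Par d)) (f : X → Par d → ℝ) (g : X × Λ → Par d → ℝ) (φ : Par d → ℝ)
    (w₀ : Par d) {n : ℕ} (x : Fin n → X) : ℝ :=
  Real.log (evidenceRatio W f φ w₀ x).toReal
    - ∑ T, condProb f g w₀ x T * Real.log (evidenceRatio W g φ w₀ (withLabels T x)).toReal

variable {r₁ r₂ : ℝ} {B₁ G₁ : X → ℝ} {B₂ G₂ : X × Λ → ℝ}

lemma integrable_evidenceLoss (hf : IsRegularFamily μ W f w₀)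
    (hg : IsRegularFamily (μ.prod Measure.count) W g w₀)
    (hsum : ∀ x w, ∑ t, g (x, t) w = f x w) (hfb : LocalBounds μ W f w₀ r₁ B₁ G₁)
    (hgb : LocalBounds (μ.prod Measure.count) W g w₀ r₂ B₂ G₂) (hφ : IsPriorAt W φ w₀) (n : ℕ) :
    Integrable (fun x => evidenceLoss W f g φ w₀ x) (sampleLaw (trueLaw μ f w₀) n) :=
  (hfb.integrable_log_evidenceRatio hf hφ n).sub (integrable_finsetSum _ fun T _ =>
    hf.integrable_condProb_mul hg hsum (hgb.integrable_log_evidenceRatio hg hφ n) T)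

lemma integral_evidenceLoss (hf : IsRegularFamily μ W f w₀)
    (hg : IsRegularFamily (μ.prod Measure.count) W g w₀)
    (hsum : ∀ x w, ∑ t, g (x, t) w = f x w) (hfb : LocalBounds μ W f w₀ r₁ B₁ G₁)
    (hgb : LocalBounds (μ.prod Measure.count) W g w₀ r₂ B₂ G₂) (hφ : IsPriorAt W φ w₀) (n : ℕ) :
    ∫ x, evidenceLoss W f g φ w₀ x ∂sampleLaw (trueLaw μ f w₀) n
      = ∫ x, Real.log (evidenceRatio W f φ w₀ x).toReal ∂sampleLaw (trueLaw μ f w₀) n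
        - ∫ z, Real.log (evidenceRatio W g φ w₀ z).toReal
          ∂sampleLaw (trueLaw (μ.prod Measure.count) g w₀) n := by
  have hi := hgb.integrable_log_evidenceRatio hg hφ n
  simp only [evidenceLoss]
  rw [integral_sub (hfb.integrable_log_evidenceRatio hf hφ n) (integrable_finsetSum _ fun T _ =>
    hf.integrable_condProb_mul hg hsum hi T), hf.integral_sampleLaw_prod hg hsum hi,
    integral_finsetSum _ fun T _ => hf.integrable_condProb_mul hg hsum hi T]

/-- The expected divergence tends to half the logarithm of the quotient of the determinants of the
Fisher information matrices. -/
theorem tendsto_integral_evidenceLoss (hf : IsRegularFamily μ W f w₀)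
    (hg : IsRegularFamily (μ.prod Measure.count) W g w₀)
    (hsum : ∀ x w, ∑ t, g (x, t) w = f x w) (hfb : LocalBounds μ W f w₀ r₁ B₁ G₁)
    (hgb : LocalBounds (μ.prod Measure.count) W g w₀ r₂ B₂ G₂) (hφ : IsPriorAt W φ w₀)
    {ι : Type*} [Fintype ι] {ψ : ι → X → ℝ} {A c : ℝ} (hs : IsSeparating μ W f w₀ ψ A c) :
    Tendsto (fun n : ℕ => ∫ x, evidenceLoss W f g φ w₀ x ∂sampleLaw (trueLaw μ f w₀) n) atTop
      (𝓝 (1 / 2 * Real.log ((scoreCov (μ.prod Measure.count) g w₀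
        * (scoreCov μ f w₀)⁻¹).det))) := by
  have hs' := hs.comp_fst hf hg hsum
  have hJf := hfb.posDef_scoreCov hf hs
  have hJg := hgb.posDef_scoreCov hg hs'
  -- In the difference the terms (d/2) log n, log φ(w₀), d/2 and the standard Gaussian integral
  -- cancel.
  have h := (hfb.tendsto_integral_log_evidenceRatio hf hφ hs).sub
    (hgb.tendsto_integral_log_evidenceRatio hg hφ hs')
  rw [log_gaussConst hJf, log_gaussConst hJg] at h
  have e : Real.log ((scoreCov (μ.prod Measure.count) g w₀ * (scoreCov μ f w₀)⁻¹).det)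
      = Real.log (scoreCov (μ.prod Measure.count) g w₀).det - Real.log (scoreCov μ f w₀).det := by
    rw [Matrix.det_mul, Matrix.det_nonsing_inv, Ring.inverse_eq_inv',
      Real.log_mul hJg.det_pos.ne' (inv_ne_zero hJf.det_pos.ne'), Real.log_inv, sub_eq_add_neg]
  rw [e]
  refine (h.congr fun n => ?_).trans_eq ?_
  · rw [integral_evidenceLoss hf hg hsum hfb hgb hφ n]
    ring
  · congr 1
    ring

end Labelled

/-! ### Latent variable models -/

section Nuisance

variable {M K L Kt : ℕ}

/-- With `Kt = K` nothing is summed out, so the joint error becomes a case of the marginal one. -/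
lemma margTarget_le_rfl (g : Obs M → Label K L → ℝ) (x : Obs M) (t : Label K L) :
    margTarget le_rfl g x t = g x t := by
  have h : ∀ y : Label K L, target le_rfl y = y := fun y => rfl
  simp [margTarget, h, Finset.filter_eq']

lemma sumNuisance_le_rfl {n : ℕ} (r : (Fin n → Label K L) → ℝ) (T : Fin n → Label K L) :
    sumNuisance le_rfl r T = r T := by
  have h : ∀ y : Label K L, target le_rfl y = y := fun y => rfl
  simp [sumNuisance, h, ← funext_iff, Finset.filter_eq']

lemma sum_margTarget (h : Kt ≤ K) (g : Obs M → Label K L → ℝ) (x : Obs M) :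
    ∑ t, margTarget h g x t = margX g x :=
  Finset.sum_fiberwise _ _ _

/-- The constraint on the labels acts on each observation separately, so the constrained sum of
products factorises. -/
lemma sum_filter_target_prod (h : Kt ≤ K) {n : ℕ} (a : Fin n → Label K L → ℝ)
    (T : Fin n → Label Kt L) :
    ∑ Y : Fin n → Label K L with (∀ i, target h (Y i) = T i), ∏ i, a i (Y i)
      = ∏ i, ∑ y with target h y = T i, a i y := by
  rw [Finset.prod_univ_sum]
  refine Finset.sum_congr ?_ fun _ _ => rfl
  ext Y
  simp

end Nuisance

namespace Model

variable {M K L d Kt : ℕ} (m : Model M K L d)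

instance : SigmaFinite m.μ := m.sigmaFinite

lemma measurable_uncurry_densX : Measurable fun z : Obs M × Par d => m.densX z.1 z.2 :=
  Finset.measurable_fun_sum _ fun y _ => m.measurable_p y

lemma measurable_uncurry_densTarget (h : Kt ≤ K) :
    Measurable fun z : (Obs M × Label Kt L) × Par d => m.densTarget h z.1 z.2 := by
  simp only [densTarget, margTarget, Finset.sum_filter]
  refine Finset.measurable_fun_sum _ fun y _ => Measurable.ite ?_ ?_ measurable_const
  · exact (measurable_snd.comp measurable_fst) (measurableSet_singleton (target h y)) |>.congr
      (by ext z; simp [eq_comm])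
  · exact (m.measurable_p y).comp ((measurable_fst.comp measurable_fst).prodMk measurable_snd)

lemma densX_nonneg (x : Obs M) {w : Par d} (hw : w ∈ m.W) : 0 ≤ m.densX x w :=
  Finset.sum_nonneg fun y _ => m.p_nonneg x y w hw

lemma densTarget_nonneg (h : Kt ≤ K) (z : Obs M × Label Kt L) {w : Par d} (hw : w ∈ m.W) :
    0 ≤ m.densTarget h z w :=
  Finset.sum_nonneg fun y _ => m.p_nonneg z.1 y w hw

lemma sum_densTarget (h : Kt ≤ K) (x : Obs M) (w : Par d) :
    ∑ t, m.densTarget h (x, t) w = m.densX x w :=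
  sum_margTarget h _ x

lemma integral_densX {w : Par d} (hw : w ∈ m.W) : ∫ x, m.densX x w ∂m.μ = 1 := m.integral_p w hw

lemma integral_densTarget (h : Kt ≤ K) {w : Par d} (hw : w ∈ m.W) :
    ∫ z, m.densTarget h z w ∂m.μ.prod Measure.count = 1 := by
  have hm : Measurable fun z => m.densTarget h z w :=
    (m.measurable_uncurry_densTarget h).comp
      (g := fun z : (Obs M × Label Kt L) × Par d => m.densTarget h z.1 z.2)
      (f := fun z => (z, w)) (measurable_id.prodMk measurable_const)
  have hm' : Measurable fun z => ENNReal.ofReal (m.densTarget h z w) := hm.ennreal_ofReal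
  rw [integral_eq_lintegral_of_nonneg_ae
    (Eventually.of_forall fun z => m.densTarget_nonneg h z hw) hm.aestronglyMeasurable,
    lintegral_prod _ hm'.aemeasurable]
  have hsum : ∀ x, ∑ t, ENNReal.ofReal (m.densTarget h (x, t) w) = ENNReal.ofReal (m.densX x w) :=
    fun x => by
      rw [← m.sum_densTarget h, ENNReal.ofReal_sum_of_nonneg fun t _ =>
        m.densTarget_nonneg h (x, t) hw]
  simp only [lintegral_count, tsum_fintype, hsum]
  rw [← ofReal_integral_eq_lintegral_ofReal
    (Integrable.of_integral_ne_zero (by rw [m.integral_densX hw]; exact one_ne_zero))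
    (Eventually.of_forall fun x => m.densX_nonneg x hw), m.integral_densX hw]
  simp

lemma isRegularFamily_densX {w₀ : Par d} (hw : w₀ ∈ m.W) (hreg : RegularAt m.μ m.W m.densX w₀) :
    IsRegularFamily m.μ m.W m.densX w₀ where
  measurableSet := m.measurableSet_W
  mem := hw
  measurable_uncurry := m.measurable_uncurry_densX
  nonneg x _ hw := m.densX_nonneg x hw
  integral_eq_one _ hw := m.integral_densX hw
  regular := hreg

lemma isRegularFamily_densTarget (h : Kt ≤ K) {w₀ : Par d} (hw : w₀ ∈ m.W)
    (hreg : RegularAt (m.μ.prod Measure.count) m.W (m.densTarget h) w₀) :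
    IsRegularFamily (m.μ.prod Measure.count) m.W (m.densTarget h) w₀ where
  measurableSet := m.measurableSet_W
  mem := hw
  measurable_uncurry := m.measurable_uncurry_densTarget h
  nonneg z _ hw := m.densTarget_nonneg h z hw
  integral_eq_one _ hw := m.integral_densTarget h hw
  regular := hreg

lemma isPriorAt {w₀ : Par d} (hc : ContinuousAt m.prior w₀) (hpos : 0 < m.prior w₀) :
    IsPriorAt m.W m.prior w₀ where
  measurable := m.measurable_prior
  nonneg := m.prior_nonneg
  integral_eq_one := m.integral_prior
  continuousAt := hc
  pos := hpos

/-- The true density at `w₀`. -/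
abbrev trueDens (w₀ : Par d) : Obs M → Label K L → ℝ := fun x y => m.p x y w₀

lemma infoX_eq_scoreCov {w₀ : Par d} (hf : IsRegularFamily m.μ m.W m.densX w₀) :
    m.infoX (m.trueDens w₀) w₀ = scoreCov m.μ m.densX w₀ := by
  ext i j
  exact (hf.integral_trueLaw _).symm

lemma infoTarget_eq_scoreCov (h : Kt ≤ K) {w₀ : Par d}
    (hg : IsRegularFamily (m.μ.prod Measure.count) m.W (m.densTarget h) w₀) :
    m.infoTarget (m.trueDens w₀) h w₀
      = scoreCov (m.μ.prod Measure.count) (m.densTarget h) w₀ := by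
  ext i j
  exact (hg.integral_trueLaw _).symm

lemma sumNuisance_trueCond (h : Kt ≤ K) (w₀ : Par d) {n : ℕ} (x : Fin n → Obs M)
    (T : Fin n → Label Kt L) :
    sumNuisance h (trueCond (m.trueDens w₀) x) T
      = condProb m.densX (m.densTarget h) w₀ x T := by
  simp only [sumNuisance, trueCond, condProb]
  rw [sum_filter_target_prod h fun i y => m.trueDens w₀ (x i) y / margX (m.trueDens w₀) (x i)]
  refine Finset.prod_congr rfl fun i _ => ?_
  rw [← Finset.sum_div]
  rfl

/-- Exchanges a finite sum and the integral. The summands are nonnegative on `W`, so each is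
dominated by their integrable sum. -/
lemma sumNuisance_estimated (h : Kt ≤ K) {n : ℕ} (x : Fin n → Obs M) (T : Fin n → Label Kt L)
    (hi : IntegrableOn (fun w => (∏ i, m.densTarget h (x i, T i) w) * m.prior w) m.W) :
    sumNuisance h (m.estimated x) T
      = (∫ w in m.W, (∏ i, m.densTarget h (x i, T i) w) * m.prior w) / m.evidenceX x := by
  have hsum : ∀ w, (∏ i, m.densTarget h (x i, T i) w) * m.prior w
      = ∑ Y : Fin n → Label K L with (∀ i, target h (Y i) = T i),
        (∏ i, m.p (x i) (Y i) w) * m.prior w := fun w => by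
    rw [← Finset.sum_mul, sum_filter_target_prod h fun i y => m.p (x i) y w]
    rfl
  have hn : ∀ (Y : Fin n → Label K L), ∀ w ∈ m.W, 0 ≤ (∏ i, m.p (x i) (Y i) w) * m.prior w :=
    fun Y w hw => mul_nonneg (Finset.prod_nonneg fun i _ => m.p_nonneg _ _ w hw)
      (m.prior_nonneg w hw)
  have hYi : ∀ Y ∈ Finset.univ.filter fun Y : Fin n → Label K L => ∀ i, target h (Y i) = T i,
      IntegrableOn (fun w => (∏ i, m.p (x i) (Y i) w) * m.prior w) m.W := by
    intro Y hY
    refine Integrable.mono' hi ?_ ?_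
    · exact ((Finset.measurable_fun_prod _ fun i _ => (m.measurable_p (Y i)).comp
        (measurable_const.prodMk measurable_id)).mul m.measurable_prior).aestronglyMeasurable
    · refine (ae_restrict_iff' m.measurableSet_W).2 (Eventually.of_forall fun w hw => ?_)
      rw [Real.norm_of_nonneg (hn Y w hw), hsum]
      exact Finset.single_le_sum (f := fun Y : Fin n → Label K L =>
        (∏ i, m.p (x i) (Y i) w) * m.prior w) (fun Y _ => hn Y w hw) hY
  simp_rw [hsum]
  rw [integral_finsetSum _ hYi, Finset.sum_div]
  rfl

/-- The true densities cancel: the logarithm of the ratio of the two conditional laws is log a - log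
b(T), and the conditional probabilities of the label sequences sum to 1. -/
lemma targetLoss_ae_eq (h : Kt ≤ K) {w₀ : Par d} (hf : IsRegularFamily m.μ m.W m.densX w₀)
    (hg : IsRegularFamily (m.μ.prod Measure.count) m.W (m.densTarget h) w₀)
    (hφ : IsPriorAt m.W m.prior w₀) (n : ℕ) :
    (fun x : Fin n → Obs M => m.targetLoss (m.trueDens w₀) h x)
      =ᵐ[sampleLaw (trueLaw m.μ m.densX w₀) n]
      fun x => evidenceLoss m.W m.densX (m.densTarget h) m.prior w₀ x := by
  have := hf.isProbabilityMeasure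
  obtain ⟨_, _, _, hfb⟩ := hf.exists_localBounds
  obtain ⟨_, _, _, hgb⟩ := hg.exists_localBounds
  filter_upwards [ae_sampleLaw_forall n hf.ae_trueLaw_pos, hfb.ae_evidenceRatio_pos hf hφ n,
    hf.ae_withLabels hg (m.sum_densTarget h) (hgb.ae_evidenceRatio_pos hg hφ n)] with x hx hYx hYT
  set a := (evidenceRatio m.W m.densX m.prior w₀ x).toReal with ha
  set b : (Fin n → Label Kt L) → ℝ := fun T =>
    (evidenceRatio m.W (m.densTarget h) m.prior w₀ (withLabels T x)).toReal with hb
  have hterm : ∀ T, sumNuisance h (trueCond (m.trueDens w₀) x) T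
        * Real.log (sumNuisance h (trueCond (m.trueDens w₀) x) T / sumNuisance h (m.estimated x) T)
      = condProb m.densX (m.densTarget h) w₀ x T * Real.log a
        - condProb m.densX (m.densTarget h) w₀ x T * Real.log (b T) := by
    intro T
    rw [m.sumNuisance_trueCond]
    -- A term of conditional probability 0 vanishes whatever its logarithm; otherwise the evidence
    -- of the labelled sample is positive.
    by_cases hT : condProb m.densX (m.densTarget h) w₀ x T = 0
    · simp [hT]
    have hbT : 0 < b T := hYT T hT
    have hgT : ∀ i, 0 < m.densTarget h (withLabels T x i) w₀ := fun i =>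
      (hg.nonneg _ _ hg.mem).lt_of_ne' fun h0 => hT
        (Finset.prod_eq_zero (Finset.mem_univ i) (div_eq_zero_iff.2 (Or.inl h0)))
    have e1 : ∫ w in m.W, (∏ i, m.densTarget h (x i, T i) w) * m.prior w
        = (∏ i, m.densTarget h (x i, T i) w₀) * b T := hg.integral_prod_mul_prior hφ hgT
    have e2 : m.evidenceX x = (∏ i, m.densX (x i) w₀) * a := hf.integral_prod_mul_prior hφ hx
    have hg0 : 0 < ∏ i, m.densTarget h (x i, T i) w₀ := Finset.prod_pos fun i _ => hgT i
    have hf0 : 0 < ∏ i, m.densX (x i) w₀ := Finset.prod_pos fun i _ => hx i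
    have hi : IntegrableOn (fun w => (∏ i, m.densTarget h (x i, T i) w) * m.prior w) m.W :=
      Integrable.of_integral_ne_zero (by rw [e1]; exact (mul_pos hg0 hbT).ne')
    rw [m.sumNuisance_estimated h x T hi, e1, e2, ← mul_sub, ← Real.log_div hYx.ne' hbT.ne']
    congr 2
    rw [condProb, Finset.prod_div_distrib]
    field_simp
  rw [targetLoss, klSum, Finset.sum_congr rfl fun T _ => hterm T, Finset.sum_sub_distrib,
    ← Finset.sum_mul, sum_condProb (m.sum_densTarget h) hx, one_mul]
  rfl

/-- The asymptotic expansion of the expected divergence of the estimated law of the target labels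
from the true one. -/
theorem integrable_targetLoss_and_isLittleO (h : Kt ≤ K) {w₀ : Par d} (hw : w₀ ∈ m.W)
    (hident : m.IdentifiableAt w₀) (hc : ContinuousAt m.prior w₀) (hpos : 0 < m.prior w₀)
    (hregX : RegularAt m.μ m.W m.densX w₀)
    (hreg : RegularAt (m.μ.prod Measure.count) m.W (m.densTarget h) w₀)
    (hinfo : (m.infoX (m.trueDens w₀) w₀).PosDef) :
    (∀ n : ℕ, Integrable (fun x => m.targetLoss (m.trueDens w₀) h x)
      (lawX m.μ (m.trueDens w₀) n)) ∧
    (fun n : ℕ => m.errorTarget (m.trueDens w₀) h n - 1 / (2 * (n : ℝ))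
        * Real.log ((m.infoTarget (m.trueDens w₀) h w₀ * (m.infoX (m.trueDens w₀) w₀)⁻¹).det))
      =o[atTop] fun n : ℕ => 1 / (n : ℝ) := by
  have hf := m.isRegularFamily_densX hw hregX
  have hg := m.isRegularFamily_densTarget h hw hreg
  have hφ := m.isPriorAt hc hpos
  obtain ⟨_, _, _, hfb⟩ := hf.exists_localBounds
  obtain ⟨_, _, _, hgb⟩ := hg.exists_localBounds
  rw [m.infoX_eq_scoreCov hf] at hinfo ⊢
  rw [m.infoTarget_eq_scoreCov h hg]
  obtain ⟨ι, _, ψ, A, c, hs⟩ := hfb.exists_isSeparating hf hinfo hident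
  have hlim := tendsto_integral_evidenceLoss hf hg (m.sum_densTarget h) hfb hgb hφ hs
  set D := Real.log ((scoreCov (m.μ.prod Measure.count) (m.densTarget h) w₀
    * (scoreCov m.μ m.densX w₀)⁻¹).det)
  refine ⟨fun n => (integrable_evidenceLoss hf hg (m.sum_densTarget h) hfb hgb hφ n).congr
    (m.targetLoss_ae_eq h hf hg hφ n).symm, ?_⟩
  have hint : ∀ n : ℕ, ∫ x, m.targetLoss (m.trueDens w₀) h x ∂lawX m.μ (m.trueDens w₀) n
      = ∫ x, evidenceLoss m.W m.densX (m.densTarget h) m.prior w₀ x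
        ∂sampleLaw (trueLaw m.μ m.densX w₀) n := fun n =>
    integral_congr_ae (m.targetLoss_ae_eq h hf hg hφ n)
  have hlim0 := hlim.sub_const (1 / 2 * D)
  rw [sub_self] at hlim0
  -- The error function is 1/n times an expectation converging to half of `D`, so the difference is
  -- 1/n times a null sequence.
  have hO := (isBigO_refl (fun n : ℕ => 1 / (n : ℝ)) atTop).mul_isLittleO
    ((isLittleO_one_iff ℝ).2 hlim0)
  simp only [mul_one] at hO
  refine hO.congr_left fun n => ?_
  rw [errorTarget, hint]
  ring

end Model

end LatentBayes

end

theorem mainTheorem3 {M K L d : ℕ} (m : LatentBayes.Model M K L d)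
    (q : LatentBayes.Obs M → LatentBayes.Label K L → ℝ) (wstar : LatentBayes.Par d)
    (hw : wstar ∈ m.W) (hq : ∀ x y, m.p x y wstar = q x y)
    (hident : m.IdentifiableAt wstar)
    (hprior_cont : ContinuousAt m.prior wstar) (hprior_pos : 0 < m.prior wstar)
    (hregX : LatentBayes.RegularAt m.μ m.W m.densX wstar)
    (hregXY : LatentBayes.RegularAt (m.μ.prod Measure.count) m.W m.densXY wstar)
    (hinfo : (m.infoX q wstar).PosDef) :
    ((∀ n : ℕ, Integrable (fun X => m.jointLoss q X) (LatentBayes.lawX m.μ q n)) ∧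
      (fun n : ℕ => m.errorJoint q n
          - 1 / (2 * (n : ℝ)) * Real.log ((m.infoXY q wstar * (m.infoX q wstar)⁻¹).det))
        =o[atTop] (fun n : ℕ => 1 / (n : ℝ))) ∧
    ∀ (Kt : ℕ) (hKt : Kt < K),
      LatentBayes.RegularAt (m.μ.prod Measure.count) m.W (m.densTarget hKt.le) wstar →
      (∀ n : ℕ, Integrable (fun X => m.targetLoss q hKt.le X) (LatentBayes.lawX m.μ q n)) ∧
      (fun n : ℕ => m.errorTarget q hKt.le n
          - 1 / (2 * (n : ℝ)) * Real.log ((m.infoTarget q hKt.le wstar * (m.infoX q wstar)⁻¹).det))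
        =o[atTop] (fun n : ℕ => 1 / (n : ℝ)) := by
  obtain rfl : q = m.trueDens wstar := funext fun x => funext fun y => (hq x y).symm
  -- The joint statement is the marginal one with `Kt = K`, which is why that theorem allows `Kt ≤
  -- K`.
  have hXY : m.densTarget le_rfl = m.densXY := funext fun z => funext fun w =>
    LatentBayes.margTarget_le_rfl _ _ _
  have hloss : ∀ {n : ℕ} (X : Fin n → LatentBayes.Obs M),
      m.targetLoss (m.trueDens wstar) le_rfl X = m.jointLoss (m.trueDens wstar) X := fun X => by
    simp only [LatentBayes.Model.targetLoss, LatentBayes.Model.jointLoss, LatentBayes.klSum,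
      LatentBayes.sumNuisance_le_rfl]
  have hinfoXY : m.infoTarget (m.trueDens wstar) le_rfl wstar
      = m.infoXY (m.trueDens wstar) wstar := by
    simp only [LatentBayes.Model.infoTarget, LatentBayes.Model.infoXY, hXY,
      LatentBayes.margTarget_le_rfl]
  refine ⟨?_, fun Kt hKt hreg => m.integrable_targetLoss_and_isLittleO hKt.le hw hident hprior_cont
    hprior_pos hregX hreg hinfo⟩
  have h := m.integrable_targetLoss_and_isLittleO le_rfl hw hident hprior_cont hprior_pos hregX
    (hXY ▸ hregXY) hinfo
  simpa only [LatentBayes.Model.errorTarget, LatentBayes.Model.errorJoint, hloss, hinfoXY] using h
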